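/- **Setting.** Let $L_1,L_2\ge 1$ be such that $n_F=(L_1-1)(L_2-1)$ is odd, and let $m=L_1L_2$. Consider the square lattice with vertices $v=(x,y)$, $0\le x<L_1$, $0\le y<L_2$, and faces $(x,y)$ named by their lower left vertex. Horizontal edges are oriented to the left if $y$ is even and to the right if $y$ is odd; vertical edges are oriented downwards if $x$ is even and upwards if $x$ is odd. Label the face $(x,y)$ odd if $x+y$ is even, and even otherwise (so there is one more odd face than even faces and the corner faces are odd: "case III"). Place a qubit on every vertex and on every odd face. For an edge with tail $i$ and head $j$ let $f$ be the odd face bordering it, if there is one, and put $$\tilde E_{ij}=X_iY_jX_f\ \text{(downward edge)},\qquad \tilde E_{ij}=-X_iY_jX_f\ \text{(upward edge)},\qquad \tilde E_{ij}=X_iY_jY_f\ \text{(horizontal edge)},$$ where the factor on $f$ is omitted if there is no such face; put $\tilde E_{ji}=-\tilde E_{ij}$ and $\tilde V_j=Z_j$. The stabilizer of a face with vertices $a,b,c,d$ in cyclic order is $\tilde E_{ab}\tilde E_{bc}\tilde E_{cd}\tilde E_{da}$, and the code space $\mathcal L$ is the joint $+1$ eigenspace of the stabilizers different from the identity. For a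 corner vertex $c$ of the lattice let $M_c=X_c$ if the edges at $c$ point into $c$, and $M_c=Y_c$ if they point away from $c$. Let $F_m=\bigoplus_{n=0}^m\bigwedge^n\mathbb C^m$ be the fermionic Fock space whose modes are the vertices, with annihilation operators $a_j$, and put $\gamma_j=a_j+a_j^\dagger$, $\bar\gamma_j=-i(a_j-a_j^\dagger)$, $E_{jk}=-i\gamma_j\gamma_k$, $V_j=-i\gamma_j\bar\gamma_j$. For a sign $\varepsilon\in\{1,-1\}$ let the hole operators be $h_j=i\varepsilon\,\gamma_j\prod_kV_k$. Write $L(S)$ for the algebra of linear operators on $S$. **Theorem.** The encoding uses $m+\lceil n_F/2\rceil$ qubits, exactly $\lfloor n_F/2\rfloor$ of the face stabilizers are different from the identity, and $\mathcal L\subset(\mathbb C^2)^{\otimes(m+\lceil n_F/2\rceil)}$ has dimension $2^{m+1}$. The lattice has exactly four corner vertices, and for every enumeration $c,c_x,c_y,c_z$ of them there is a sign $\varepsilon$ such that: 1. the operators $I\otimes E_{jk}$ ($j,k$ adjacent), $I\otimes V_j$, $I\otimes\gamma_c$, $X\otimes h_{c_x}$, $Y\otimes h_{c_y}$, $Z\otimes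 h_{c_z}$ generate the algebra $L(\mathbb C^2\otimes F_m)$; 2. there are a $*$-isomorphism $\mu:L(\mathbb C^2\otimes F_m)\to L(\mathcal L)$ and a surjective isometry $J:\mathbb C^2\otimes F_m\to\mathcal L$ with $\mu(T)=JTJ^\dagger$ for all $T$, such that $$\mu(I\otimes E_{jk})=\tilde E_{jk}|_{\mathcal L}\ (j,k\text{ adjacent}),\quad \mu(I\otimes V_j)=\tilde V_j|_{\mathcal L},\quad \mu(I\otimes\gamma_c)=M_c|_{\mathcal L},$$ $$\mu(X\otimes h_{c_x})=M_{c_x}|_{\mathcal L},\quad \mu(Y\otimes h_{c_y})=M_{c_y}|_{\mathcal L},\quad \mu(Z\otimes h_{c_z})=M_{c_z}|_{\mathcal L},$$ where in particular all operators on the right-hand sides map $\mathcal L$ into itself. -/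

import Mathlib

open scoped TensorProduct

noncomputable section

namespace Compact

/-- Subspaces of a Hilbert space.  (This abbreviation and the next one make Lean derive the linear
structures from the Hilbert space structures.) -/
abbrev HilbertSubspace (E : Type) [NormedAddCommGroup E] [InnerProductSpace ℂ E] : Type := Submodule ℂ E

/-- The tensor product of (finite-dimensional) Hilbert spaces. -/
abbrev HilbertTensor (E F : Type) [NormedAddCommGroup E] [InnerProductSpace ℂ E]
    [NormedAddCommGroup F] [InnerProductSpace ℂ F] : Type := E ⊗[ℂ] F

/-! ### Fermionic Fock space -/

section Fock

variable (V : Type) [Fintype V] [DecidableEq V]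

/-- A word of at most `m = |V|` modes.  The words of length `n` index the product basis of the
tensor power `(ℂ^V)^{⊗ n}`. -/
abbrev Word : Type := Σ n : Fin (Fintype.card V + 1), (Fin n → V)

/-- The full fermionic Fock space `F_m = ⨁_{n=0}^m ⋀ⁿ ℂ^m` on the set `V` of `m = |V|` modes, as a
subspace of the orthogonal direct sum `⨁_{n=0}^m (ℂ^V)^{⊗ n}`: the vectors all of whose components
are antisymmetric under permutations of the tensor factors. -/
def fockSubmodule : HilbertSubspace (EuclideanSpace ℂ (Word V)) where
  carrier := {ψ | ∀ (n : Fin (Fintype.card V + 1)) (π : Equiv.Perm (Fin n)) (x : Fin n → V),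
    ψ ⟨n, x ∘ π⟩ = ((Equiv.Perm.sign π : ℤ) : ℂ) * ψ ⟨n, x⟩}
  add_mem' {φ ψ} hφ hψ n π x := by simp [hφ n π x, hψ n π x, mul_add]
  zero_mem' n π x := by simp
  smul_mem' c ψ hψ n π x := by simp [hψ n π x, mul_left_comm]

/-- The Fock space as a Hilbert space. -/
abbrev Fock : Type := fockSubmodule V

variable {V}

/-- The annihilation operator `a_j`, from the `(n+1)`-fermion sector to the `n`-fermion sector:
`(a_j ψ)(x₁, …, xₙ) = √(n+1) ψ(j, x₁, …, xₙ)`. -/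
def annihilate (j : V) : Module.End ℂ (Fock V) where
  toFun ψ := ⟨WithLp.toLp 2 fun w : Word V =>
    if h : (w.1 : ℕ) < Fintype.card V then
      ((Real.sqrt ((w.1 : ℕ) + 1) : ℝ) : ℂ) *
        (ψ : EuclideanSpace ℂ (Word V)) ⟨⟨(w.1 : ℕ) + 1, Nat.succ_lt_succ h⟩, Fin.cons j w.2⟩
    else 0, by
    intro n π x
    by_cases h : (n : ℕ) < Fintype.card V
    · have h' := ψ.2 ⟨n + 1, Nat.succ_lt_succ h⟩ (Equiv.Perm.decomposeFin.symm (0, π)) (Fin.cons j x)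
      have e : (Fin.cons j x : Fin (n + 1) → V) ∘ (Equiv.Perm.decomposeFin.symm (0, π))
          = Fin.cons j (x ∘ π) := by
        funext k
        refine Fin.cases ?_ (fun k => ?_) k <;> simp
      simp only [e, Equiv.Perm.decomposeFin.symm_sign, if_true, one_mul] at h'
      simp only [dif_pos h]
      rw [h', mul_left_comm]
    · simp only [dif_neg h, mul_zero]⟩
  map_add' φ ψ := by
    ext w
    by_cases h : (w.1 : ℕ) < Fintype.card V
    · simp only [dif_pos h, Submodule.coe_add, PiLp.add_apply, mul_add]
    · simp only [dif_neg h, Submodule.coe_add, PiLp.add_apply, add_zero]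
  map_smul' c ψ := by
    ext w
    by_cases h : (w.1 : ℕ) < Fintype.card V
    · simp only [dif_pos h, Submodule.coe_smul, PiLp.smul_apply, smul_eq_mul, RingHom.id_apply,
        mul_left_comm]
    · simp only [dif_neg h, Submodule.coe_smul, PiLp.smul_apply, smul_zero]

/-- The creation operator `a_j†`. -/
def create (j : V) : Module.End ℂ (Fock V) := LinearMap.adjoint (annihilate j)

/-- The Majorana operator `γ_j = a_j + a_j†`. -/
def majorana (j : V) : Module.End ℂ (Fock V) := annihilate j + create j

/-- The Majorana operator `γ̄_j = (a_j - a_j†) / i`. -/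
def majoranaBar (j : V) : Module.End ℂ (Fock V) := (-Complex.I) • (annihilate j - create j)

/-- The fermionic edge operator `E_{jk} = -i γ_j γ_k`. -/
def edgeOp (j k : V) : Module.End ℂ (Fock V) := (-Complex.I) • (majorana j * majorana k)

/-- The fermionic vertex operator `V_j = -i γ_j γ̄_j`. -/
def vertexOp (j : V) : Module.End ℂ (Fock V) := (-Complex.I) • (majorana j * majoranaBar j)

/-- The fermion parity `∏_k V_k`.  The factors commute, so the order of the product plays
no role. -/
def parity : Module.End ℂ (Fock V) := ((Finset.univ : Finset V).toList.map vertexOp).prod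

/-- The (self-adjoint) hole operator `h_j = i ε γ_j ∏_k V_k` with sign convention `ε`. -/
def hole (ε : ℤˣ) (j : V) : Module.End ℂ (Fock V) :=
  (((ε : ℤ) : ℂ) * Complex.I) • (majorana j * parity)

end Fock

/-! ### Pauli operators -/

def pauliX : Matrix (Fin 2) (Fin 2) ℂ := !![0, 1; 1, 0]
def pauliY : Matrix (Fin 2) (Fin 2) ℂ := !![0, -Complex.I; Complex.I, 0]
def pauliZ : Matrix (Fin 2) (Fin 2) ℂ := !![1, 0; 0, -1]

/-- The Hilbert space `(ℂ²)^{⊗ Q}` of a set `Q` of qubits, in its computational basis. -/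
abbrev QubitSpace (Q : Type) [Fintype Q] : Type := EuclideanSpace ℂ (Q → Fin 2)

/-- The operator `⨂_q M_q` on `(ℂ²)^{⊗ Q}`, with `M_q` acting on the qubit `q`. -/
def tensorOp {Q : Type} [Fintype Q] [DecidableEq Q] (M : Q → Matrix (Fin 2) (Fin 2) ℂ) :
    Module.End ℂ (QubitSpace Q) :=
  Matrix.toEuclideanLin (Matrix.of fun s t : Q → Fin 2 => ∏ q, M q (s q) (t q))

/-- `M` acting on the single qubit `q`. -/
def onQubit {Q : Type} [Fintype Q] [DecidableEq Q] (q : Q) (M : Matrix (Fin 2) (Fin 2) ℂ) :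
    Module.End ℂ (QubitSpace Q) :=
  tensorOp (Function.update (fun _ => 1) q M)

/-! ### The lattice -/

/-- Vertices `(x, y)` of the `L₁ × L₂` square lattice; these are also the fermionic modes. -/
abbrev Vertex (L₁ L₂ : ℕ) : Type := Fin L₁ × Fin L₂

/-- Faces, named by their lower left vertex. -/
abbrev Face (L₁ L₂ : ℕ) : Type := Fin (L₁ - 1) × Fin (L₂ - 1)

variable {L₁ L₂ : ℕ}

/-- The checkerboard labelling in which the corner face at the origin is labelled odd
(the "extra odd face" when the number of faces is odd). -/
def IsOddFace (f : Face L₁ L₂) : Prop := Even ((f.1 : ℕ) + (f.2 : ℕ))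

instance (f : Face L₁ L₂) : Decidable (IsOddFace f) := by unfold IsOddFace; infer_instance

variable (L₁ L₂) in
/-- One qubit for each vertex and one for each odd face. -/
abbrev Qubit : Type := Vertex L₁ L₂ ⊕ {f : Face L₁ L₂ // IsOddFace f}

/-- `v` is one of the four vertices of the face `f`. -/
def Touches (f : Face L₁ L₂) (v : Vertex L₁ L₂) : Prop :=
  ((v.1 : ℕ) = f.1 ∨ (v.1 : ℕ) = f.1 + 1) ∧ ((v.2 : ℕ) = f.2 ∨ (v.2 : ℕ) = f.2 + 1)

instance (f : Face L₁ L₂) (v : Vertex L₁ L₂) : Decidable (Touches f v) := by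
  unfold Touches; infer_instance

/-- There is a lattice edge pointing from `i` to `j`.  Horizontal edges point left in even rows
and right in odd rows; vertical edges point down in even columns and up in odd columns.  Thus the
edges circulate around every even face. -/
def Arrow (i j : Vertex L₁ L₂) : Prop :=
  (i.2 = j.2 ∧ ((Even (i.2 : ℕ) ∧ (i.1 : ℕ) = j.1 + 1) ∨ (Odd (i.2 : ℕ) ∧ (j.1 : ℕ) = i.1 + 1))) ∨
  (i.1 = j.1 ∧ ((Even (i.1 : ℕ) ∧ (i.2 : ℕ) = j.2 + 1) ∨ (Odd (i.1 : ℕ) ∧ (j.2 : ℕ) = i.2 + 1)))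

instance (i j : Vertex L₁ L₂) : Decidable (Arrow i j) := by unfold Arrow; infer_instance

/-- `i` and `j` are the ends of an edge. -/
def Adjacent (i j : Vertex L₁ L₂) : Prop := Arrow i j ∨ Arrow j i

/-- The encoded operator of an edge with tail `i` and head `j`: `X_i Y_j` times a Pauli operator
on the unique odd face bordering the edge, if there is one: `Y` for horizontal edges, `X` for
vertical ones.  There is a sign `-1` if the edge points up. -/
def arrowOp (i j : Vertex L₁ L₂) : Module.End ℂ (QubitSpace (Qubit L₁ L₂)) :=
  (if (i.2 : ℕ) < j.2 then (-1 : ℂ) else 1) •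
    tensorOp (Sum.elim
      (fun v => if v = i then pauliX else if v = j then pauliY else 1)
      (fun f => if Touches f.1 i ∧ Touches f.1 j then
        (if i.2 = j.2 then pauliY else pauliX) else 1))

/-- The encoded edge operator `Ẽ_{ij}` of adjacent vertices, with `Ẽ_{ji} = -Ẽ_{ij}`. -/
def encodedEdge (i j : Vertex L₁ L₂) : Module.End ℂ (QubitSpace (Qubit L₁ L₂)) :=
  if Arrow i j then arrowOp i j else if Arrow j i then -arrowOp j i else 0

/-- The encoded vertex operator `Ṽ_j = Z_j`. -/
def encodedVertex (j : Vertex L₁ L₂) : Module.End ℂ (QubitSpace (Qubit L₁ L₂)) :=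
  onQubit (Sum.inl j) pauliZ

/-- The vertex of the face `f` displaced by `(dx, dy)` from its lower left vertex. -/
def faceVertex (f : Face L₁ L₂) (dx dy : Fin 2) : Vertex L₁ L₂ :=
  (⟨f.1 + dx, by omega⟩, ⟨f.2 + dy, by omega⟩)

/-- The stabilizer of a face: the product (with the factor `i⁴ = 1`) of the encoded edge operators
along the loop around the face. -/
def stabilizer (f : Face L₁ L₂) : Module.End ℂ (QubitSpace (Qubit L₁ L₂)) :=
  encodedEdge (faceVertex f 0 0) (faceVertex f 1 0) *
  encodedEdge (faceVertex f 1 0) (faceVertex f 1 1) *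
  encodedEdge (faceVertex f 1 1) (faceVertex f 0 1) *
  encodedEdge (faceVertex f 0 1) (faceVertex f 0 0)

variable (L₁ L₂) in
/-- The code space `𝓛`: the joint `+1` eigenspace of the non-trivial stabilizers. -/
def codeSpace : HilbertSubspace (QubitSpace (Qubit L₁ L₂)) :=
  ⨅ f : {f : Face L₁ L₂ // stabilizer f ≠ 1}, LinearMap.ker (stabilizer f.1 - 1)

variable (L₁ L₂) in
/-- The corner vertices of the lattice. -/
def corners : Set (Vertex L₁ L₂) :=
  {v | ((v.1 : ℕ) = 0 ∨ (v.1 : ℕ) + 1 = L₁) ∧ ((v.2 : ℕ) = 0 ∨ (v.2 : ℕ) + 1 = L₂)}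

/-- The operator of a corner `c`: `X_c` if the edges at `c` point into `c`, and `Y_c` if they
point away from it. -/
def cornerOp (c : Vertex L₁ L₂) : Module.End ℂ (QubitSpace (Qubit L₁ L₂)) :=
  if ∀ j, ¬ Arrow c j then onQubit (Sum.inl c) pauliX else onQubit (Sum.inl c) pauliY

/-! ### The logical space `ℂ² ⊗ F_m` -/

variable (L₁ L₂) in
/-- The logical space `ℂ² ⊗ F_m`: a qubit and the Fock space with the vertices as modes. -/
abbrev Logical : Type := HilbertTensor (EuclideanSpace ℂ (Fin 2)) (Fock (Vertex L₁ L₂))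

/-- The logical operator `P ⊗ T`. -/
def logicalOp (P : Matrix (Fin 2) (Fin 2) ℂ) (T : Module.End ℂ (Fock (Vertex L₁ L₂))) :
    Module.End ℂ (Logical L₁ L₂) :=
  TensorProduct.map (Matrix.toEuclideanLin P) T

/-- `S` is the restriction of `T` to the subspace `U` (in particular `T` maps `U` into `U`). -/
def IsRestriction {H : Type} [NormedAddCommGroup H] [InnerProductSpace ℂ H] {U : HilbertSubspace H}
    (S : Module.End ℂ U) (T : Module.End ℂ H) : Prop :=
  ∀ ψ : U, (S ψ : H) = T ψ

end Compact

end

/-!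
The logical operators and the encoded operators are both representations of one Clifford algebra.

On `ℂ² ⊗ F_m` the Majorana operators `1 ⊗ γ_v`, `1 ⊗ γ̄_v` together with `X ⊗ P` and `Y ⊗ P`, where
`P` is the fermion parity, are `2(m+1)` pairwise anticommuting self-adjoint involutions
(`logicalFamily_isClifford`). For this one needs the canonical anticommutation relations on the Fock
space, which follow from an explicit formula for the creation operators
(`annihilate_mul_create`).

On the code space such a family is found as follows. Encoded edge operators anticommute if the edges
share exactly one vertex, since perpendicular edges with a common tail or a common head border
exactly one common odd face (`twist_arrowOp`). Hence the product of a corner operator `M_c` with the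
edge operators along a path from `c` to `v` behaves like a Majorana operator `Γ_v` of `v`. The paths
are taken in a spanning tree, and the stabilizers of the faces show that `E_ij = -i Γ_i Γ_j` holds on
the code space for all edges and not only for those of the tree (`exists_majoranas`). For a second
corner `x` the operator `i M_x Γ_x` anticommutes with all Majorana operators; the operators of two
such corners complete the family (`cornerFamily_isClifford`).

Both spaces have dimension `2^(m+1)`: the Fock space because antisymmetric tensors are determined by
their values on sets of modes (`finrank_fock`), and the code space because each even face has a
single-qubit operator that anticommutes with its stabilizer and commutes with the stabilizers of the
faces that are not closer to the origin, so that each stabilizer halves the dimension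
(`finrank_codeSpace`). Two representations of equal dimension of a Clifford algebra with an even
number of generators are unitarily equivalent (`IsClifford.exists_isometry`), which gives `J`. In
dimension `2^(m+1)` the generators generate all operators (`IsClifford.adjoin_eq_top`); so the
logical operators generate, and the operator of the remaining corner is determined up to a sign,
because up to a scalar there is only one operator that anticommutes with all generators
(`exists_corner_sign`). The sign `ε` of the hole operators is chosen accordingly.
-/

open scoped TensorProduct

noncomputable section

namespace Compact

/-! ### Halving a space by an involution -/

section Halving

variable {H : Type} [AddCommGroup H] [Module ℂ H]

/-- The `+1` eigenspace of an operator. -/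
def fixedSpace (Z : Module.End ℂ H) : Submodule ℂ H := LinearMap.ker (Z - 1)

lemma mem_fixedSpace {Z : Module.End ℂ H} {x : H} : x ∈ fixedSpace Z ↔ Z x = x := by
  simp [fixedSpace, sub_eq_zero]

lemma apply_mem_fixedSpace {Z T : Module.End ℂ H} (h : T * Z = Z * T) {x : H}
    (hx : x ∈ fixedSpace Z) : T x ∈ fixedSpace Z := by
  rw [mem_fixedSpace] at *
  have := LinearMap.congr_fun h x
  simp only [Module.End.mul_apply, hx] at this
  exact this.symm

/-- The spectral projection `(1 + Z) / 2` of an involution `Z` onto its `+1` eigenspace. -/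
def fixedProj (Z : Module.End ℂ H) (hZ : Z * Z = 1) : H →ₗ[ℂ] fixedSpace Z :=
  LinearMap.codRestrict _ ((1 / 2 : ℂ) • (1 + Z)) fun x => by
    have := LinearMap.congr_fun hZ x
    simp only [Module.End.mul_apply, Module.End.one_apply] at this
    simp [mem_fixedSpace, this, add_comm]

lemma coe_fixedProj {Z : Module.End ℂ H} (hZ : Z * Z = 1) (x : H) :
    (fixedProj Z hZ x : H) = (1 / 2 : ℂ) • (x + Z x) := rfl

lemma fixedProj_of_mem {Z : Module.End ℂ H} (hZ : Z * Z = 1) (x : fixedSpace Z) :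
    fixedProj Z hZ x = x := by
  ext
  rw [coe_fixedProj, mem_fixedSpace.1 x.2, ← two_smul ℂ, smul_smul]
  norm_num

/-- If an involution `p` anticommutes with the involution `Z`, then it exchanges the eigenspaces of
`Z`; so the whole space is the sum of two copies of the `+1` eigenspace. -/
def halvingEquiv {Z p : Module.End ℂ H} (hZ : Z * Z = 1) (hp : p * p = 1) (h : Z * p = -(p * Z)) :
    H ≃ₗ[ℂ] fixedSpace Z × fixedSpace Z where
  toFun x := (fixedProj Z hZ x, fixedProj Z hZ (p x))
  map_add' x y := by simp
  map_smul' a x := by simp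
  invFun w := w.1 + p w.2
  left_inv x := by
    have h1 : ∀ x, p (p x) = x := fun x => LinearMap.congr_fun hp x
    have h2 : ∀ x, Z (p x) = - p (Z x) := fun x => LinearMap.congr_fun h x
    simp only [coe_fixedProj, h2, map_smul, map_add, map_neg, h1]
    module
  right_inv w := by
    obtain ⟨w, w'⟩ := w
    have h1 : ∀ x, p (p x) = x := fun x => LinearMap.congr_fun hp x
    have h2 : ∀ x, Z (p x) = - p (Z x) := fun x => LinearMap.congr_fun h x
    have hw := mem_fixedSpace.1 w.2
    have hw' := mem_fixedSpace.1 w'.2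
    refine Prod.ext (Subtype.ext ?_) (Subtype.ext ?_) <;> simp only [coe_fixedProj] <;>
      simp only [map_add, h2, hw, hw', h1] <;> module

lemma two_mul_finrank_fixedSpace [FiniteDimensional ℂ H] {Z p : Module.End ℂ H} (hZ : Z * Z = 1)
    (hp : p * p = 1) (h : Z * p = -(p * Z)) :
    2 * Module.finrank ℂ (fixedSpace Z) = Module.finrank ℂ H := by
  rw [(halvingEquiv hZ hp h).finrank_eq, Module.finrank_prod, two_mul]

/-- The dimension of a stabilizer code: each of the commuting involutions `S f` halves the
dimension, provided there are involutions `D f` such that `D f` anticommutes with `S f` and commutes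
with those `S g` that precede `S f` in the order given by `r`. -/
lemma finrank_iInf_fixedSpace [FiniteDimensional ℂ H] {ι : Type} (r : ι → ℤ)
    (S D : ι → Module.End ℂ H) (s : Finset ι) (hS : ∀ f ∈ s, S f * S f = 1)
    (hD : ∀ f ∈ s, D f * D f = 1) (hSS : ∀ f ∈ s, ∀ g ∈ s, S f * S g = S g * S f)
    (hDS : ∀ f ∈ s, S f * D f = -(D f * S f))
    (hDS' : ∀ f ∈ s, ∀ g ∈ s, f ≠ g → r g ≤ r f → D f * S g = S g * D f) :
    2 ^ s.card * Module.finrank ℂ (⨅ f ∈ s, fixedSpace (S f) : Submodule ℂ H) =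
      Module.finrank ℂ H := by
  classical
  induction s using Finset.induction_on_max_value r with
  | empty =>
    have : (⨅ f ∈ (∅ : Finset ι), fixedSpace (S f) : Submodule ℂ H) = ⊤ := by simp
    rw [this, finrank_top, Finset.card_empty, pow_zero, one_mul]
  | insert a s ha hr ih =>
    have hmem : ∀ {x}, x ∈ (⨅ f ∈ s, fixedSpace (S f) : Submodule ℂ H) ↔
        ∀ f ∈ s, S f x = x := by
      intro x; simp [Submodule.mem_iInf, mem_fixedSpace]
    rw [← ih (fun f hf => hS f (Finset.mem_insert_of_mem hf))
      (fun f hf => hD f (Finset.mem_insert_of_mem hf))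
      (fun f hf g hg => hSS f (Finset.mem_insert_of_mem hf) g (Finset.mem_insert_of_mem hg))
      (fun f hf => hDS f (Finset.mem_insert_of_mem hf))
      (fun f hf g hg => hDS' f (Finset.mem_insert_of_mem hf) g (Finset.mem_insert_of_mem hg)),
      Finset.card_insert_of_notMem ha, pow_succ, mul_assoc]
    congr 1
    set K : Submodule ℂ H := ⨅ f ∈ s, fixedSpace (S f) with hK
    have haI := Finset.mem_insert_self a s
    have pres : ∀ T : Module.End ℂ H, (∀ f ∈ s, T * S f = S f * T) → ∀ x ∈ K, T x ∈ K := by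
      intro T hT x hx
      rw [hmem] at hx ⊢
      intro f hf
      exact mem_fixedSpace.1 (apply_mem_fixedSpace (hT f hf) (mem_fixedSpace.2 (hx f hf)))
    have pS := pres (S a) fun f hf => hSS a haI f (Finset.mem_insert_of_mem hf)
    have pD := pres (D a) fun f hf => hDS' a haI f (Finset.mem_insert_of_mem hf)
      (by rintro rfl; exact ha hf) (hr f hf)
    have key := two_mul_finrank_fixedSpace (Z := (S a).restrict pS) (p := (D a).restrict pD)
      (by ext x; exact LinearMap.congr_fun (hS a haI) x)
      (by ext x; exact LinearMap.congr_fun (hD a haI) x)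
      (by ext x; exact LinearMap.congr_fun (hDS a haI) x)
    rw [← key]
    congr 1
    have : (⨅ f ∈ insert a s, fixedSpace (S f) : Submodule ℂ H) =
        Submodule.map K.subtype (fixedSpace ((S a).restrict pS)) := by
      ext x
      simp only [Finset.mem_insert, iInf_or, iInf_inf_eq, iInf_iInf_eq_left, Submodule.mem_inf,
        Submodule.mem_map, mem_fixedSpace, Subtype.exists, Submodule.coe_subtype]
      rw [← hK]
      constructor
      · rintro ⟨h1, h2⟩
        exact ⟨x, h2, Subtype.ext h1, rfl⟩
      · rintro ⟨y, h1, h2, rfl⟩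
        exact ⟨congrArg Subtype.val h2, h1⟩
    rw [this, Submodule.finrank_map_subtype_eq]

end Halving

/-! ### Representations of the Clifford algebra with an even number of generators -/

/-- A family of pairwise anticommuting self-adjoint involutions. -/
structure IsClifford {H : Type} [NormedAddCommGroup H] [InnerProductSpace ℂ H] {ι : Type}
    (c : ι → Module.End ℂ H) : Prop where
  symm : ∀ i, (c i).IsSymmetric
  sq : ∀ i, c i * c i = 1
  anti : ∀ i j, i ≠ j → c i * c j = -(c j * c i)

namespace IsClifford

section Basic

variable {H : Type} [NormedAddCommGroup H] [InnerProductSpace ℂ H] {ι : Type}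
  {c : ι → Module.End ℂ H}

lemma comp (h : IsClifford c) {ι' : Type} (e : ι' → ι) (he : Function.Injective e) :
    IsClifford (c ∘ e) :=
  ⟨fun _ => h.symm _, fun _ => h.sq _, fun _ _ hij => h.anti _ _ fun h' => hij (he h')⟩

lemma restrict (h : IsClifford c) (W : Submodule ℂ H) (hW : ∀ i, ∀ x ∈ W, c i x ∈ W) :
    IsClifford fun i => (c i).restrict (hW i) where
  symm i x y := h.symm i x y
  sq i := by ext x; exact LinearMap.congr_fun (h.sq i) x
  anti i j hij := by ext x; exact LinearMap.congr_fun (h.anti i j hij) x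

/-- The product `-i p q` of two Clifford generators. -/
def chir (c : ι → Module.End ℂ H) (i j : ι) : Module.End ℂ H := (-Complex.I) • (c i * c j)

variable (h : IsClifford c) {i j : ι}
include h

lemma chir_sq (hij : i ≠ j) : chir c i j * chir c i j = 1 := by
  have e : c i * c j * (c i * c j) = -1 := by
    rw [mul_assoc, ← mul_assoc (c j), h.anti j i hij.symm]
    simp only [neg_mul, mul_neg, mul_assoc, h.sq j]
    rw [mul_one, h.sq i]
  simp only [chir, smul_mul_smul_comm, e]
  simp

lemma chir_symm (hij : i ≠ j) : (chir c i j).IsSymmetric := by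
  intro x y
  have e := LinearMap.congr_fun (h.anti i j hij) y
  simp only [Module.End.mul_apply, LinearMap.neg_apply] at e
  simp only [chir, LinearMap.smul_apply, Module.End.mul_apply, inner_smul_left, inner_smul_right,
    h.symm i _ y, h.symm j _ (c i y), e, inner_neg_right]
  simp

lemma chir_anti (hij : i ≠ j) : chir c i j * c i = -(c i * chir c i j) := by
  simp only [chir, smul_mul_assoc, mul_smul_comm, ← smul_neg]
  rw [mul_assoc, h.anti j i hij.symm]
  simp

lemma mul_chir : c i * chir c i j = (-Complex.I) • c j := by
  rw [chir, mul_smul_comm, ← mul_assoc, h.sq i, one_mul]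

lemma chir_comm {k : ι} (hi : k ≠ i) (hj : k ≠ j) : c k * chir c i j = chir c i j * c k := by
  simp only [chir, smul_mul_assoc, mul_smul_comm]
  rw [← mul_assoc, h.anti k i hi, neg_mul, mul_assoc, h.anti k j hj, mul_neg, neg_neg, mul_assoc]

end Basic

section Option

variable {H : Type} [NormedAddCommGroup H] [InnerProductSpace ℂ H] {κ : Type}
  {c : Option κ × Bool → Module.End ℂ H}

/-- The eigenspace to which a Clifford family is restricted in order to remove one pair of
generators. -/
abbrev half (c : Option κ × Bool → Module.End ℂ H) : Submodule ℂ H :=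
  fixedSpace (chir c (none, false) (none, true))

lemma half_invariant (h : IsClifford c) (k : κ × Bool) :
    ∀ x ∈ half c, c (some k.1, k.2) x ∈ half c := fun _ hx =>
  apply_mem_fixedSpace (h.chir_comm (by simp) (by simp)) hx

/-- The remaining pairs of generators, acting on half of the space. -/
def halfFamily (h : IsClifford c) (k : κ × Bool) : Module.End ℂ (half c) :=
  (c (some k.1, k.2)).restrict (h.half_invariant k)

lemma halfFamily_isClifford (h : IsClifford c) : IsClifford h.halfFamily :=
  (h.comp (fun k : κ × Bool => (some k.1, k.2)) (by
    intro k k' e; simpa [Prod.ext_iff] using e)).restrict (half c) h.half_invariant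

/-- The projection onto `half c`. -/
def halfProj (h : IsClifford c) : H →ₗ[ℂ] half c :=
  fixedProj _ (h.chir_sq (i := (none, false)) (j := (none, true)) (by simp))

lemma two_mul_finrank_half [FiniteDimensional ℂ H] (h : IsClifford c) :
    2 * Module.finrank ℂ (half c) = Module.finrank ℂ H :=
  two_mul_finrank_fixedSpace (h.chir_sq (by simp)) (h.sq (none, false)) (h.chir_anti (by simp))

lemma halfProj_add (h : IsClifford c) (x : H) :
    (h.halfProj x : H) + c (none, false) (h.halfProj (c (none, false) x)) = x :=
  (halvingEquiv (h.chir_sq (by simp)) (h.sq (none, false)) (h.chir_anti (by simp))).left_inv x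

lemma halfProj_coe (h : IsClifford c) (x : half c) : h.halfProj x = x :=
  fixedProj_of_mem _ x

lemma halfProj_chir (h : IsClifford c) (x : H) :
    h.halfProj (chir c (none, false) (none, true) x) = h.halfProj x := by
  have e := LinearMap.congr_fun (h.chir_sq (i := (none, false)) (j := (none, true)) (by simp)) x
  ext
  simp only [halfProj, coe_fixedProj]
  simp only [Module.End.mul_apply, Module.End.one_apply] at e
  rw [e, add_comm]

lemma halfProj_some (h : IsClifford c) (k : κ × Bool) (x : H) :
    h.halfProj (c (some k.1, k.2) x) = h.halfFamily k (h.halfProj x) := by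
  have e := LinearMap.congr_fun (h.chir_comm (i := (none, false)) (j := (none, true))
    (k := (some k.1, k.2)) (by simp) (by simp)) x
  simp only [Module.End.mul_apply] at e
  ext
  simp only [halfProj, coe_fixedProj, halfFamily, LinearMap.coe_restrict_apply, map_smul, map_add, e]

lemma norm_sq_half (h : IsClifford c) (w w' : half c) :
    ‖(w : H) + c (none, false) w'‖ ^ 2 = ‖w‖ ^ 2 + ‖w'‖ ^ 2 := by
  have hp := h.symm (none, false)
  have hZ := h.chir_symm (i := (none, false)) (j := (none, true)) (by simp)
  have hne : ((none, false) : Option κ × Bool) ≠ (none, true) := by simp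
  have orth : inner ℂ (w : H) (c (none, false) (w' : H)) = 0 := by
    have e := LinearMap.congr_fun (h.chir_anti hne) (w' : H)
    simp only [Module.End.mul_apply, LinearMap.neg_apply, mem_fixedSpace.1 w'.2] at e
    have e2 := hZ (w : H) (c (none, false) (w' : H))
    rw [e, inner_neg_right, mem_fixedSpace.1 w.2] at e2
    exact self_eq_neg.1 e2
  have hn : ‖c (none, false) (w' : H)‖ = ‖w'‖ := by
    have e := LinearMap.congr_fun (h.sq (none, false)) (w' : H)
    simp only [Module.End.mul_apply, Module.End.one_apply] at e
    have e2 := hp (w' : H) (c (none, false) (w' : H))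
    rw [e] at e2
    have e3 : ‖c (none, false) (w' : H)‖ ^ 2 = ‖(w' : H)‖ ^ 2 := by
      rw [← inner_self_eq_norm_sq (𝕜 := ℂ), ← inner_self_eq_norm_sq (𝕜 := ℂ), e2]
    rw [Submodule.coe_norm]
    exact (sq_eq_sq₀ (norm_nonneg _) (norm_nonneg _)).1 e3
  have := norm_add_sq_eq_norm_sq_add_norm_sq_of_inner_eq_zero (w : H) (c (none, false) (w' : H)) orth
  rw [pow_two, this, hn]
  simp [pow_two]

end Option

/-- Two representations of equal dimension of the Clifford algebra with `2n` generators are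
unitarily equivalent. -/
theorem exists_isometry (κ : Type) [Finite κ] :
    ∀ (H₁ H₂ : Type) [NormedAddCommGroup H₁] [InnerProductSpace ℂ H₁] [FiniteDimensional ℂ H₁]
      [NormedAddCommGroup H₂] [InnerProductSpace ℂ H₂] [FiniteDimensional ℂ H₂]
      (c₁ : κ × Bool → Module.End ℂ H₁) (c₂ : κ × Bool → Module.End ℂ H₂),
      IsClifford c₁ → IsClifford c₂ → Module.finrank ℂ H₁ = Module.finrank ℂ H₂ →
      ∃ J : H₁ ≃ₗᵢ[ℂ] H₂, ∀ k x, J (c₁ k x) = c₂ k (J x) := by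
  induction κ using Finite.induction_empty_option with
  | @of_equiv α β e ih =>
    intro H₁ H₂ _ _ _ _ _ _ c₁ c₂ h₁ h₂ hd
    have inj : Function.Injective (fun k : α × Bool => (e k.1, k.2)) := by
      intro k k' h; simpa [Prod.ext_iff] using h
    obtain ⟨J, hJ⟩ := ih H₁ H₂ _ _ (h₁.comp _ inj) (h₂.comp _ inj) hd
    exact ⟨J, fun k x => by simpa using hJ (e.symm k.1, k.2) x⟩
  | h_empty =>
    intro H₁ H₂ _ _ _ _ _ _ c₁ c₂ h₁ h₂ hd
    exact ⟨(stdOrthonormalBasis ℂ H₁).equiv (stdOrthonormalBasis ℂ H₂) (finCongr hd), fun k => k.1.elim⟩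
  | @h_option α _ ih =>
    intro H₁ H₂ _ _ _ _ _ _ c₁ c₂ h₁ h₂ hd
    have hd' : Module.finrank ℂ (half c₁) = Module.finrank ℂ (half c₂) := by
      have := h₁.two_mul_finrank_half
      have := h₂.two_mul_finrank_half
      omega
    obtain ⟨J, hJ⟩ := ih _ _ _ _ h₁.halfFamily_isClifford h₂.halfFamily_isClifford hd'
    let p₁ := c₁ (none, false)
    let p₂ := c₂ (none, false)
    let J₀ : H₁ →ₗ[ℂ] H₂ :=
      (half c₂).subtype ∘ₗ J.toLinearEquiv.toLinearMap ∘ₗ h₁.halfProj +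
        p₂ ∘ₗ (half c₂).subtype ∘ₗ J.toLinearEquiv.toLinearMap ∘ₗ h₁.halfProj ∘ₗ p₁
    have hJ₀ : ∀ x, J₀ x = (J (h₁.halfProj x) : H₂) + p₂ (J (h₁.halfProj (p₁ x))) := fun x => rfl
    have hnorm : ∀ x, ‖J₀ x‖ = ‖x‖ := by
      intro x
      rw [← sq_eq_sq₀ (norm_nonneg _) (norm_nonneg _), hJ₀, h₂.norm_sq_half]
      conv_rhs => rw [← h₁.halfProj_add x, h₁.norm_sq_half]
      simp [p₁]
    refine ⟨LinearIsometry.toLinearIsometryEquiv ⟨J₀, hnorm⟩ hd, ?_⟩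
    simp only [LinearIsometry.toLinearIsometryEquiv_apply]
    change ∀ k x, J₀ (c₁ k x) = c₂ k (J₀ x)
    have sq₁ : ∀ x, p₁ (p₁ x) = x := fun x => LinearMap.congr_fun (h₁.sq _) x
    have sq₂ : ∀ x, p₂ (p₂ x) = x := fun x => LinearMap.congr_fun (h₂.sq _) x
    have hp : ∀ x, J₀ (p₁ x) = p₂ (J₀ x) := by
      intro x
      simp only [hJ₀, sq₁, map_add, sq₂]
      rw [add_comm]
    have hne : ((none, false) : Option α × Bool) ≠ (none, true) := by simp
    have hZ : ∀ x, J₀ (chir c₁ (none, false) (none, true) x) =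
        chir c₂ (none, false) (none, true) (J₀ x) := by
      intro x
      have e₁ : p₁ (chir c₁ (none, false) (none, true) x) =
          - chir c₁ (none, false) (none, true) (p₁ x) := by
        have := LinearMap.congr_fun (h₁.chir_anti hne) x
        simp only [Module.End.mul_apply, LinearMap.neg_apply] at this
        rw [this, neg_neg]
      have e₂ : ∀ y, chir c₂ (none, false) (none, true) (p₂ y) =
          - p₂ (chir c₂ (none, false) (none, true) y) := fun y =>
        LinearMap.congr_fun (h₂.chir_anti hne) y
      simp only [hJ₀, e₁, map_neg, h₁.halfProj_chir, map_add, e₂, mem_fixedSpace.1 (J _).2,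
        Submodule.coe_neg]
    rintro ⟨_ | k, b⟩ x
    · cases b
      · exact hp x
      · -- `q = i p Z` for the pair `p, q` with `Z = -i p q`
        have q₁ : c₁ (none, true) x = Complex.I • p₁ (chir c₁ (none, false) (none, true) x) := by
          have := LinearMap.congr_fun (h₁.mul_chir (i := (none, false)) (j := (none, true))) x
          simp only [Module.End.mul_apply, LinearMap.smul_apply] at this
          simp [p₁, this, smul_smul]
        have q₂ : c₂ (none, true) (J₀ x) =
            Complex.I • p₂ (chir c₂ (none, false) (none, true) (J₀ x)) := by
          have := LinearMap.congr_fun (h₂.mul_chir (i := (none, false)) (j := (none, true))) (J₀ x)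
          simp only [Module.End.mul_apply, LinearMap.smul_apply] at this
          simp [p₂, this, smul_smul]
        rw [q₁, q₂, map_smul, hp, hZ]
    · have e₁ : p₁ (c₁ (some k, b) x) = - c₁ (some k, b) (p₁ x) :=
        LinearMap.congr_fun (h₁.anti _ _ (by simp)) x
      have e₂ : ∀ y, c₂ (some k, b) (p₂ y) = - p₂ (c₂ (some k, b) y) := fun y =>
        LinearMap.congr_fun (h₂.anti _ _ (by simp)) y
      have e₃ : ∀ w, (J (h₁.halfFamily (k, b) w) : H₂) = c₂ (some k, b) (J w) := fun w =>
        congrArg Subtype.val (hJ (k, b) w)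
      have e₄ : ∀ y, h₁.halfProj (c₁ (some k, b) y) = h₁.halfFamily (k, b) (h₁.halfProj y) :=
        fun y => h₁.halfProj_some (k, b) y
      simp only [hJ₀, e₁, map_neg, e₄, Submodule.coe_neg, map_add, e₂, e₃]

/-- The dimension of a representation of the Clifford algebra with `2n` generators is a multiple
of `2ⁿ`. -/
theorem two_pow_dvd_finrank (κ : Type) [Finite κ] :
    ∀ (H : Type) [NormedAddCommGroup H] [InnerProductSpace ℂ H] [FiniteDimensional ℂ H]
      (c : κ × Bool → Module.End ℂ H), IsClifford c → 2 ^ Nat.card κ ∣ Module.finrank ℂ H := by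
  induction κ using Finite.induction_empty_option with
  | @of_equiv α β e ih =>
    intro H _ _ _ c h
    have inj : Function.Injective (fun k : α × Bool => (e k.1, k.2)) := by
      intro k k' h; simpa [Prod.ext_iff] using h
    rw [← Nat.card_congr e]
    exact ih H _ (h.comp _ inj)
  | h_empty => intro H _ _ _ c h; simp
  | @h_option α _ ih =>
    intro H _ _ _ c h
    rw [← h.two_mul_finrank_half, Finite.card_option, pow_succ, mul_comm]
    exact mul_dvd_mul_left _ (ih _ _ h.halfFamily_isClifford)

/-- In dimension `2ⁿ` the `2n` Clifford generators generate all operators. -/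
theorem adjoin_eq_top (κ : Type) [Finite κ] :
    ∀ (H : Type) [NormedAddCommGroup H] [InnerProductSpace ℂ H] [FiniteDimensional ℂ H]
      (c : κ × Bool → Module.End ℂ H), IsClifford c → Module.finrank ℂ H = 2 ^ Nat.card κ →
      Algebra.adjoin ℂ (Set.range c) = ⊤ := by
  induction κ using Finite.induction_empty_option with
  | @of_equiv α β e ih =>
    intro H _ _ _ c h hd
    have inj : Function.Injective (fun k : α × Bool => (e k.1, k.2)) := by
      intro k k' h; simpa [Prod.ext_iff] using h
    rw [← Nat.card_congr e] at hd
    rw [eq_top_iff, ← ih H _ (h.comp _ inj) hd]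
    exact Algebra.adjoin_mono (Set.range_comp_subset_range _ _)
  | h_empty =>
    intro H _ _ _ c h hd
    have : Nontrivial H := Module.nontrivial_of_finrank_pos (R := ℂ) (by rw [hd]; positivity)
    have : (⊥ : Subalgebra ℂ (Module.End ℂ H)) = ⊤ := by
      rw [Subalgebra.bot_eq_top_iff_finrank_eq_one, Module.finrank_linearMap, hd]
      simp
    rw [eq_top_iff, ← this]
    exact bot_le
  | @h_option α _ ih =>
    intro H _ _ _ c h hd
    have hd' : Module.finrank ℂ (half c) = 2 ^ Nat.card α := by
      have := h.two_mul_finrank_half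
      rw [hd, Finite.card_option, pow_succ] at this
      omega
    have top := ih _ _ h.halfFamily_isClifford hd'
    set A := Algebra.adjoin ℂ (Set.range c) with hA
    have hc : ∀ k, c k ∈ A := fun k => Algebra.subset_adjoin ⟨k, rfl⟩
    let lift : Module.End ℂ (half c) → Module.End ℂ H := fun S =>
      (half c).subtype ∘ₗ S ∘ₗ h.halfProj
    have hP : lift 1 ∈ A := by
      have : lift 1 = (1 / 2 : ℂ) • (1 + chir c (none, false) (none, true)) := rfl
      rw [this]
      exact A.smul_mem (A.add_mem A.one_mem (A.smul_mem (A.mul_mem (hc _) (hc _)) _)) _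
    have lift_mem : ∀ S, lift S ∈ A := by
      intro S
      have hS : S ∈ Algebra.adjoin ℂ (Set.range h.halfFamily) := by rw [top]; trivial
      induction hS using Algebra.adjoin_induction with
      | mem S hS =>
        obtain ⟨k, rfl⟩ := hS
        have : lift (h.halfFamily k) = c (some k.1, k.2) * lift 1 := by ext x; rfl
        rw [this]
        exact A.mul_mem (hc _) hP
      | algebraMap r =>
        have : lift (algebraMap ℂ _ r) = r • lift 1 := by ext x; rfl
        rw [this]
        exact A.smul_mem hP _
      | add S T _ _ hS hT =>
        have : lift (S + T) = lift S + lift T := by ext x; rfl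
        rw [this]
        exact A.add_mem hS hT
      | mul S T _ _ hS hT =>
        have : lift (S * T) = lift S * lift T := by
          ext x
          simp [lift, h.halfProj_coe]
        rw [this]
        exact A.mul_mem hS hT
    rw [eq_top_iff]
    rintro T -
    -- the four blocks of `T` with respect to the decomposition of the space into its two halves
    let p := c (none, false)
    let B : Module.End ℂ H → Module.End ℂ (half c) := fun T =>
      h.halfProj ∘ₗ T ∘ₗ (half c).subtype
    have : T = lift (B T) + lift (B (T * p)) * p + p * lift (B (p * T)) +
        p * lift (B (p * T * p)) * p := by
      ext x
      conv_lhs => rw [← h.halfProj_add x, map_add, ← h.halfProj_add (T (h.halfProj x : H)),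
        ← h.halfProj_add (T (c (none, false) (h.halfProj (c (none, false) x)) : H))]
      simp only [lift, B, p, LinearMap.add_apply, Module.End.mul_apply, LinearMap.comp_apply,
        Submodule.coe_subtype]
      abel
    rw [this]
    exact A.add_mem (A.add_mem (A.add_mem (lift_mem _) (A.mul_mem (lift_mem _) (hc _)))
      (A.mul_mem (hc _) (lift_mem _))) (A.mul_mem (A.mul_mem (hc _) (lift_mem _)) (hc _))

end IsClifford

/-! ### Antisymmetric functions of words -/

section Antisymmetric

variable {V : Type}

/-- `f` is antisymmetric under permutations of the letters. -/
def IsAntisymm {n : ℕ} (f : (Fin n → V) → ℂ) : Prop :=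
  ∀ (π : Equiv.Perm (Fin n)) (x : Fin n → V), f (x ∘ π) = ((Equiv.Perm.sign π : ℤ) : ℂ) * f x

lemma sign_mul_self {n : ℕ} (π : Equiv.Perm (Fin n)) :
    ((Equiv.Perm.sign π : ℤ) : ℂ) * ((Equiv.Perm.sign π : ℤ) : ℂ) = 1 := by
  rw [← Int.cast_mul, ← Units.val_mul, Int.units_mul_self]
  simp

lemma IsAntisymm.eq_zero {n : ℕ} {f : (Fin n → V) → ℂ} (hf : IsAntisymm f) {x : Fin n → V}
    (hx : ¬ Function.Injective x) : f x = 0 := by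
  simp only [Function.Injective, not_forall] at hx
  obtain ⟨a, b, hab, hne⟩ := hx
  have h := hf (Equiv.swap a b) x
  have e : x ∘ Equiv.swap a b = x := by
    funext k
    rcases eq_or_ne k a with rfl | hka
    · simp [hab]
    rcases eq_or_ne k b with rfl | hkb
    · simp [hab]
    · simp [Equiv.swap_apply_of_ne_of_ne hka hkb]
  rw [e, Equiv.Perm.sign_swap hne] at h
  simpa using self_eq_neg.1 (h.trans (by simp))

/-- The summands of `insertLetter` can be computed from any permutation that brings the `k`-th
letter to the front. -/
lemma insertLetter_term {n : ℕ} {f : (Fin n → V) → ℂ} (hf : IsAntisymm f) (x : Fin (n + 1) → V)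
    (σ : Equiv.Perm (Fin (n + 1))) :
    ((Equiv.Perm.sign σ : ℤ) : ℂ) * f (x ∘ σ ∘ Fin.succ) =
      (-1) ^ (σ 0 : ℕ) * f (x ∘ (σ 0).succAbove) := by
  obtain ⟨ρ, hρ⟩ : ∃ ρ : Equiv.Perm (Fin n),
      (σ 0).cycleRange * σ = Equiv.Perm.decomposeFin.symm (0, ρ) := by
    refine ⟨(Equiv.Perm.decomposeFin ((σ 0).cycleRange * σ)).2, ?_⟩
    rw [Equiv.eq_symm_apply]
    refine Prod.ext ?_ rfl
    have := Equiv.Perm.decomposeFin_symm_apply_zero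
      (Equiv.Perm.decomposeFin ((σ 0).cycleRange * σ)).1
      (Equiv.Perm.decomposeFin ((σ 0).cycleRange * σ)).2
    rw [Prod.mk.eta, Equiv.symm_apply_apply] at this
    rw [← this]
    simp
  have h1 : x ∘ σ ∘ Fin.succ = (x ∘ (σ 0).succAbove) ∘ ρ := by
    funext k
    have := congrArg (fun τ : Equiv.Perm (Fin (n + 1)) => (σ 0).cycleRange.symm (τ k.succ)) hρ
    simp only [Equiv.Perm.mul_apply, Equiv.symm_apply_apply,
      Equiv.Perm.decomposeFin_symm_apply_succ, Equiv.swap_self, Equiv.refl_apply,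
      Fin.cycleRange_symm_succ] at this
    simp [this]
  have h2 := congrArg (fun τ => ((Equiv.Perm.sign τ : ℤ) : ℂ)) hρ
  simp only [Equiv.Perm.sign_mul, Fin.sign_cycleRange, Equiv.Perm.decomposeFin.symm_sign,
    if_true, one_mul, Units.val_mul, Int.cast_mul, Units.val_pow_eq_pow_val, Units.val_neg,
    Units.val_one, Int.cast_pow, Int.cast_neg, Int.cast_one] at h2
  rw [h1, hf ρ, ← h2]
  linear_combination (-1) ^ (σ 0 : ℕ) * f (x ∘ (σ 0).succAbove) * sign_mul_self σ

variable [DecidableEq V]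

/-- The insertion of the letter `j` into `f`, antisymmetrized: up to normalization this is the
action of the creation operator of the mode `j`. -/
def insertLetter (j : V) {n : ℕ} (f : (Fin n → V) → ℂ) (x : Fin (n + 1) → V) : ℂ :=
  ∑ k : Fin (n + 1), (-1) ^ (k : ℕ) * if x k = j then f (x ∘ k.succAbove) else 0

lemma IsAntisymm.insertLetter (j : V) {n : ℕ} {f : (Fin n → V) → ℂ} (hf : IsAntisymm f) :
    IsAntisymm (insertLetter j f) := by
  intro π x
  have key : ∀ k : Fin (n + 1), (-1 : ℂ) ^ (k : ℕ) * f ((x ∘ π) ∘ k.succAbove) =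
      ((Equiv.Perm.sign π : ℤ) : ℂ) * ((-1) ^ (π k : ℕ) * f (x ∘ (π k).succAbove)) := by
    intro k
    have h1 := insertLetter_term hf (x ∘ π) k.cycleRange.symm
    have h2 := insertLetter_term hf x (π * k.cycleRange.symm)
    simp only [Equiv.Perm.mul_apply, Fin.cycleRange_symm_zero, Equiv.Perm.sign_mul, Units.val_mul,
      Int.cast_mul] at h1 h2
    rw [← h1, ← h2]
    have h5 : (x ∘ π) ∘ k.cycleRange.symm ∘ Fin.succ = x ∘ ⇑(π * k.cycleRange.symm) ∘ Fin.succ := rfl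
    rw [h5, ← mul_assoc, ← mul_assoc, sign_mul_self, one_mul]
  simp only [Compact.insertLetter, Finset.mul_sum]
  refine Eq.trans (Finset.sum_congr rfl fun k _ => ?_) (Equiv.sum_comp π fun k =>
    ((Equiv.Perm.sign π : ℤ) : ℂ) * ((-1) ^ (k : ℕ) * if x k = j then f (x ∘ k.succAbove) else 0))
  rw [Function.comp_apply]
  split_ifs
  · exact key k
  · simp

/-- The anticommutation relation between removing and inserting a letter. -/
lemma insertLetter_cons_succ (i j : V) {n : ℕ} (f : (Fin (n + 1) → V) → ℂ) (y : Fin (n + 1) → V) :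
    insertLetter j f (Fin.cons i y) + insertLetter j (fun z => f (Fin.cons i z)) y =
      if i = j then f y else 0 := by
  rw [insertLetter, Fin.sum_univ_succ, insertLetter, add_assoc, ← Finset.sum_add_distrib,
    Finset.sum_eq_zero, add_zero]
  · simp
  · intro k _
    have : (Fin.cons i y : Fin (n + 2) → V) ∘ k.succ.succAbove = Fin.cons i (y ∘ k.succAbove) := by
      funext l
      refine Fin.cases ?_ (fun l => ?_) l <;> simp
    simp only [Fin.cons_succ, this, Fin.val_succ, pow_succ]
    split_ifs <;> ring

lemma insertLetter_cons_zero (i j : V) (f : (Fin 0 → V) → ℂ) (y : Fin 0 → V) :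
    insertLetter j f (Fin.cons i y) = if i = j then f y else 0 := by
  simp [insertLetter]

/-- Inserting and removing a letter are adjoint to each other. -/
lemma sum_mul_insertLetter [Fintype V] (j : V) {n : ℕ} (f : (Fin n → V) → ℂ)
    {g : (Fin (n + 1) → V) → ℂ} (hg : IsAntisymm g) :
    ∑ x, (starRingEnd ℂ) (g x) * insertLetter j f x =
      (n + 1) * ∑ y, (starRingEnd ℂ) (g (Fin.cons j y)) * f y := by
  simp only [insertLetter, Finset.mul_sum]
  rw [Finset.sum_comm]
  have : ∀ k : Fin (n + 1), ∑ x, (starRingEnd ℂ) (g x) * ((-1) ^ (k : ℕ) *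
      if x k = j then f (x ∘ k.succAbove) else 0) =
      ∑ y, (starRingEnd ℂ) (g (Fin.cons j y)) * f y := by
    intro k
    rw [← Equiv.sum_comp (Fin.insertNthEquiv (fun _ => V) k), Fintype.sum_prod_type,
      Finset.sum_eq_single j]
    · refine Finset.sum_congr rfl fun y _ => ?_
      have h1 := hg k.cycleRange (Fin.cons j y)
      rw [Fin.cons_comp_cycleRange, Fin.sign_cycleRange] at h1
      have h2 : (k.insertNth j y : Fin (n + 1) → V) ∘ k.succAbove = y := by funext l; simp
      have h3 : ((-1 : ℂ)) ^ (k : ℕ) * (-1) ^ (k : ℕ) = 1 := by rw [← mul_pow]; simp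
      change (starRingEnd ℂ) (g (k.insertNth j y)) * ((-1) ^ (k : ℕ) *
        if (k.insertNth j y : Fin (n + 1) → V) k = j then f (k.insertNth j y ∘ k.succAbove) else 0) = _
      rw [Fin.insertNth_apply_same, if_pos rfl, h1, h2, map_mul]
      push_cast
      rw [map_pow, map_neg, map_one]
      linear_combination ((starRingEnd ℂ) (g (Fin.cons j y)) * f y) * h3
    · intro b _ hb
      simp [hb]
    · simp
  rw [Finset.sum_congr rfl fun k _ => this k]
  simp [Finset.mul_sum]

end Antisymmetric

/-! ### The canonical anticommutation relations -/

section Fock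

variable {V : Type} [Fintype V]

/-- The component of a Fock space vector with `n` fermions, for arbitrary `n` (so it vanishes when
there are more fermions than modes). -/
def sector (ψ : Fock V) (n : ℕ) (x : Fin n → V) : ℂ :=
  if h : n < Fintype.card V + 1 then (ψ : EuclideanSpace ℂ (Word V)) ⟨⟨n, h⟩, x⟩ else 0

lemma sector_of_lt (ψ : Fock V) {n : ℕ} (h : n < Fintype.card V + 1) (x : Fin n → V) :
    sector ψ n x = (ψ : EuclideanSpace ℂ (Word V)) ⟨⟨n, h⟩, x⟩ := dif_pos h

lemma sector_of_not_lt (ψ : Fock V) {n : ℕ} (h : ¬ n < Fintype.card V + 1) :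
    sector ψ n = 0 := by
  funext x
  exact dif_neg h

lemma sector_antisymm (ψ : Fock V) (n : ℕ) : IsAntisymm (sector ψ n) := by
  intro π x
  by_cases h : n < Fintype.card V + 1
  · rw [sector_of_lt ψ h, sector_of_lt ψ h]
    exact ψ.2 ⟨n, h⟩ π x
  · simp [sector_of_not_lt ψ h]

lemma sector_ext {φ ψ : Fock V} (h : ∀ n x, sector φ n x = sector ψ n x) : φ = ψ := by
  ext ⟨⟨n, hn⟩, x⟩
  rw [← sector_of_lt φ hn, ← sector_of_lt ψ hn, h]

lemma sector_add (φ ψ : Fock V) (n : ℕ) (x : Fin n → V) :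
    sector (φ + ψ) n x = sector φ n x + sector ψ n x := by
  by_cases h : n < Fintype.card V + 1 <;> simp [sector, h]

lemma sector_smul (a : ℂ) (ψ : Fock V) (n : ℕ) (x : Fin n → V) :
    sector (a • ψ) n x = a * sector ψ n x := by
  by_cases h : n < Fintype.card V + 1 <;> simp [sector, h]

/-- There is no antisymmetric function of more letters than there are modes. -/
lemma IsAntisymm.eq_zero_of_card_lt {n : ℕ} {f : (Fin n → V) → ℂ} (hf : IsAntisymm f)
    (h : Fintype.card V < n) : f = 0 := by
  funext x
  refine hf.eq_zero fun hx => ?_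
  have := Fintype.card_le_of_injective x hx
  simp at this
  omega

lemma annihilate_inner_left (j : V) (φ ψ : Fock V) :
    inner ℂ (annihilate j φ) ψ = inner ℂ φ (create j ψ) := by
  rw [create, LinearMap.adjoint_inner_right]

lemma create_inner_left (j : V) (φ ψ : Fock V) :
    inner ℂ (create j φ) ψ = inner ℂ φ (annihilate j ψ) := by
  rw [create, LinearMap.adjoint_inner_left]

lemma sector_annihilate (j : V) (ψ : Fock V) (n : ℕ) (x : Fin n → V) :
    sector (annihilate j ψ) n x = ((Real.sqrt (n + 1) : ℝ) : ℂ) * sector ψ (n + 1) (Fin.cons j x) := by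
  by_cases h : n < Fintype.card V
  · rw [sector_of_lt _ (h.trans (Nat.lt_succ_self _)), sector_of_lt _ (Nat.succ_lt_succ h)]
    simp [annihilate, h]
  · rw [sector_of_not_lt ψ (n := n + 1) (by omega)]
    by_cases h' : n < Fintype.card V + 1
    · rw [sector_of_lt _ h']
      simp [annihilate, h]
    · simp [sector_of_not_lt _ h']

lemma inner_eq_sum_sector (φ ψ : Fock V) :
    inner ℂ φ ψ = ∑ n ∈ Finset.range (Fintype.card V + 1),
      ∑ x : Fin n → V, (starRingEnd ℂ) (sector φ n x) * sector ψ n x := by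
  rw [Submodule.coe_inner, PiLp.inner_apply, Fintype.sum_sigma, Finset.sum_range]
  refine Finset.sum_congr rfl fun n _ => Finset.sum_congr rfl fun x _ => ?_
  rw [sector_of_lt φ n.2, sector_of_lt ψ n.2]
  simp [mul_comm]

lemma majorana_symm (j : V) : (majorana j).IsSymmetric := fun φ ψ => by
  simp only [majorana, LinearMap.add_apply, inner_add_left, inner_add_right,
    annihilate_inner_left, create_inner_left]
  ring

lemma majoranaBar_symm (j : V) : (majoranaBar j).IsSymmetric := fun φ ψ => by
  simp only [majoranaBar, LinearMap.smul_apply, LinearMap.sub_apply, inner_smul_left,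
    inner_smul_right, inner_sub_left, inner_sub_right,
    annihilate_inner_left, create_inner_left]
  simp only [map_neg, Complex.conj_I]
  ring

lemma annihilate_mul_annihilate (i j : V) :
    annihilate i * annihilate j + annihilate j * annihilate i = 0 := by
  refine LinearMap.ext fun ψ => sector_ext fun n x => ?_
  have e : (Fin.cons i (Fin.cons j x) : Fin (n + 2) → V) =
      (Fin.cons j (Fin.cons i x) : Fin (n + 2) → V) ∘ Equiv.swap 0 1 := by
    funext k
    refine Fin.cases ?_ (fun k => ?_) k
    · simp
    refine Fin.cases ?_ (fun k => ?_) k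
    · simp
    · rw [Function.comp_apply, Equiv.swap_apply_of_ne_of_ne (by simp)
        (by simp [Fin.ext_iff])]
      simp
  have h := sector_antisymm ψ (n + 2) (Equiv.swap 0 1) (Fin.cons j (Fin.cons i x))
  rw [← e, Equiv.Perm.sign_swap (by simp)] at h
  have h0 : sector (0 : Fock V) n x = 0 := by simp [sector]
  simp only [LinearMap.add_apply, Module.End.mul_apply, sector_add, sector_annihilate, h,
    LinearMap.zero_apply, h0]
  push_cast
  ring

lemma create_mul_create (i j : V) : create i * create j + create j * create i = 0 := by
  refine LinearMap.ext fun ψ => ext_inner_left ℂ fun φ => ?_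
  have h := LinearMap.congr_fun (annihilate_mul_annihilate j i) φ
  simp only [LinearMap.add_apply, Module.End.mul_apply] at h ⊢
  rw [inner_add_right, ← annihilate_inner_left, ← annihilate_inner_left, ← annihilate_inner_left,
    ← annihilate_inner_left, ← inner_add_left, h]
  simp

variable [DecidableEq V]

/-- The components of a vector to which a creation operator is applied. -/
def createSector (j : V) (ψ : Fock V) : (n : ℕ) → (Fin n → V) → ℂ
  | 0, _ => 0
  | n + 1, x => ((Real.sqrt (n + 1) : ℝ) : ℂ)⁻¹ * insertLetter j (sector ψ n) x

lemma createSector_antisymm (j : V) (ψ : Fock V) : ∀ n, IsAntisymm (createSector j ψ n)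
  | 0 => fun π x => by simp [createSector]
  | n + 1 => fun π x => by
    simp only [createSector, (sector_antisymm ψ n).insertLetter j π x]
    ring

/-- The vector with the components `createSector`. -/
def createVec (j : V) (ψ : Fock V) : Fock V :=
  ⟨WithLp.toLp 2 fun w : Word V => createSector j ψ w.1 w.2,
    fun n π x => createSector_antisymm j ψ n π x⟩

lemma sector_createVec (j : V) (ψ : Fock V) (n : ℕ) (x : Fin n → V) :
    sector (createVec j ψ) n x = createSector j ψ n x := by
  by_cases h : n < Fintype.card V + 1
  · rw [sector_of_lt _ h]
    rfl
  · rw [sector_of_not_lt _ h, (createSector_antisymm j ψ n).eq_zero_of_card_lt (by omega)]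

lemma inner_annihilate (j : V) (φ ψ : Fock V) :
    inner ℂ (annihilate j φ) ψ = inner ℂ φ (createVec j ψ) := by
  rw [inner_eq_sum_sector, inner_eq_sum_sector, Finset.sum_range_succ, Finset.sum_range_succ']
  simp only [sector_createVec, createSector, mul_zero, Finset.sum_const_zero, add_zero]
  rw [Finset.sum_eq_zero (s := (Finset.univ : Finset (Fin (Fintype.card V) → V))), add_zero]
  · refine Finset.sum_congr rfl fun n _ => ?_
    have h1 := sum_mul_insertLetter j (sector ψ n) (sector_antisymm φ (n + 1))
    have h2 : ((Real.sqrt (n + 1) : ℝ) : ℂ) * ((Real.sqrt (n + 1) : ℝ) : ℂ) = n + 1 := by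
      rw [← Complex.ofReal_mul, Real.mul_self_sqrt (by positivity)]
      push_cast
      rfl
    have h3 : ((Real.sqrt (n + 1) : ℝ) : ℂ) ≠ 0 := by
      rw [Complex.ofReal_ne_zero]
      positivity
    calc _ = ((Real.sqrt (n + 1) : ℝ) : ℂ) *
          ∑ y, (starRingEnd ℂ) (sector φ (n + 1) (Fin.cons j y)) * sector ψ n y := by
          rw [Finset.mul_sum]
          refine Finset.sum_congr rfl fun x _ => ?_
          rw [sector_annihilate, map_mul, Complex.conj_ofReal, mul_assoc]
      _ = ((Real.sqrt (n + 1) : ℝ) : ℂ)⁻¹ *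
          ∑ x, (starRingEnd ℂ) (sector φ (n + 1) x) * insertLetter j (sector ψ n) x := by
          rw [h1, ← h2]
          field_simp
      _ = _ := by
          rw [Finset.mul_sum]
          exact Finset.sum_congr rfl fun x _ => by ring
  · intro x _
    rw [sector_annihilate, sector_of_not_lt φ (n := Fintype.card V + 1) (by omega)]
    simp

lemma create_apply (j : V) (ψ : Fock V) : create j ψ = createVec j ψ := by
  refine ext_inner_left ℂ fun φ => ?_
  rw [create, LinearMap.adjoint_inner_right, inner_annihilate]

lemma annihilate_mul_create (i j : V) :
    annihilate i * create j + create j * annihilate i = if i = j then 1 else 0 := by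
  refine LinearMap.ext fun ψ => sector_ext fun n y => ?_
  have h2 : ∀ n : ℕ, ((Real.sqrt (n + 1) : ℝ) : ℂ) ≠ 0 := by
    intro n
    rw [Complex.ofReal_ne_zero]
    positivity
  have rhs : sector ((if i = j then (1 : Module.End ℂ (Fock V)) else 0) ψ) n y =
      if i = j then sector ψ n y else 0 := by
    split_ifs <;> simp [sector]
  rw [rhs]
  simp only [LinearMap.add_apply, Module.End.mul_apply, sector_add, sector_annihilate, create_apply,
    sector_createVec]
  cases n with
  | zero =>
    simp only [createSector, add_zero]
    rw [mul_inv_cancel_left₀ (h2 0), insertLetter_cons_zero]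
  | succ n =>
    simp only [createSector]
    rw [mul_inv_cancel_left₀ (h2 (n + 1)), ← insertLetter_cons_succ i j (sector ψ (n + 1)) y]
    have : sector ((annihilate i) ψ) n =
        fun z => ((Real.sqrt (n + 1) : ℝ) : ℂ) * sector ψ (n + 1) (Fin.cons i z) := by
      funext z
      exact sector_annihilate i ψ n z
    have e : insertLetter j (sector ((annihilate i) ψ) n) y =
        ((Real.sqrt (n + 1) : ℝ) : ℂ) * insertLetter j (fun z => sector ψ (n + 1) (Fin.cons i z)) y := by
      rw [this]
      simp only [insertLetter, Finset.mul_sum]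
      refine Finset.sum_congr rfl fun k _ => ?_
      split_ifs <;> ring
    rw [e, inv_mul_cancel_left₀ (h2 n)]

/-! ### The dimension of the Fock space -/

lemma finrank_fock_le : Module.finrank ℂ (Fock V) ≤ 2 ^ Fintype.card V := by
  -- a vector is determined by its values on one word for each set of modes
  let Φ : Fock V →ₗ[ℂ] (Finset V → ℂ) :=
    { toFun ψ s := sector ψ s.card (fun k => (s.equivFin.symm k : V))
      map_add' φ ψ := by funext s; exact sector_add _ _ _ _
      map_smul' a ψ := by funext s; exact sector_smul _ _ _ _ }
  have hΦ : Function.Injective Φ := by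
    rw [← LinearMap.ker_eq_bot, LinearMap.ker_eq_bot']
    intro ψ hψ
    have key : ∀ (s : Finset V) (n : ℕ) (x : Fin n → V), s.card = n → Function.Injective x →
        (∀ k, x k ∈ s) → sector ψ n x = 0 := by
      rintro s _ x rfl hx hxs
      let ρ : Fin s.card → Fin s.card := fun k => s.equivFin ⟨x k, hxs k⟩
      have hρ : Function.Injective ρ := fun a b hab => by
        have := s.equivFin.injective hab
        exact hx (congrArg Subtype.val this)
      have e : x = (fun k => (s.equivFin.symm k : V)) ∘
          Equiv.ofBijective ρ (Finite.injective_iff_bijective.1 hρ) := by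
        funext k
        simp [ρ]
      have h0 : sector ψ s.card (fun k => (s.equivFin.symm k : V)) = 0 := congrFun hψ s
      rw [e, sector_antisymm, h0, mul_zero]
    refine sector_ext fun n x => ?_
    have h0 : sector (0 : Fock V) n x = 0 := by simp [sector]
    rw [h0]
    by_cases hx : Function.Injective x
    · exact key (Finset.univ.image x) n x (by simp [Finset.card_image_of_injective _ hx]) hx
        (by simp)
    · exact (sector_antisymm ψ n).eq_zero hx
  have := LinearMap.finrank_le_finrank_of_injective hΦ
  simpa using this

instance : Nontrivial (Fock V) := by
  let Ω : Fock V := ⟨WithLp.toLp 2 fun w : Word V => if w.1 = 0 then 1 else 0, by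
    intro n π x
    by_cases hn : n = 0
    · have : Subsingleton (Fin n) := by
        subst hn
        exact inferInstanceAs (Subsingleton (Fin 0))
      simp [Subsingleton.elim π 1]
    · simp [hn]⟩
  refine ⟨Ω, 0, fun h => ?_⟩
  have := congrArg (fun ψ : Fock V => (ψ : EuclideanSpace ℂ (Word V)) ⟨0, Fin.elim0⟩) h
  simp [Ω] at this

/-! ### Majorana operators -/

/-- The Majorana operators `γ_j` and `γ̄_j`. -/
def majoranaFamily (k : V × Bool) : Module.End ℂ (Fock V) :=
  if k.2 then majoranaBar k.1 else majorana k.1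

lemma majorana_mul_majorana (i j : V) :
    majorana i * majorana j + majorana j * majorana i = if i = j then 2 else 0 := by
  have h1 := annihilate_mul_annihilate i j
  have h2 := create_mul_create i j
  have h3 := annihilate_mul_create i j
  have h4 := annihilate_mul_create j i
  have : majorana i * majorana j + majorana j * majorana i =
      (annihilate i * annihilate j + annihilate j * annihilate i) +
      (create i * create j + create j * create i) +
      (annihilate i * create j + create j * annihilate i) +
      (annihilate j * create i + create i * annihilate j) := by
    simp only [majorana, mul_add, add_mul]
    abel
  rw [this, h1, h2, h3, h4]
  by_cases hij : i = j
  · simp [hij, one_add_one_eq_two]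
  · simp [hij, Ne.symm hij]

lemma neg_I_smul_sub_mul {R : Type} [Ring R] [Algebra ℂ R] (a b c d : R) :
    ((-Complex.I) • (a - c)) * ((-Complex.I) • (b - d)) +
      ((-Complex.I) • (b - d)) * ((-Complex.I) • (a - c)) =
    -(a * b + b * a) - (c * d + d * c) + (a * d + d * a) + (b * c + c * b) := by
  have hI : -Complex.I * -Complex.I = -1 := by simp
  rw [smul_mul_smul_comm, smul_mul_smul_comm, hI]
  simp only [neg_smul, one_smul, mul_sub, sub_mul]
  abel

lemma majoranaBar_mul_majoranaBar (i j : V) :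
    majoranaBar i * majoranaBar j + majoranaBar j * majoranaBar i = if i = j then 2 else 0 := by
  have h1 := annihilate_mul_annihilate i j
  have h2 := create_mul_create i j
  have h3 := annihilate_mul_create i j
  have h4 := annihilate_mul_create j i
  have : majoranaBar i * majoranaBar j + majoranaBar j * majoranaBar i =
      -(annihilate i * annihilate j + annihilate j * annihilate i) -
      (create i * create j + create j * create i) +
      (annihilate i * create j + create j * annihilate i) +
      (annihilate j * create i + create i * annihilate j) :=
    neg_I_smul_sub_mul _ _ _ _
  rw [this, h1, h2, h3, h4]
  by_cases hij : i = j
  · simp [hij, one_add_one_eq_two]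
  · simp [hij, Ne.symm hij]

lemma majorana_mul_majoranaBar (i j : V) :
    majorana i * majoranaBar j = -(majoranaBar j * majorana i) := by
  have h1 := annihilate_mul_annihilate i j
  have h2 := create_mul_create i j
  have h3 := annihilate_mul_create i j
  have h4 := annihilate_mul_create j i
  have h5 : (if j = i then (1 : Module.End ℂ (Fock V)) else 0) = if i = j then 1 else 0 := by
    simp [eq_comm]
  have : majorana i * majoranaBar j + majoranaBar j * majorana i = (-Complex.I) •
      ((annihilate i * annihilate j + annihilate j * annihilate i) -
      (create i * create j + create j * create i) -
      (annihilate i * create j + create j * annihilate i) +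
      (annihilate j * create i + create i * annihilate j)) := by
    simp only [majoranaBar, majorana, smul_mul_assoc, mul_smul_comm, ← smul_add]
    congr 1
    simp only [mul_sub, sub_mul, mul_add, add_mul]
    abel
  rw [h1, h2, h3, h4, h5] at this
  rw [eq_neg_iff_add_eq_zero, this]
  simp

theorem majoranaFamily_isClifford : IsClifford (majoranaFamily (V := V)) where
  symm k := by
    rcases k with ⟨j, _ | _⟩
    exacts [majorana_symm j, majoranaBar_symm j]
  sq k := by
    have half : ∀ T : Module.End ℂ (Fock V), T * T + T * T = 2 → T * T = 1 := by
      intro T hT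
      have : (2 : ℂ) • (T * T) = (2 : ℂ) • 1 := by
        rw [two_smul, hT, two_smul, one_add_one_eq_two]
      exact smul_right_injective _ two_ne_zero this
    rcases k with ⟨j, _ | _⟩
    · exact half _ ((majorana_mul_majorana j j).trans (if_pos rfl))
    · exact half _ ((majoranaBar_mul_majoranaBar j j).trans (if_pos rfl))
  anti k l hkl := by
    rcases k with ⟨i, _ | _⟩ <;> rcases l with ⟨j, _ | _⟩
    · have : i ≠ j := by rintro rfl; exact hkl rfl
      exact eq_neg_of_add_eq_zero_left ((majorana_mul_majorana i j).trans (if_neg this))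
    · exact majorana_mul_majoranaBar i j
    · have := majorana_mul_majoranaBar j i
      exact (neg_eq_iff_eq_neg.2 this).symm
    · have : i ≠ j := by rintro rfl; exact hkl rfl
      exact eq_neg_of_add_eq_zero_left ((majoranaBar_mul_majoranaBar i j).trans (if_neg this))

theorem finrank_fock : Module.finrank ℂ (Fock V) = 2 ^ Fintype.card V := by
  refine le_antisymm finrank_fock_le (Nat.le_of_dvd Module.finrank_pos ?_)
  have := IsClifford.two_pow_dvd_finrank V (Fock V) _ majoranaFamily_isClifford
  rwa [Nat.card_eq_fintype_card] at this

end Fock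

/-! ### Commutation up to sign -/

/-- `-1` if `p` holds, and `1` otherwise. -/
def sgn (p : Prop) [Decidable p] : ℤˣ := if p then -1 else 1

lemma sgn_pos {p : Prop} [Decidable p] (h : p) : sgn p = -1 := if_pos h

lemma sgn_neg {p : Prop} [Decidable p] (h : ¬p) : sgn p = 1 := if_neg h

lemma sgn_comm {α : Type} [DecidableEq α] (a b : α) : sgn (a = b) = sgn (b = a) := by
  simp only [sgn, eq_comm]

lemma units_mul_self_cancel (s t : ℤˣ) : s * (s * t) = t := by
  rw [← mul_assoc, Int.units_mul_self, one_mul]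

/-- `A` and `B` commute up to the sign `s`. -/
def Twist {R : Type} [Ring R] (s : ℤˣ) (A B : R) : Prop := A * B = (s : ℤ) • (B * A)

namespace Twist

section Ring

variable {R : Type} [Ring R] {s t : ℤˣ} {A B C : R}

lemma one_iff : Twist 1 A B ↔ A * B = B * A := by simp [Twist]

lemma neg_one_iff : Twist (-1) A B ↔ A * B = -(B * A) := by simp [Twist]

lemma congr (h : Twist s A B) (e : s = t) : Twist t A B := e ▸ h

lemma symm (h : Twist s A B) : Twist s B A := by
  unfold Twist at *
  rw [h, smul_smul, ← Units.val_mul, Int.units_mul_self, Units.val_one, one_smul]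

lemma mul_right (h : Twist s A B) (h' : Twist t A C) : Twist (s * t) A (B * C) := by
  unfold Twist at *
  rw [← mul_assoc, h, smul_mul_assoc, mul_assoc, h', mul_smul_comm, smul_smul, Units.val_mul,
    mul_assoc]

lemma mul_left (h : Twist s A C) (h' : Twist t B C) : Twist (s * t) (A * B) C :=
  (h.symm.mul_right h'.symm).symm

lemma neg_right (h : Twist s A B) : Twist s A (-B) := by
  unfold Twist at *
  rw [mul_neg, neg_mul, h, smul_neg]

lemma smul_right [Algebra ℂ R] (a : ℂ) (h : Twist s A B) : Twist s A (a • B) := by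
  unfold Twist at *
  rw [mul_smul_comm, smul_mul_assoc, h, smul_comm]

lemma smul_left [Algebra ℂ R] (a : ℂ) (h : Twist s A B) : Twist s (a • A) B :=
  (h.symm.smul_right a).symm

lemma refl (A : R) : Twist 1 A A := one_iff.2 rfl

lemma one_right (A : R) : Twist 1 A 1 := one_iff.2 (by simp)

/-- The square of a product of operators that commute up to a sign. -/
lemma sq_mul (h : Twist s A B) (hA : A * A = 1) : A * B * (A * B) = (s : ℤ) • (B * B) := by
  rw [mul_assoc, ← mul_assoc B, h.symm, smul_mul_assoc, mul_smul_comm, mul_assoc, ← mul_assoc A,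
    hA, one_mul]

end Ring

end Twist

/-! ### Pauli operators on qubits -/

lemma pauliX_mul_self : pauliX * pauliX = 1 := by
  ext i j; fin_cases i <;> fin_cases j <;> simp [pauliX]

lemma pauliY_mul_self : pauliY * pauliY = 1 := by
  ext i j; fin_cases i <;> fin_cases j <;> simp [pauliY]

lemma pauliZ_mul_self : pauliZ * pauliZ = 1 := by
  ext i j; fin_cases i <;> fin_cases j <;> simp [pauliZ]

lemma pauliX_mul_pauliY : pauliX * pauliY = Complex.I • pauliZ := by
  ext i j; fin_cases i <;> fin_cases j <;> simp [pauliX, pauliY, pauliZ]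

lemma pauliY_mul_pauliX : pauliY * pauliX = -(Complex.I • pauliZ) := by
  ext i j; fin_cases i <;> fin_cases j <;> simp [pauliX, pauliY, pauliZ]

lemma twist_X_Y : Twist (-1) pauliX pauliY := by
  rw [Twist.neg_one_iff, pauliX_mul_pauliY, pauliY_mul_pauliX, neg_neg]

lemma twist_Z_X : Twist (-1) pauliZ pauliX := by
  rw [Twist.neg_one_iff]
  ext i j; fin_cases i <;> fin_cases j <;> simp [pauliX, pauliZ]

lemma twist_Z_Y : Twist (-1) pauliZ pauliY := by
  rw [Twist.neg_one_iff]
  ext i j; fin_cases i <;> fin_cases j <;> simp [pauliY, pauliZ]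

lemma pauliX_herm : pauliX.conjTranspose = pauliX := by
  ext i j; fin_cases i <;> fin_cases j <;> simp [pauliX]

lemma pauliY_herm : pauliY.conjTranspose = pauliY := by
  ext i j; fin_cases i <;> fin_cases j <;> simp [pauliY]

lemma pauliZ_herm : pauliZ.conjTranspose = pauliZ := by
  ext i j; fin_cases i <;> fin_cases j <;> simp [pauliZ]

section TensorOp

variable {Q : Type} [Fintype Q] [DecidableEq Q]

lemma toEuclideanLin_mul {n : Type} [Fintype n] [DecidableEq n] (A B : Matrix n n ℂ) :
    (Matrix.toEuclideanLin (A * B) : Module.End ℂ (EuclideanSpace ℂ n)) =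
      Matrix.toEuclideanLin A * Matrix.toEuclideanLin B := by
  ext x k
  simp [Matrix.toLpLin_apply]

lemma toEuclideanLin_one {n : Type} [Fintype n] [DecidableEq n] :
    (Matrix.toEuclideanLin (1 : Matrix n n ℂ) : Module.End ℂ (EuclideanSpace ℂ n)) = 1 := by
  ext x k
  simp

lemma tensorOp_mul (M N : Q → Matrix (Fin 2) (Fin 2) ℂ) :
    tensorOp M * tensorOp N = tensorOp fun q => M q * N q := by
  rw [tensorOp, tensorOp, ← toEuclideanLin_mul, tensorOp]
  congr 1
  ext s t
  simp only [Matrix.mul_apply, Matrix.of_apply, ← Finset.prod_mul_distrib]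
  rw [Finset.prod_univ_sum, Fintype.piFinset_univ]

lemma tensorOp_one : tensorOp (fun _ : Q => 1) = 1 := by
  rw [tensorOp, ← toEuclideanLin_one]
  congr 1
  ext s t
  simp only [Matrix.of_apply, Matrix.one_apply, Finset.prod_ite_zero]
  simp [funext_iff]

lemma tensorOp_units_smul (s : Q → ℤˣ) (M : Q → Matrix (Fin 2) (Fin 2) ℂ) :
    tensorOp (fun q => (s q : ℤ) • M q) = ((∏ q, s q : ℤˣ) : ℤ) • tensorOp M := by
  rw [tensorOp, tensorOp, ← map_zsmul]
  congr 1
  ext a b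
  simp [Finset.prod_mul_distrib, Units.coe_prod]

lemma twist_tensorOp {M N : Q → Matrix (Fin 2) (Fin 2) ℂ} (s : Q → ℤˣ)
    (h : ∀ q, Twist (s q) (M q) (N q)) : Twist (∏ q, s q) (tensorOp M) (tensorOp N) := by
  unfold Twist
  rw [tensorOp_mul, tensorOp_mul, ← tensorOp_units_smul]
  congr 1
  funext q
  exact h q

lemma tensorOp_mul_self {M : Q → Matrix (Fin 2) (Fin 2) ℂ} (h : ∀ q, M q * M q = 1) :
    tensorOp M * tensorOp M = 1 := by
  rw [tensorOp_mul, ← tensorOp_one]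
  congr 1
  funext q
  exact h q

lemma toEuclideanLin_symm {n : Type} [Fintype n] [DecidableEq n] {A : Matrix n n ℂ}
    (h : A.conjTranspose = A) : (Matrix.toEuclideanLin A).IsSymmetric := by
  rw [LinearMap.isSymmetric_iff_isSelfAdjoint, isSelfAdjoint_iff, LinearMap.star_eq_adjoint,
    ← Matrix.toEuclideanLin_conjTranspose_eq_adjoint, h]

lemma tensorOp_symm {M : Q → Matrix (Fin 2) (Fin 2) ℂ} (h : ∀ q, (M q).conjTranspose = M q) :
    (tensorOp M).IsSymmetric := by
  refine toEuclideanLin_symm ?_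
  ext s t
  simp only [Matrix.conjTranspose_apply, Matrix.of_apply, star_prod]
  exact Finset.prod_congr rfl fun q _ => congrFun (congrFun (h q) _) _

lemma twist_onQubit_tensorOp {s : ℤˣ} {q : Q} {P : Matrix (Fin 2) (Fin 2) ℂ}
    {N : Q → Matrix (Fin 2) (Fin 2) ℂ} (h : Twist s P (N q)) :
    Twist s (onQubit q P) (tensorOp N) := by
  refine (twist_tensorOp (fun r => if r = q then s else 1) fun r => ?_).congr (by simp)
  rcases eq_or_ne r q with rfl | hr
  · simpa using h
  · simpa [hr] using (Twist.one_right (N r)).symm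

lemma twist_onQubit_of_ne {q r : Q} (h : q ≠ r) (P P' : Matrix (Fin 2) (Fin 2) ℂ) :
    Twist 1 (onQubit q P) (onQubit r P') :=
  twist_onQubit_tensorOp (by simpa [h] using Twist.one_right P)

lemma onQubit_mul_self {P : Matrix (Fin 2) (Fin 2) ℂ} (h : P * P = 1) (q : Q) :
    onQubit q P * onQubit q P = 1 := by
  refine tensorOp_mul_self fun r => ?_
  rcases eq_or_ne r q with rfl | hr
  · simpa using h
  · simp [hr]

lemma onQubit_symm {P : Matrix (Fin 2) (Fin 2) ℂ} (h : P.conjTranspose = P) (q : Q) :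
    (onQubit q P).IsSymmetric := by
  refine tensorOp_symm fun r => ?_
  rcases eq_or_ne r q with rfl | hr
  · simpa using h
  · simp [hr]

end TensorOp

/-! ### The lattice and its encoded operators -/

section Lattice

variable {L₁ L₂ : ℕ}

lemma arrow_iff {i j : Vertex L₁ L₂} : Arrow i j ↔
    ((i.2 : ℕ) = j.2 ∧ (((i.2 : ℕ) % 2 = 0 ∧ (i.1 : ℕ) = j.1 + 1) ∨
      ((i.2 : ℕ) % 2 = 1 ∧ (j.1 : ℕ) = i.1 + 1))) ∨
    ((i.1 : ℕ) = j.1 ∧ (((i.1 : ℕ) % 2 = 0 ∧ (i.2 : ℕ) = j.2 + 1) ∨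
      ((i.1 : ℕ) % 2 = 1 ∧ (j.2 : ℕ) = i.2 + 1))) := by
  simp only [Arrow, Nat.even_iff, Nat.odd_iff, Fin.ext_iff]

lemma vertex_ext {i j : Vertex L₁ L₂} : i = j ↔ (i.1 : ℕ) = j.1 ∧ (i.2 : ℕ) = j.2 := by
  rw [Prod.ext_iff, Fin.ext_iff, Fin.ext_iff]

lemma face_ext {f g : Face L₁ L₂} : f = g ↔ (f.1 : ℕ) = g.1 ∧ (f.2 : ℕ) = g.2 := by
  rw [Prod.ext_iff, Fin.ext_iff, Fin.ext_iff]

lemma isOddFace_iff {f : Face L₁ L₂} : IsOddFace f ↔ ((f.1 : ℕ) + f.2) % 2 = 0 := Nat.even_iff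

lemma Arrow.ne {i j : Vertex L₁ L₂} (h : Arrow i j) : i ≠ j := by
  rw [arrow_iff] at h
  rw [Ne, vertex_ext]
  omega

lemma Arrow.not_symm {i j : Vertex L₁ L₂} (h : Arrow i j) : ¬ Arrow j i := by
  rw [arrow_iff] at *
  omega

lemma Adjacent.symm {i j : Vertex L₁ L₂} (h : Adjacent i j) : Adjacent j i := Or.symm h

lemma adjacent_iff {i j : Vertex L₁ L₂} : Adjacent i j ↔
    ((i.2 : ℕ) = j.2 ∧ ((i.1 : ℕ) = j.1 + 1 ∨ (j.1 : ℕ) = i.1 + 1)) ∨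
    ((i.1 : ℕ) = j.1 ∧ ((i.2 : ℕ) = j.2 + 1 ∨ (j.2 : ℕ) = i.2 + 1)) := by
  rw [Adjacent, arrow_iff, arrow_iff]
  omega

lemma encodedEdge_of_arrow {i j : Vertex L₁ L₂} (h : Arrow i j) :
    encodedEdge i j = arrowOp i j := if_pos h

lemma encodedEdge_of_arrow' {i j : Vertex L₁ L₂} (h : Arrow j i) :
    encodedEdge i j = -arrowOp j i := by
  rw [encodedEdge, if_neg h.not_symm, if_pos h]

/-- The Pauli string of an edge operator, without its sign. -/
def edgeString (i j : Vertex L₁ L₂) : Qubit L₁ L₂ → Matrix (Fin 2) (Fin 2) ℂ :=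
  Sum.elim (fun v => if v = i then pauliX else if v = j then pauliY else 1)
    (fun f => if Touches f.1 i ∧ Touches f.1 j then
      (if i.2 = j.2 then pauliY else pauliX) else 1)

lemma arrowOp_eq (i j : Vertex L₁ L₂) :
    arrowOp i j = (if (i.2 : ℕ) < j.2 then (-1 : ℂ) else 1) • tensorOp (edgeString i j) := rfl

lemma arrowOp_eq_pos {i j : Vertex L₁ L₂} (h : ¬ (i.2 : ℕ) < j.2) :
    arrowOp i j = tensorOp (edgeString i j) := by rw [arrowOp_eq, if_neg h, one_smul]

lemma arrowOp_eq_neg {i j : Vertex L₁ L₂} (h : (i.2 : ℕ) < j.2) :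
    arrowOp i j = -tensorOp (edgeString i j) := by rw [arrowOp_eq, if_pos h, neg_smul, one_smul]

lemma arrowOp_mul_self (i j : Vertex L₁ L₂) : arrowOp i j * arrowOp i j = 1 := by
  have h : tensorOp (edgeString i j) * tensorOp (edgeString i j) = 1 := by
    refine tensorOp_mul_self fun q => ?_
    rcases q with v | f <;> simp only [edgeString, Sum.elim_inl, Sum.elim_inr] <;> split_ifs <;>
      simp [pauliX_mul_self, pauliY_mul_self]
  by_cases hlt : (i.2 : ℕ) < j.2
  · rw [arrowOp_eq_neg hlt, neg_mul_neg, h]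
  · rw [arrowOp_eq_pos hlt, h]

lemma arrowOp_symm (i j : Vertex L₁ L₂) : (arrowOp i j).IsSymmetric := by
  have h : (tensorOp (edgeString i j)).IsSymmetric := by
    refine tensorOp_symm fun q => ?_
    rcases q with v | f <;> simp only [edgeString, Sum.elim_inl, Sum.elim_inr] <;> split_ifs <;>
      simp [pauliX_herm, pauliY_herm]
  by_cases hlt : (i.2 : ℕ) < j.2
  · rw [arrowOp_eq_neg hlt]
    intro x y
    simpa using h x y
  · rwa [arrowOp_eq_pos hlt]

/-- Perpendicular edges border a common odd face if and only if they have a common tail or a common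
head; then there is exactly one such face. -/
lemma prod_sgn_oddFace {i j k l : Vertex L₁ L₂} (hij : Arrow i j) (hkl : Arrow k l) :
    ∏ f : {f : Face L₁ L₂ // IsOddFace f}, sgn ((Touches f.1 i ∧ Touches f.1 j) ∧
      (Touches f.1 k ∧ Touches f.1 l) ∧ ¬(i.2 = j.2 ↔ k.2 = l.2)) =
    sgn (i = k) * sgn (j = l) := by
  have h1 := hij
  have h2 := hkl
  rw [arrow_iff] at h1 h2
  have hi1 := i.1.2
  have hi2 := i.2.2
  have hj1 := j.1.2
  have hj2 := j.2.2
  have hk1 := k.1.2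
  have hk2 := k.2.2
  have hl1 := l.1.2
  have hl2 := l.2.2
  by_cases hik : i = k <;> by_cases hjl : j = l
  · rw [sgn_pos hik, sgn_pos hjl, Finset.prod_eq_one]
    · simp
    · rintro f -
      exact sgn_neg (by subst hik hjl; tauto)
  · subst hik
    rw [vertex_ext] at hjl
    rw [sgn_pos rfl, sgn_neg (by rwa [vertex_ext]), mul_one]
    let f₀ : Face L₁ L₂ := (⟨min (j.1 : ℕ) l.1, by omega⟩, ⟨min (j.2 : ℕ) l.2, by omega⟩)
    rw [Finset.prod_eq_single ⟨f₀, by rw [isOddFace_iff]; simp only [f₀]; omega⟩]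
    · apply sgn_pos
      simp only [Touches, f₀, Fin.ext_iff]
      omega
    · rintro ⟨g, hg⟩ - hne
      apply sgn_neg
      rw [Ne, Subtype.mk.injEq, face_ext] at hne
      simp only [Touches, f₀, Fin.ext_iff] at *
      omega
    · simp
  · subst hjl
    rw [vertex_ext] at hik
    rw [sgn_neg (by rwa [vertex_ext]), sgn_pos rfl, one_mul]
    let f₀ : Face L₁ L₂ := (⟨min (i.1 : ℕ) k.1, by omega⟩, ⟨min (i.2 : ℕ) k.2, by omega⟩)
    rw [Finset.prod_eq_single ⟨f₀, by rw [isOddFace_iff]; simp only [f₀]; omega⟩]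
    · apply sgn_pos
      simp only [Touches, f₀, Fin.ext_iff]
      omega
    · rintro ⟨g, hg⟩ - hne
      apply sgn_neg
      rw [Ne, Subtype.mk.injEq, face_ext] at hne
      simp only [Touches, f₀, Fin.ext_iff] at *
      omega
    · simp
  · rw [sgn_neg hik, sgn_neg hjl, one_mul, Finset.prod_eq_one]
    rintro ⟨f, hf⟩ -
    apply sgn_neg
    rw [isOddFace_iff] at hf
    rw [vertex_ext] at hik hjl
    simp only [Touches, Fin.ext_iff]
    omega

lemma prod_sgn_eq_and (i l : Vertex L₁ L₂) : ∏ v, sgn (v = i ∧ v = l) = sgn (i = l) := by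
  rw [Finset.prod_eq_single i]
  · simp [sgn]
  · intro v _ hv
    exact sgn_neg fun h => hv h.1
  · simp

/-- Edge operators anticommute if the edges share exactly one vertex. -/
lemma twist_arrowOp {i j k l : Vertex L₁ L₂} (hij : Arrow i j) (hkl : Arrow k l) :
    Twist (sgn (i = k) * sgn (i = l) * sgn (j = k) * sgn (j = l))
      (arrowOp i j) (arrowOp k l) := by
  rw [arrowOp_eq, arrowOp_eq]
  refine Twist.smul_left _ (Twist.smul_right _ ?_)
  refine (twist_tensorOp (Sum.elim (fun v => sgn (v = i ∧ v = l) * sgn (v = j ∧ v = k))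
    fun f => sgn ((Touches f.1 i ∧ Touches f.1 j) ∧
      (Touches f.1 k ∧ Touches f.1 l) ∧ ¬(i.2 = j.2 ↔ k.2 = l.2))) ?_).congr ?_
  · rintro (v | f)
    · have h1 := hij.ne
      have h2 := hkl.ne
      simp only [edgeString, Sum.elim_inl]
      by_cases hi : v = i
      · subst hi
        by_cases hk : v = k
        · subst hk
          simp [sgn, h1, h2, Twist.refl]
        · by_cases hl : v = l
          · subst hl
            simp [sgn, h1, h2.symm, twist_X_Y]
          · simp [sgn, h1, hk, hl, Twist.one_right]
      · by_cases hj : v = j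
        · subst hj
          by_cases hk : v = k
          · subst hk
            simp [sgn, h1.symm, twist_X_Y.symm]
          · by_cases hl : v = l
            · subst hl
              simp [sgn, hi, hk, Twist.refl]
            · simp [sgn, hi, hk, hl, Twist.one_right]
        · simp [sgn, hi, hj, (Twist.one_right _).symm]
    · simp only [edgeString, Sum.elim_inr]
      by_cases h1 : Touches f.1 i ∧ Touches f.1 j
      · by_cases h2 : Touches f.1 k ∧ Touches f.1 l
        · by_cases h3 : i.2 = j.2 <;> by_cases h4 : k.2 = l.2 <;>
            simp [sgn, h1, h2, h3, h4, Twist.refl, twist_X_Y, twist_X_Y.symm]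
        · simp [sgn, h2, Twist.one_right]
      · simp [sgn, h1, (Twist.one_right _).symm]
  · rw [Fintype.prod_sum_type]
    simp only [Sum.elim_inl, Sum.elim_inr]
    rw [Finset.prod_mul_distrib, prod_sgn_eq_and, prod_sgn_eq_and, prod_sgn_oddFace hij hkl]
    ac_rfl

/-- A property of edge operators that does not depend on the direction of the edge and on the sign
of the operator has to be checked for arrows only. -/
lemma twist_encodedEdge {T : Module.End ℂ (QubitSpace (Qubit L₁ L₂))}
    {s : Vertex L₁ L₂ → Vertex L₁ L₂ → ℤˣ} (hs : ∀ i j, s i j = s j i)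
    (h : ∀ i j, Arrow i j → Twist (s i j) T (arrowOp i j)) {i j : Vertex L₁ L₂}
    (hij : Adjacent i j) : Twist (s i j) T (encodedEdge i j) := by
  rcases hij with h1 | h1
  · rw [encodedEdge_of_arrow h1]
    exact h i j h1
  · rw [encodedEdge_of_arrow' h1, hs]
    exact (h j i h1).neg_right

lemma encodedEdge_swap {i j : Vertex L₁ L₂} (hij : Adjacent i j) :
    encodedEdge j i = -encodedEdge i j := by
  rcases hij with h1 | h1
  · rw [encodedEdge_of_arrow h1, encodedEdge_of_arrow' h1]
  · rw [encodedEdge_of_arrow h1, encodedEdge_of_arrow' h1, neg_neg]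

lemma encodedEdge_mul_self {i j : Vertex L₁ L₂} (hij : Adjacent i j) :
    encodedEdge i j * encodedEdge i j = 1 := by
  rcases hij with h1 | h1
  · rw [encodedEdge_of_arrow h1, arrowOp_mul_self]
  · rw [encodedEdge_of_arrow' h1, neg_mul_neg, arrowOp_mul_self]

lemma encodedEdge_symm {i j : Vertex L₁ L₂} (hij : Adjacent i j) :
    (encodedEdge i j).IsSymmetric := by
  rcases hij with h1 | h1
  · rw [encodedEdge_of_arrow h1]
    exact arrowOp_symm i j
  · rw [encodedEdge_of_arrow' h1]
    intro x y
    simpa using arrowOp_symm j i x y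

lemma twist_vertex_arrowOp (k i j : Vertex L₁ L₂) (hij : Arrow i j) :
    Twist (sgn (k = i) * sgn (k = j)) (encodedVertex k) (arrowOp i j) := by
  rw [arrowOp_eq]
  refine Twist.smul_right _ (twist_onQubit_tensorOp ?_)
  simp only [edgeString, Sum.elim_inl]
  by_cases hi : k = i
  · subst hi
    simp [sgn, hij.ne, twist_Z_X]
  · by_cases hj : k = j
    · subst hj
      simp [sgn, hi, twist_Z_Y]
    · simp [sgn, hi, hj, Twist.one_right]

lemma twist_faceY_arrowOp (f : {f : Face L₁ L₂ // IsOddFace f}) (i j : Vertex L₁ L₂) :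
    Twist (sgn ((Touches f.1 i ∧ Touches f.1 j) ∧ ¬ i.2 = j.2))
      (onQubit (Sum.inr f) pauliY) (arrowOp i j) := by
  rw [arrowOp_eq]
  refine Twist.smul_right _ (twist_onQubit_tensorOp ?_)
  simp only [edgeString, Sum.elim_inr]
  by_cases h1 : Touches f.1 i ∧ Touches f.1 j
  · by_cases h3 : i.2 = j.2 <;> simp [sgn, h1, h3, Twist.refl, twist_X_Y.symm]
  · simp [sgn, h1, Twist.one_right]

lemma twist_faceX_arrowOp (f : {f : Face L₁ L₂ // IsOddFace f}) (i j : Vertex L₁ L₂) :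
    Twist (sgn ((Touches f.1 i ∧ Touches f.1 j) ∧ i.2 = j.2))
      (onQubit (Sum.inr f) pauliX) (arrowOp i j) := by
  rw [arrowOp_eq]
  refine Twist.smul_right _ (twist_onQubit_tensorOp ?_)
  simp only [edgeString, Sum.elim_inr]
  by_cases h1 : Touches f.1 i ∧ Touches f.1 j
  · by_cases h3 : i.2 = j.2 <;> simp [sgn, h1, h3, Twist.refl, twist_X_Y]
  · simp [sgn, h1, Twist.one_right]

/-- If both side lengths are even, the edges at a corner all point into it or all point away. -/
lemma not_arrow_of_corner (h₁ : Even L₁) (h₂ : Even L₂) {c i : Vertex L₁ L₂}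
    (hc : c ∈ corners L₁ L₂) (hi : Arrow i c) (j : Vertex L₁ L₂) : ¬ Arrow c j := by
  rw [Nat.even_iff] at h₁ h₂
  simp only [corners, Set.mem_ofPred_eq] at hc
  rw [arrow_iff] at *
  have := i.1.2
  have := i.2.2
  have := j.1.2
  have := j.2.2
  omega

lemma twist_corner_arrowOp (h₁ : Even L₁) (h₂ : Even L₂) {c : Vertex L₁ L₂}
    (hc : c ∈ corners L₁ L₂) (i j : Vertex L₁ L₂) (hij : Arrow i j) :
    Twist (sgn (c = i) * sgn (c = j)) (cornerOp c) (arrowOp i j) := by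
  rw [arrowOp_eq]
  refine Twist.smul_right _ ?_
  by_cases hi : c = i
  · subst hi
    rw [cornerOp, if_neg fun h => h j hij]
    refine twist_onQubit_tensorOp ?_
    simp [edgeString, sgn, hij.ne, twist_X_Y.symm]
  · by_cases hj : c = j
    · subst hj
      rw [cornerOp, if_pos (not_arrow_of_corner h₁ h₂ hc hij)]
      refine twist_onQubit_tensorOp ?_
      simp [edgeString, sgn, hi, twist_X_Y]
    · rw [cornerOp]
      split_ifs <;> refine twist_onQubit_tensorOp ?_ <;>
        simp [edgeString, sgn, hi, hj, Twist.one_right]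

end Lattice

section Stabilizers

variable {L₁ L₂ : ℕ}

/-! ### The commutation relations of edge, vertex and corner operators -/

/-- The relations up to sign that the fermionic edge operators `E`, the vertex operators `Z` and the
corner operators `M` satisfy; the relations around the faces are not among them. -/
structure FermionRelations {H : Type} [NormedAddCommGroup H] [InnerProductSpace ℂ H]
    (E : Vertex L₁ L₂ → Vertex L₁ L₂ → Module.End ℂ H) (Z M : Vertex L₁ L₂ → Module.End ℂ H) :
    Prop where
  edge_symm : ∀ i j, Adjacent i j → (E i j).IsSymmetric
  edge_sq : ∀ i j, Adjacent i j → E i j * E i j = 1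
  edge_swap : ∀ i j, Adjacent i j → E j i = -E i j
  edge_edge : ∀ i j k l, Adjacent i j → Adjacent k l →
    Twist (sgn (k = i) * sgn (l = i) * (sgn (k = j) * sgn (l = j))) (E k l) (E i j)
  vertex_symm : ∀ i, (Z i).IsSymmetric
  vertex_sq : ∀ i, Z i * Z i = 1
  vertex_vertex : ∀ i j, Twist 1 (Z i) (Z j)
  vertex_edge : ∀ k i j, Adjacent i j → Twist (sgn (k = i) * sgn (k = j)) (Z k) (E i j)
  corner_symm : ∀ c ∈ corners L₁ L₂, (M c).IsSymmetric
  corner_sq : ∀ c ∈ corners L₁ L₂, M c * M c = 1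
  corner_corner : ∀ c ∈ corners L₁ L₂, ∀ d ∈ corners L₁ L₂, Twist 1 (M c) (M d)
  corner_edge : ∀ c ∈ corners L₁ L₂, ∀ i j, Adjacent i j →
    Twist (sgn (c = i) * sgn (c = j)) (M c) (E i j)
  vertex_corner : ∀ k, ∀ c ∈ corners L₁ L₂, Twist (sgn (k = c)) (Z k) (M c)

theorem encoded_fermionRelations (h₁ : Even L₁) (h₂ : Even L₂) :
    FermionRelations (L₁ := L₁) (L₂ := L₂) encodedEdge encodedVertex cornerOp where
  edge_symm _ _ h := encodedEdge_symm h
  edge_sq _ _ h := encodedEdge_mul_self h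
  edge_swap _ _ h := encodedEdge_swap h
  edge_edge i j k l hij hkl := by
    refine twist_encodedEdge (s := fun i j => sgn (k = i) * sgn (l = i) * (sgn (k = j) * sgn (l = j)))
      (fun i j => by ac_rfl) (fun i j h => ?_) hij
    refine (twist_encodedEdge (s := fun k l => sgn (k = i) * sgn (l = i) *
      (sgn (k = j) * sgn (l = j))) (fun k l => by ac_rfl) (fun k l h' => ?_) hkl).symm
    refine (twist_arrowOp h h').congr ?_
    rw [sgn_comm k, sgn_comm l, sgn_comm k, sgn_comm l]
    ac_rfl
  vertex_symm _ := onQubit_symm pauliZ_herm _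
  vertex_sq _ := onQubit_mul_self pauliZ_mul_self _
  vertex_vertex i j := by
    rcases eq_or_ne i j with rfl | h
    · exact Twist.refl _
    · exact twist_onQubit_of_ne (by simpa using h) _ _
  vertex_edge k i j hij := twist_encodedEdge (s := fun i j => sgn (k = i) * sgn (k = j))
    (fun i j => mul_comm _ _) (fun i j => twist_vertex_arrowOp k i j) hij
  corner_symm c _ := by
    rw [cornerOp]
    split_ifs
    exacts [onQubit_symm pauliX_herm _, onQubit_symm pauliY_herm _]
  corner_sq c _ := by
    rw [cornerOp]
    split_ifs
    exacts [onQubit_mul_self pauliX_mul_self _, onQubit_mul_self pauliY_mul_self _]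
  corner_corner c _ d _ := by
    rcases eq_or_ne c d with rfl | h
    · exact Twist.refl _
    · rw [cornerOp, cornerOp]
      split_ifs <;> exact twist_onQubit_of_ne (by simpa using h) _ _
  corner_edge c hc i j hij := twist_encodedEdge (s := fun i j => sgn (c = i) * sgn (c = j))
    (fun i j => mul_comm _ _) (fun i j => twist_corner_arrowOp h₁ h₂ hc i j) hij
  vertex_corner k c _ := by
    rw [cornerOp]
    rcases eq_or_ne k c with rfl | h
    · rw [sgn_pos rfl]
      split_ifs
      · exact twist_onQubit_tensorOp (by simpa using twist_Z_X)
      · exact twist_onQubit_tensorOp (by simpa using twist_Z_Y)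
    · rw [sgn_neg h]
      split_ifs <;> exact twist_onQubit_of_ne (by simpa using h) _ _

/-! ### Stabilizers -/

lemma adjacent_face (f : Face L₁ L₂) :
    Adjacent (faceVertex f 0 0) (faceVertex f 1 0) ∧ Adjacent (faceVertex f 1 0) (faceVertex f 1 1) ∧
    Adjacent (faceVertex f 1 1) (faceVertex f 0 1) ∧
    Adjacent (faceVertex f 0 1) (faceVertex f 0 0) := by
  simp [adjacent_iff, faceVertex]

/-- An operator whose commutation sign with the edge `i j` is a product `s i * s j` commutes with
the stabilizers. -/
lemma twist_stabilizer {T : Module.End ℂ (QubitSpace (Qubit L₁ L₂))} (s : Vertex L₁ L₂ → ℤˣ)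
    (h : ∀ i j, Adjacent i j → Twist (s i * s j) T (encodedEdge i j)) (f : Face L₁ L₂) :
    Twist 1 T (stabilizer f) := by
  obtain ⟨h1, h2, h3, h4⟩ := adjacent_face f
  refine ((((h _ _ h1).mul_right (h _ _ h2)).mul_right (h _ _ h3)).mul_right (h _ _ h4)).congr ?_
  generalize s (faceVertex f 0 0) = a
  generalize s (faceVertex f 1 0) = b
  generalize s (faceVertex f 1 1) = c
  generalize s (faceVertex f 0 1) = d
  calc a * b * (b * c) * (c * d) * (d * a) = (a * a) * (b * b) * (c * c) * (d * d) := by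
        ac_rfl
    _ = 1 := by simp [Int.units_mul_self]

lemma twist_edge_stabilizer (h₁ : Even L₁) (h₂ : Even L₂) {k l : Vertex L₁ L₂}
    (hkl : Adjacent k l) (f : Face L₁ L₂) : Twist 1 (encodedEdge k l) (stabilizer f) :=
  twist_stabilizer (fun a => sgn (k = a) * sgn (l = a))
    (fun i j hij => (encoded_fermionRelations h₁ h₂).edge_edge i j k l hij hkl) f

lemma twist_stabilizer_stabilizer (h₁ : Even L₁) (h₂ : Even L₂) (f g : Face L₁ L₂) :
    Twist 1 (stabilizer f) (stabilizer g) := by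
  obtain ⟨a1, a2, a3, a4⟩ := adjacent_face f
  exact (((twist_edge_stabilizer h₁ h₂ a1 g).mul_left (twist_edge_stabilizer h₁ h₂ a2 g)).mul_left
    (twist_edge_stabilizer h₁ h₂ a3 g)).mul_left (twist_edge_stabilizer h₁ h₂ a4 g)

lemma stabilizer_mul_self (h₁ : Even L₁) (h₂ : Even L₂) (f : Face L₁ L₂) :
    stabilizer f * stabilizer f = 1 := by
  obtain ⟨a1, a2, a3, a4⟩ := adjacent_face f
  have R := encoded_fermionRelations h₁ h₂
  have ne : ∀ a b c d : Fin 2, (a ≠ c ∨ b ≠ d) → faceVertex f a b ≠ faceVertex f c d := by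
    intro a b c d h e
    rw [vertex_ext] at e
    simp only [faceVertex] at e
    omega
  have n1 := ne 0 0 1 0 (by simp)
  have n2 := ne 0 0 1 1 (by simp)
  have n3 := ne 0 0 0 1 (by simp)
  have n4 := ne 1 0 1 1 (by simp)
  have n5 := ne 1 0 0 1 (by simp)
  have n6 := ne 1 1 0 1 (by simp)
  have t12 := R.edge_edge _ _ _ _ a2 a1
  have t13 := R.edge_edge _ _ _ _ a3 a1
  have t14 := R.edge_edge _ _ _ _ a4 a1
  have t23 := R.edge_edge _ _ _ _ a3 a2
  have t24 := R.edge_edge _ _ _ _ a4 a2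
  have t34 := R.edge_edge _ _ _ _ a4 a3
  simp only [sgn, n1, n2, n3, n4, n5, n6, n1.symm, n2.symm, n3.symm, if_true, if_false, one_mul, mul_one] at t12 t13 t14 t23 t24 t34
  have q1 := R.edge_sq _ _ a1
  have q2 := R.edge_sq _ _ a2
  have q3 := R.edge_sq _ _ a3
  have q4 := R.edge_sq _ _ a4
  have e : stabilizer f = encodedEdge (faceVertex f 0 0) (faceVertex f 1 0) *
      (encodedEdge (faceVertex f 1 0) (faceVertex f 1 1) *
      (encodedEdge (faceVertex f 1 1) (faceVertex f 0 1) *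
      encodedEdge (faceVertex f 0 1) (faceVertex f 0 0))) := by
    rw [stabilizer, mul_assoc, mul_assoc]
  rw [e, ((t12.mul_right (t13.mul_right t14)).sq_mul q1), ((t23.mul_right t24).sq_mul q2),
    t34.sq_mul q3, q4]
  simp

/-- The vertex factors cancel in a loop of four edges in which `s` and `s'` are sources and `t` and
`t'` are sinks. -/
lemma edgeString_loop {s s' t t' : Vertex L₁ L₂} (hs : s ≠ s') (h₁ : s ≠ t) (h₂ : s ≠ t')
    (h₃ : s' ≠ t) (h₄ : s' ≠ t') (ht : t ≠ t') (v : Vertex L₁ L₂) :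
    edgeString s t (Sum.inl v) * edgeString s t' (Sum.inl v) * edgeString s' t' (Sum.inl v) *
      edgeString s' t (Sum.inl v) = 1 ∧
    edgeString s t (Sum.inl v) * edgeString s' t (Sum.inl v) * edgeString s' t' (Sum.inl v) *
      edgeString s t' (Sum.inl v) = 1 := by
  simp only [edgeString, Sum.elim_inl]
  rcases eq_or_ne v s with rfl | e1
  · simp [hs, h₁, h₂, pauliX_mul_self]
  rcases eq_or_ne v s' with rfl | e2
  · simp [e1, h₃, h₄, pauliX_mul_self]
  rcases eq_or_ne v t with rfl | e3
  · simp [e1, e2, ht, pauliY_mul_self]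
  rcases eq_or_ne v t' with rfl | e4
  · simp [e1, e2, e3, pauliY_mul_self]
  · simp [e1, e2, e3, e4]

/-- The stabilizers of odd faces are trivial. -/
lemma stabilizer_of_odd {f : Face L₁ L₂} (hf : IsOddFace f) : stabilizer f = 1 := by
  have hodd := isOddFace_iff.1 hf
  have ne : ∀ a b c d : Fin 2, (a ≠ c ∨ b ≠ d) → faceVertex f a b ≠ faceVertex f c d := by
    intro a b c d h e
    rw [vertex_ext] at e
    simp only [faceVertex] at e
    omega
  -- only the odd face `f` itself borders the edges of `f`
  have other : ∀ (g : {g : Face L₁ L₂ // IsOddFace g}) (a b c d : Fin 2), (a = c ∧ b ≠ d ∨ a ≠ c ∧ b = d) →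
      ((Touches g.1 (faceVertex f a b) ∧ Touches g.1 (faceVertex f c d)) ↔ g = ⟨f, hf⟩) := by
    rintro ⟨g, hg⟩ a b c d h
    rw [isOddFace_iff] at hg
    rw [Subtype.mk.injEq, face_ext]
    simp only [Touches, faceVertex]
    omega
  have horiz : ∀ a b c d : Fin 2, (faceVertex f a b).2 = (faceVertex f c d).2 ↔ b = d := by
    intro a b c d
    simp only [faceVertex, Fin.ext_iff]
    omega
  have hprod : ∀ A B C D : Qubit L₁ L₂ → Matrix (Fin 2) (Fin 2) ℂ,
      (∀ v, A (Sum.inl v) * B (Sum.inl v) * C (Sum.inl v) * D (Sum.inl v) = 1) →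
      (∀ g, A (Sum.inr g) * B (Sum.inr g) * C (Sum.inr g) * D (Sum.inr g) =
        if g = ⟨f, hf⟩ then -1 else 1) →
      tensorOp A * tensorOp B * tensorOp C * tensorOp D = -1 := by
    intro A B C D h1 h2
    rw [tensorOp_mul, tensorOp_mul, tensorOp_mul]
    have e : (fun q => A q * B q * C q * D q) =
        fun q => (((if q = Sum.inr ⟨f, hf⟩ then -1 else 1 : ℤˣ) : ℤˣ) : ℤ) •
          (1 : Matrix (Fin 2) (Fin 2) ℂ) := by
      funext q
      rcases q with v | g
      · simp [h1 v]
      · by_cases hg : g = ⟨f, hf⟩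
        · subst hg
          simp [h2 ⟨f, hf⟩]
        · simp [h2 g, hg]
    rw [e, tensorOp_units_smul, tensorOp_one]
    simp
  have n1 := ne 0 0 1 0 (by simp)
  have n2 := ne 0 0 1 1 (by simp)
  have n3 := ne 0 0 0 1 (by simp)
  have n4 := ne 1 0 1 1 (by simp)
  have n5 := ne 1 0 0 1 (by simp)
  have n6 := ne 1 1 0 1 (by simp)
  have hXY : ∀ P Q : Matrix (Fin 2) (Fin 2) ℂ, P * P = 1 → Q * Q = 1 → P * Q = -(Q * P) →
      P * Q * P * Q = -1 := by
    intro P Q hP hQ h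
    rw [h, neg_mul, mul_assoc Q, hP, mul_one, neg_mul, hQ]
  have hYXYX := hXY _ _ pauliY_mul_self pauliX_mul_self (Twist.neg_one_iff.1 twist_X_Y.symm)
  rcases Nat.mod_two_eq_zero_or_one (f.1 : ℕ) with hx | hx
  · have e1 : Arrow (faceVertex f 1 0) (faceVertex f 0 0) := by
      rw [arrow_iff]; simp only [faceVertex]; simp; omega
    have e2 : Arrow (faceVertex f 1 0) (faceVertex f 1 1) := by
      rw [arrow_iff]; simp only [faceVertex]; simp; omega
    have e3 : Arrow (faceVertex f 0 1) (faceVertex f 1 1) := by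
      rw [arrow_iff]; simp only [faceVertex]; simp; omega
    have e4 : Arrow (faceVertex f 0 1) (faceVertex f 0 0) := by
      rw [arrow_iff]; simp only [faceVertex]; simp; omega
    rw [stabilizer, encodedEdge_of_arrow' e1, encodedEdge_of_arrow e2, encodedEdge_of_arrow' e3,
      encodedEdge_of_arrow e4, arrowOp_eq_pos (by simp [faceVertex]),
      arrowOp_eq_neg (by simp [faceVertex]), arrowOp_eq_pos (by simp [faceVertex]),
      arrowOp_eq_pos (by simp [faceVertex])]
    simp only [neg_mul, mul_neg, neg_neg]
    rw [hprod, neg_neg]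
    · exact fun v => (edgeString_loop n5 n1.symm n4 n3.symm n6.symm n2 v).1
    · intro g
      simp only [edgeString, Sum.elim_inr]
      rw [if_congr (other g 1 0 0 0 (by simp)) rfl rfl, if_congr (other g 1 0 1 1 (by simp)) rfl rfl,
        if_congr (other g 0 1 1 1 (by simp)) rfl rfl, if_congr (other g 0 1 0 0 (by simp)) rfl rfl]
      simp only [horiz]
      by_cases hg : g = ⟨f, hf⟩
      · simpa [hg] using hYXYX
      · simp [hg]
  · have e1 : Arrow (faceVertex f 0 0) (faceVertex f 1 0) := by
      rw [arrow_iff]; simp only [faceVertex]; simp; omega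
    have e2 : Arrow (faceVertex f 1 1) (faceVertex f 1 0) := by
      rw [arrow_iff]; simp only [faceVertex]; simp; omega
    have e3 : Arrow (faceVertex f 1 1) (faceVertex f 0 1) := by
      rw [arrow_iff]; simp only [faceVertex]; simp; omega
    have e4 : Arrow (faceVertex f 0 0) (faceVertex f 0 1) := by
      rw [arrow_iff]; simp only [faceVertex]; simp; omega
    rw [stabilizer, encodedEdge_of_arrow e1, encodedEdge_of_arrow' e2, encodedEdge_of_arrow e3,
      encodedEdge_of_arrow' e4, arrowOp_eq_pos (by simp [faceVertex]),
      arrowOp_eq_pos (by simp [faceVertex]), arrowOp_eq_pos (by simp [faceVertex]),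
      arrowOp_eq_neg (by simp [faceVertex])]
    simp only [neg_mul, mul_neg, neg_neg]
    rw [hprod, neg_neg]
    · exact fun v => (edgeString_loop n2 n1 n3 n4.symm n6 n5 v).2
    · intro g
      simp only [edgeString, Sum.elim_inr]
      rw [if_congr (other g 0 0 1 0 (by simp)) rfl rfl, if_congr (other g 1 1 1 0 (by simp)) rfl rfl,
        if_congr (other g 1 1 0 1 (by simp)) rfl rfl, if_congr (other g 0 0 0 1 (by simp)) rfl rfl]
      simp only [horiz]
      by_cases hg : g = ⟨f, hf⟩
      · simpa [hg] using hYXYX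
      · simp [hg]

/-- Every even face has a single-qubit operator that anticommutes with its stabilizer and commutes
with the stabilizers of all even faces that are not closer to the origin. -/
lemma exists_destabilizer {f : Face L₁ L₂} (hf : ¬ IsOddFace f) :
    ∃ D : Module.End ℂ (QubitSpace (Qubit L₁ L₂)), D * D = 1 ∧ Twist (-1) D (stabilizer f) ∧
      ∀ g : Face L₁ L₂, f ≠ g → (f.1 : ℕ) + f.2 ≤ (g.1 : ℕ) + g.2 → Twist 1 D (stabilizer g) := by
  rw [isOddFace_iff] at hf
  have hf1 := f.1.2
  have hf2 := f.2.2
  rcases Nat.mod_two_eq_zero_or_one (f.2 : ℕ) with hy | hy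
  · let f' : {f : Face L₁ L₂ // IsOddFace f} :=
      ⟨(⟨(f.1 : ℕ) - 1, by omega⟩, f.2), by rw [isOddFace_iff]; simp only; omega⟩
    have hT : ∀ {i j : Vertex L₁ L₂}, Adjacent i j → _ := fun {i j} =>
      twist_encodedEdge (s := fun i j => sgn ((Touches f'.1 i ∧ Touches f'.1 j) ∧ ¬ i.2 = j.2))
        (fun i j => by simp only [and_comm, eq_comm]) (fun i j _ => twist_faceY_arrowOp f' i j)
        (i := i) (j := j)
    refine ⟨_, onQubit_mul_self pauliY_mul_self (Sum.inr f'), ?_, fun g hg hgf => ?_⟩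
    · obtain ⟨a1, a2, a3, a4⟩ := adjacent_face f
      refine ((((hT a1).mul_right (hT a2)).mul_right (hT a3)).mul_right (hT a4)).congr ?_
      rw [sgn_neg, sgn_neg, sgn_neg, sgn_pos]
      · rfl
      all_goals
        simp only [Touches, faceVertex, f', Fin.ext_iff]
        simp
        try omega
    · rw [Ne, face_ext] at hg
      obtain ⟨a1, a2, a3, a4⟩ := adjacent_face g
      refine ((((hT a1).mul_right (hT a2)).mul_right (hT a3)).mul_right (hT a4)).congr ?_
      rw [sgn_neg, sgn_neg, sgn_neg, sgn_neg]
      · rfl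
      all_goals
        simp only [Touches, faceVertex, f', Fin.ext_iff]
        simp
        try omega
  · let f' : {f : Face L₁ L₂ // IsOddFace f} :=
      ⟨(f.1, ⟨(f.2 : ℕ) - 1, by omega⟩), by rw [isOddFace_iff]; simp only; omega⟩
    have hT : ∀ {i j : Vertex L₁ L₂}, Adjacent i j → _ := fun {i j} =>
      twist_encodedEdge (s := fun i j => sgn ((Touches f'.1 i ∧ Touches f'.1 j) ∧ i.2 = j.2))
        (fun i j => by simp only [and_comm, eq_comm]) (fun i j _ => twist_faceX_arrowOp f' i j)
        (i := i) (j := j)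
    refine ⟨_, onQubit_mul_self pauliX_mul_self (Sum.inr f'), ?_, fun g hg hgf => ?_⟩
    · obtain ⟨a1, a2, a3, a4⟩ := adjacent_face f
      refine ((((hT a1).mul_right (hT a2)).mul_right (hT a3)).mul_right (hT a4)).congr ?_
      rw [sgn_pos, sgn_neg, sgn_neg, sgn_neg]
      · rfl
      all_goals
        simp only [Touches, faceVertex, f', Fin.ext_iff]
        simp
        try omega
    · rw [Ne, face_ext] at hg
      obtain ⟨a1, a2, a3, a4⟩ := adjacent_face g
      refine ((((hT a1).mul_right (hT a2)).mul_right (hT a3)).mul_right (hT a4)).congr ?_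
      rw [sgn_neg, sgn_neg, sgn_neg, sgn_neg]
      · rfl
      all_goals
        simp only [Touches, faceVertex, f', Fin.ext_iff]
        simp
        try omega

lemma stabilizer_ne_one_iff {f : Face L₁ L₂} : stabilizer f ≠ 1 ↔ ¬ IsOddFace f := by
  refine ⟨fun h hf => h (stabilizer_of_odd hf), fun hf h => ?_⟩
  obtain ⟨D, hD, hDf, -⟩ := exists_destabilizer hf
  rw [h, Twist.neg_one_iff, mul_one, one_mul] at hDf
  have h0 : D = 0 := by
    have : (2 : ℂ) • D = (2 : ℂ) • 0 := by
      rw [two_smul, smul_zero]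
      exact eq_neg_iff_add_eq_zero.1 hDf
    exact smul_right_injective _ two_ne_zero this
  rw [h0, mul_zero] at hD
  exact zero_ne_one hD

lemma mem_codeSpace {ψ : QubitSpace (Qubit L₁ L₂)} :
    ψ ∈ codeSpace L₁ L₂ ↔ ∀ f, stabilizer f ψ = ψ := by
  simp only [codeSpace, Submodule.mem_iInf, LinearMap.mem_ker, LinearMap.sub_apply,
    Module.End.one_apply, sub_eq_zero, Subtype.forall]
  refine ⟨fun h f => ?_, fun h f _ => h f⟩
  by_cases hf : stabilizer f = 1
  · simp [hf]
  · exact h f hf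

/-! ### Counting faces -/

lemma card_even_fin (n : ℕ) : Fintype.card {k : Fin n // Even (k : ℕ)} = (n + 1) / 2 := by
  rw [← Fintype.card_fin ((n + 1) / 2)]
  exact Fintype.card_congr
    { toFun k := ⟨(k.1 : ℕ) / 2, by have := k.1.2; have := Nat.even_iff.1 k.2; omega⟩
      invFun k := ⟨⟨2 * (k : ℕ), by have := k.2; omega⟩, by simp⟩
      left_inv k := by
        have := Nat.even_iff.1 k.2
        ext
        simp only
        omega
      right_inv k := by
        ext
        simp }

lemma card_oddFace (hodd : Odd ((L₁ - 1) * (L₂ - 1))) :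
    Fintype.card {f : Face L₁ L₂ // IsOddFace f} = ((L₁ - 1) * (L₂ - 1) + 1) / 2 := by
  rw [← card_even_fin]
  refine Fintype.card_congr (finProdFinEquiv.subtypeEquiv fun f => ?_)
  have h2 : Odd (L₂ - 1) := (Nat.odd_mul.1 hodd).2
  rw [IsOddFace, finProdFinEquiv_apply_val, Nat.even_add, Nat.even_add, Nat.even_mul]
  have : ¬ Even (L₂ - 1) := Nat.not_even_iff_odd.2 h2
  tauto

lemma card_evenFace (hodd : Odd ((L₁ - 1) * (L₂ - 1))) :
    Fintype.card {f : Face L₁ L₂ // ¬ IsOddFace f} = (L₁ - 1) * (L₂ - 1) / 2 := by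
  rw [Fintype.card_subtype_compl, card_oddFace hodd, Fintype.card_prod, Fintype.card_fin,
    Fintype.card_fin]
  have := Nat.odd_iff.1 hodd
  omega

lemma card_qubit (hodd : Odd ((L₁ - 1) * (L₂ - 1))) :
    Fintype.card (Qubit L₁ L₂) = L₁ * L₂ + ((L₁ - 1) * (L₂ - 1) + 1) / 2 := by
  rw [Fintype.card_sum, card_oddFace hodd, Fintype.card_prod, Fintype.card_fin, Fintype.card_fin]

lemma even_of_odd_sub_one {n : ℕ} (h : Odd (n - 1)) : Even n ∧ 2 ≤ n := by
  rw [Nat.odd_iff] at h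
  rw [Nat.even_iff]
  omega

lemma corners_ncard (h₁ : 2 ≤ L₁) (h₂ : 2 ≤ L₂) : (corners L₁ L₂).ncard = 4 := by
  let e : Fin 2 × Fin 2 → Vertex L₁ L₂ := fun k =>
    (⟨(k.1 : ℕ) * (L₁ - 1), by have := k.1.2; nlinarith [Nat.sub_add_cancel (show 1 ≤ L₁ by omega)]⟩,
      ⟨(k.2 : ℕ) * (L₂ - 1), by have := k.2.2; nlinarith [Nat.sub_add_cancel (show 1 ≤ L₂ by omega)]⟩)
  have he : corners L₁ L₂ = Set.range e := by
    ext v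
    simp only [corners, Set.mem_ofPred_eq, Set.mem_range, Prod.exists, vertex_ext, e,
      Fin.exists_fin_two, Fin.val_zero, Fin.val_one, zero_mul, one_mul]
    omega
  have inj : Function.Injective e := by
    rintro ⟨a, b⟩ ⟨a', b'⟩ h
    rw [vertex_ext] at h
    simp only [e, Nat.mul_left_inj (show L₁ - 1 ≠ 0 by omega),
      Nat.mul_left_inj (show L₂ - 1 ≠ 0 by omega)] at h
    exact Prod.ext (Fin.ext h.1) (Fin.ext h.2)
  rw [he, ← Set.image_univ, Set.ncard_image_of_injective _ inj, Set.ncard_univ]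
  simp

/-! ### The code space -/

theorem finrank_codeSpace (hodd : Odd ((L₁ - 1) * (L₂ - 1))) :
    Module.finrank ℂ (codeSpace L₁ L₂) = 2 ^ (L₁ * L₂ + 1) := by
  obtain ⟨ho₁, ho₂⟩ := Nat.odd_mul.1 hodd
  have h₁ := (even_of_odd_sub_one ho₁).1
  have h₂ := (even_of_odd_sub_one ho₂).1
  choose D hD hDf hDg using fun f : {f : Face L₁ L₂ // ¬ IsOddFace f} => exists_destabilizer f.2
  have key := finrank_iInf_fixedSpace (fun f : {f : Face L₁ L₂ // ¬ IsOddFace f} =>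
      -(((f.1.1 : ℕ) : ℤ) + ((f.1.2 : ℕ) : ℤ))) (fun f => stabilizer f.1) D Finset.univ
    (fun f _ => stabilizer_mul_self h₁ h₂ f.1) (fun f _ => hD f)
    (fun f _ g _ => Twist.one_iff.1 (twist_stabilizer_stabilizer h₁ h₂ _ _))
    (fun f _ => Twist.neg_one_iff.1 (hDf f).symm)
    (fun f _ g _ hne hle => Twist.one_iff.1 (hDg f g.1 (fun e => hne (Subtype.ext e)) (by omega)))
  have e : (⨅ f ∈ (Finset.univ : Finset {f : Face L₁ L₂ // ¬ IsOddFace f}),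
      fixedSpace (stabilizer f.1) : Submodule ℂ (QubitSpace (Qubit L₁ L₂))) = codeSpace L₁ L₂ := by
    ext ψ
    simp only [Submodule.mem_iInf, mem_fixedSpace, mem_codeSpace, Finset.mem_univ, true_imp_iff,
      Subtype.forall]
    refine ⟨fun h f => ?_, fun h f _ => h f⟩
    by_cases hf : IsOddFace f
    · simp [stabilizer_of_odd hf]
    · exact h f hf
  rw [e, Finset.card_univ, card_evenFace hodd, finrank_euclideanSpace, Fintype.card_fun,
    card_qubit hodd, Fintype.card_fin] at key
  have hn := Nat.odd_iff.1 hodd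
  have e2 : L₁ * L₂ + ((L₁ - 1) * (L₂ - 1) + 1) / 2 =
      (L₁ - 1) * (L₂ - 1) / 2 + (L₁ * L₂ + 1) := by omega
  rw [e2, pow_add] at key
  exact Nat.eq_of_mul_eq_mul_left (by positivity) key

end Stabilizers

section Encoding

variable {L₁ L₂ : ℕ}

/-! ### A spanning tree of the lattice -/

/-- The edges, directed away from the origin, of the spanning tree that consists of the bottom row
and all columns. -/
def TreeEdge (i j : Vertex L₁ L₂) : Prop :=
  ((i.2 : ℕ) = 0 ∧ (j.2 : ℕ) = 0 ∧ (j.1 : ℕ) = i.1 + 1) ∨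
    ((i.1 : ℕ) = j.1 ∧ (j.2 : ℕ) = i.2 + 1)

lemma TreeEdge.adjacent {i j : Vertex L₁ L₂} (h : TreeEdge i j) : Adjacent i j := by
  rw [TreeEdge] at h
  rw [adjacent_iff]
  omega

/-- The tree is connected. -/
lemma tree_connected {P : Vertex L₁ L₂ → Prop} (h : ∀ i j, TreeEdge i j → (P i ↔ P j))
    (i j : Vertex L₁ L₂) : P i ↔ P j := by
  have h1 : 0 < L₁ := by have := i.1.2; omega
  have h2 : 0 < L₂ := by have := i.2.2; omega
  have row : ∀ (x : ℕ) (hx : x < L₁), P (⟨0, h1⟩, ⟨0, h2⟩) ↔ P (⟨x, hx⟩, ⟨0, h2⟩) := by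
    intro x
    induction x with
    | zero => intro hx; rfl
    | succ x ih =>
      intro hx
      exact (ih (by omega)).trans (h _ _ (Or.inl (by simp)))
  have col : ∀ (y : ℕ) (x : Fin L₁) (hy : y < L₂), P (⟨0, h1⟩, ⟨0, h2⟩) ↔ P (x, ⟨y, hy⟩) := by
    intro y x
    induction y with
    | zero => intro hy; exact row x x.2
    | succ y ih =>
      intro hy
      exact (ih (by omega)).trans (h _ _ (Or.inr (by simp)))
  exact (col i.2 i.1 i.2.2).symm.trans (col j.2 j.1 j.2.2)

/-- A function on the vertices may be defined by recursion along the tree. -/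
lemma exists_tree_rec {α : Type} (h₁ : 0 < L₁) (h₂ : 0 < L₂)
    (s : Vertex L₁ L₂ → Vertex L₁ L₂ → α → α) (a : α) :
    ∃ T : Vertex L₁ L₂ → α, T (⟨0, h₁⟩, ⟨0, h₂⟩) = a ∧ ∀ i j, TreeEdge i j → T j = s i j (T i) := by
  let v : ℕ → ℕ → Vertex L₁ L₂ := fun x y =>
    (⟨min x (L₁ - 1), by omega⟩, ⟨min y (L₂ - 1), by omega⟩)
  let R : ℕ → α := fun x => Nat.rec a (fun x b => s (v x 0) (v (x + 1) 0) b) x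
  let F : ℕ → ℕ → α := fun x y => Nat.rec (R x) (fun y b => s (v x y) (v x (y + 1)) b) y
  refine ⟨fun i => F i.1 i.2, rfl, ?_⟩
  rintro ⟨⟨x, hx⟩, ⟨y, hy⟩⟩ ⟨⟨x', hx'⟩, ⟨y', hy'⟩⟩ (⟨e1, e2, e3⟩ | ⟨e1, e2⟩)
  · simp only at e1 e2 e3
    subst e1 e2 e3
    change s (v x 0) (v (x + 1) 0) (R x) = _
    congr 1 <;> simp only [vertex_ext, v] <;> omega
  · simp only at e1 e2
    subst e1 e2
    change s (v x y) (v x (y + 1)) (F x y) = _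
    congr 1 <;> simp only [vertex_ext, v] <;> omega

/-! ### Products of anticommuting involutions -/

section Ring

variable {R : Type} [Ring R] {A B C : R}

lemma Twist.list_prod {ι : Type} (l : List ι) (f : ι → R) (s : ι → ℤˣ)
    (h : ∀ i, Twist (s i) (f i) A) : Twist (l.map s).prod (l.map f).prod A := by
  induction l with
  | nil => simpa using (Twist.one_right A).symm
  | cons i l ih =>
    rw [List.map_cons, List.map_cons, List.prod_cons, List.prod_cons]
    exact (h i).mul_left ih

lemma list_prod_mul_self {ι : Type} (l : List ι) (f : ι → R) (hf : ∀ i, f i * f i = 1)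
    (h : ∀ i j, Twist 1 (f i) (f j)) : (l.map f).prod * (l.map f).prod = 1 := by
  induction l with
  | nil => simp
  | cons i l ih =>
    rw [List.map_cons, List.prod_cons]
    have ht : Twist 1 (l.map f).prod (f i) :=
      (Twist.list_prod l f (fun _ => 1) fun j => h j i).congr (by simp)
    rw [ht.symm.sq_mul (hf i), ih]
    simp

lemma prod_toList_sgn {V : Type} [Fintype V] [DecidableEq V] (v : V) :
    ((Finset.univ : Finset V).toList.map fun k => sgn (k = v)).prod = -1 := by
  rw [Finset.prod_map_toList, Finset.prod_eq_single v]
  · exact sgn_pos rfl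
  · intro k _ hk
    exact sgn_neg hk
  · simp

variable [Algebra ℂ R]

lemma Twist.smul_mul_left {s t : ℤˣ} (a : ℂ) (h : Twist s A C) (h' : Twist t B C) :
    Twist (s * t) (a • (A * B)) C := (h.mul_left h').smul_left a

lemma Twist.smul_mul_right {s t : ℤˣ} (a : ℂ) (h : Twist s A B) (h' : Twist t A C) :
    Twist (s * t) A (a • (B * C)) := (h.mul_right h').smul_right a

lemma I_smul_mul_self (hA : A * A = 1) (hB : B * B = 1) (h : Twist (-1) A B) :
    (Complex.I • (A * B)) * (Complex.I • (A * B)) = 1 := by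
  rw [smul_mul_smul_comm, h.sq_mul hA, hB]
  simp

lemma I_smul_mul_cancel (hB : B * B = 1) : (-Complex.I) • ((Complex.I • (A * B)) * B) = A := by
  rw [smul_mul_assoc, mul_assoc, hB, smul_smul]
  simp

lemma I_smul_mul_cancel_left (hA : A * A = 1) :
    (-Complex.I) • (A * (Complex.I • (A * B))) = B := by
  rw [mul_smul_comm, ← mul_assoc, hA, smul_smul]
  simp

end Ring

section Symmetric

variable {H : Type} [NormedAddCommGroup H] [InnerProductSpace ℂ H] {A B : Module.End ℂ H}

lemma I_smul_mul_symm (hA : A.IsSymmetric) (hB : B.IsSymmetric) (h : Twist (-1) A B) :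
    (Complex.I • (A * B)).IsSymmetric := by
  intro x y
  have e : ∀ z, A (B z) = -B (A z) := fun z => LinearMap.congr_fun (Twist.neg_one_iff.1 h) z
  simp only [LinearMap.smul_apply, Module.End.mul_apply, inner_smul_left, inner_smul_right,
    Complex.conj_I]
  rw [e x, inner_neg_left, hB, hA]
  ring

lemma list_prod_symm {ι : Type} (l : List ι) (f : ι → Module.End ℂ H)
    (hf : ∀ i, (f i).IsSymmetric) (h : ∀ i j, Twist 1 (f i) (f j)) :
    (l.map f).prod.IsSymmetric := by
  induction l with
  | nil => intro x y; simp
  | cons i l ih =>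
    have ht : Twist 1 (l.map f).prod (f i) :=
      (Twist.list_prod l f (fun _ => 1) fun j => h j i).congr (by simp)
    intro x y
    have e := LinearMap.congr_fun (Twist.one_iff.1 ht) x
    simp only [List.map_cons, List.prod_cons, Module.End.mul_apply] at e ⊢
    rw [← e, ih, hf]

end Symmetric

/-! ### Majorana operators from edge operators -/

variable {H : Type} [NormedAddCommGroup H] [InnerProductSpace ℂ H]
  {E : Vertex L₁ L₂ → Vertex L₁ L₂ → Module.End ℂ H} {Z M : Vertex L₁ L₂ → Module.End ℂ H}

/-- `G` behaves like the Majorana operator of the vertex `v` with respect to the edge operators `E`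
and the vertex operators `Z`. -/
structure IsMajoranaAt (E : Vertex L₁ L₂ → Vertex L₁ L₂ → Module.End ℂ H)
    (Z : Vertex L₁ L₂ → Module.End ℂ H) (v : Vertex L₁ L₂) (G : Module.End ℂ H) : Prop where
  symm : G.IsSymmetric
  sq : G * G = 1
  edge : ∀ i j, Adjacent i j → Twist (sgn (v = i) * sgn (v = j)) G (E i j)
  vertex : ∀ k, Twist (sgn (k = v)) (Z k) G

lemma Adjacent.ne {i j : Vertex L₁ L₂} (h : Adjacent i j) : i ≠ j :=
  h.elim Arrow.ne fun h' => h'.ne.symm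

/-- An edge operator moves Majorana operators along the edge. -/
lemma IsMajoranaAt.step (R : FermionRelations E Z M) {i j : Vertex L₁ L₂} (hij : Adjacent i j)
    {G : Module.End ℂ H} (h : IsMajoranaAt E Z i G) :
    IsMajoranaAt E Z j (Complex.I • (G * E i j)) := by
  have t : Twist (-1) G (E i j) :=
    (h.edge i j hij).congr (by rw [sgn_pos rfl, sgn_neg hij.ne, mul_one])
  refine ⟨I_smul_mul_symm h.symm (R.edge_symm _ _ hij) t, I_smul_mul_self h.sq (R.edge_sq _ _ hij) t,
    fun k l hkl => ?_, fun k => ?_⟩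
  · refine (Twist.smul_mul_left _ (h.edge k l hkl) (R.edge_edge k l i j hkl hij)).congr ?_
    generalize sgn (i = k) = a
    generalize sgn (i = l) = b
    generalize sgn (j = k) = c
    generalize sgn (j = l) = d
    calc a * b * (a * c * (b * d)) = (a * a) * (b * b) * (c * d) := by ac_rfl
      _ = c * d := by simp [Int.units_mul_self]
  · refine (Twist.smul_mul_right _ (h.vertex k) (R.vertex_edge k i j hij)).congr ?_
    rw [units_mul_self_cancel]

lemma step_back (R : FermionRelations E Z M) {i j : Vertex L₁ L₂} (hij : Adjacent i j)
    {G G' : Module.End ℂ H} (h : G' = Complex.I • (G * E i j)) : G = Complex.I • (G' * E j i) := by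
  rw [h, R.edge_swap i j hij, smul_mul_assoc, mul_neg, mul_assoc, R.edge_sq i j hij, smul_neg,
    smul_neg, smul_smul]
  simp

/-- If the edge operators satisfy the relations around all faces, then they come from Majorana
operators, one of which is a given corner operator. -/
theorem exists_majoranas (R : FermionRelations E Z M)
    (hface : ∀ f : Face L₁ L₂, E (faceVertex f 0 0) (faceVertex f 1 0) *
      E (faceVertex f 1 0) (faceVertex f 1 1) * E (faceVertex f 1 1) (faceVertex f 0 1) *
      E (faceVertex f 0 1) (faceVertex f 0 0) = 1)
    {c : Vertex L₁ L₂} (hc : c ∈ corners L₁ L₂) :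
    ∃ Γ : Vertex L₁ L₂ → Module.End ℂ H, Γ c = M c ∧ (∀ v, IsMajoranaAt E Z v (Γ v)) ∧
      (∀ a b, Twist (-sgn (a = b)) (Γ a) (Γ b)) ∧
      (∀ i j, Adjacent i j → E i j = (-Complex.I) • (Γ i * Γ j)) ∧
      ∀ x ∈ corners L₁ L₂, x ≠ c → ∀ v, Twist (sgn (x = v)) (M x) (Γ v) := by
  have h1 : 0 < L₁ := by have := c.1.2; omega
  have h2 : 0 < L₂ := by have := c.2.2; omega
  obtain ⟨T, hT0, hT⟩ := exists_tree_rec h1 h2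
    (fun i j (G : Module.End ℂ H) => Complex.I • (G * E i j)) 1
  have hinv : ∀ v, ∃ T', T' * T v = 1 := by
    intro v
    refine (tree_connected (P := fun v => ∃ T', T' * T v = 1) (fun i j hij => ?_)
      (⟨0, h1⟩, ⟨0, h2⟩) v).1
      ⟨1, by rw [hT0, mul_one]⟩
    have hadj := hij.adjacent
    have aux : ∀ k l, Adjacent k l → T l = Complex.I • (T k * E k l) →
        (∃ T', T' * T k = 1) → ∃ T', T' * T l = 1 := by
      rintro k l hkl e ⟨T', hT'⟩
      refine ⟨(-Complex.I) • (E k l * T'), ?_⟩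
      rw [e, smul_mul_smul_comm, mul_assoc, ← mul_assoc T', hT', one_mul, R.edge_sq k l hkl]
      simp
    exact ⟨aux i j hadj (hT i j hij), aux j i hadj.symm (step_back R hadj (hT i j hij))⟩
  obtain ⟨T', hT'⟩ := hinv c
  set Γ : Vertex L₁ L₂ → Module.End ℂ H := fun v => M c * T' * T v with hΓ
  have hΓc : Γ c = M c := by rw [hΓ]; simp only; rw [mul_assoc, hT', mul_one]
  have hΓt : ∀ i j, TreeEdge i j → Γ j = Complex.I • (Γ i * E i j) := by
    intro i j hij
    simp only [hΓ]
    rw [hT i j hij, mul_smul_comm, ← mul_assoc]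
  have hmaj : ∀ v, IsMajoranaAt E Z v (Γ v) := by
    intro v
    refine (tree_connected (P := fun v => IsMajoranaAt E Z v (Γ v)) (fun i j hij => ?_) c v).1 ?_
    · constructor
      · intro h
        rw [hΓt i j hij]
        exact h.step R hij.adjacent
      · intro h
        rw [step_back R hij.adjacent (hΓt i j hij)]
        exact h.step R hij.adjacent.symm
    · rw [hΓc]
      exact ⟨R.corner_symm c hc, R.corner_sq c hc, R.corner_edge c hc, fun k => R.vertex_corner k c hc⟩
  -- commutation signs with the Majorana operators propagate along the tree
  have propagate : ∀ (A : Module.End ℂ H) (s : Vertex L₁ L₂ → ℤˣ) (t : ℤˣ),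
      (∀ i j, Adjacent i j → Twist (s i * s j) A (E i j)) → ∀ v w,
      Twist (t * s v) A (Γ v) → Twist (t * s w) A (Γ w) := by
    intro A s t hA v w
    refine (tree_connected (P := fun v => Twist (t * s v) A (Γ v)) (fun i j hij => ?_) v w).1
    have aux : ∀ k l, Adjacent k l → Γ l = Complex.I • (Γ k * E k l) →
        Twist (t * s k) A (Γ k) → Twist (t * s l) A (Γ l) := by
      intro k l hkl e h
      rw [e]
      refine (Twist.smul_mul_right _ h (hA k l hkl)).congr ?_
      rw [mul_assoc, units_mul_self_cancel]
    exact ⟨aux i j hij.adjacent (hΓt i j hij),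
      aux j i hij.adjacent.symm (step_back R hij.adjacent (hΓt i j hij))⟩
  have hcar : ∀ a b, Twist (-sgn (a = b)) (Γ a) (Γ b) := by
    intro a b
    refine (propagate (Γ a) (fun v => sgn (a = v)) (-1) (hmaj a).edge a b ?_).congr (by simp)
    exact (Twist.refl _).congr (by simp [sgn])
  have anti : ∀ a b, a ≠ b → Γ a * Γ b = -(Γ b * Γ a) := fun a b hab =>
    Twist.neg_one_iff.1 ((hcar a b).congr (by simp [sgn, hab]))
  have hEt : ∀ i j, TreeEdge i j → E i j = (-Complex.I) • (Γ i * Γ j) := by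
    intro i j hij
    rw [hΓt i j hij, I_smul_mul_cancel_left (hmaj i).sq]
  have hEs : ∀ i j, Adjacent i j → E i j = (-Complex.I) • (Γ i * Γ j) →
      E j i = (-Complex.I) • (Γ j * Γ i) := by
    intro i j hij h
    rw [R.edge_swap i j hij, h, anti i j hij.ne, smul_neg, neg_neg]
  -- the face relations carry the formula for horizontal edges from one row to the next
  have hrow : ∀ (y : ℕ) (i j : Vertex L₁ L₂), (i.2 : ℕ) = y → (j.2 : ℕ) = y →
      (j.1 : ℕ) = i.1 + 1 → E i j = (-Complex.I) • (Γ i * Γ j) := by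
    intro y
    induction y with
    | zero => intro i j hi hj hij; exact hEt i j (Or.inl ⟨hi, hj, hij⟩)
    | succ y ih =>
      intro i j hi hj hij
      have b1 := j.1.2
      have b2 := j.2.2
      let f : Face L₁ L₂ := (⟨i.1, by omega⟩, ⟨y, by omega⟩)
      have hf := hface f
      have ed : faceVertex f 0 1 = i := by
        rw [vertex_ext]; simp [faceVertex, f, hi]
      have ec : faceVertex f 1 1 = j := by
        rw [vertex_ext]; simp [faceVertex, f, hj, hij]
      rw [ed, ec] at hf
      set a := faceVertex f 0 0 with ha
      set b := faceVertex f 1 0 with hb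
      have ha1 : (a.1 : ℕ) = i.1 := by simp [ha, faceVertex, f]
      have ha2 : (a.2 : ℕ) = y := by simp [ha, faceVertex, f]
      have hb1 : (b.1 : ℕ) = i.1 + 1 := by simp [hb, faceVertex, f]
      have hb2 : (b.2 : ℕ) = y := by simp [hb, faceVertex, f]
      have tai : TreeEdge a i := Or.inr (by omega)
      have tbj : TreeEdge b j := Or.inr (by omega)
      have adjab : Adjacent a b := by rw [adjacent_iff]; omega
      have adjij : Adjacent i j := by rw [adjacent_iff]; omega
      have E1 := ih a b ha2 hb2 (by omega)
      have E2 := hEt b j tbj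
      have E4 := hEs a i tai.adjacent (hEt a i tai)
      have q1 := R.edge_sq a b adjab
      have q2 := R.edge_sq b j tbj.adjacent
      have q4 := R.edge_sq i a tai.adjacent.symm
      have hE : E j i = E b j * (E a b * E i a) := by
        calc E j i = E b j * (E a b * (E a b * E b j * E j i * E i a) * E i a) := by
              simp only [mul_assoc]
              rw [q4, ← mul_assoc (E a b) (E a b), q1, one_mul, ← mul_assoc (E b j) (E b j), q2,
                one_mul, mul_one]
          _ = _ := by rw [hf, mul_one]
      refine hEs j i adjij.symm ?_
      have nab := adjab.ne
      have nbj := tbj.adjacent.ne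
      have nai := tai.adjacent.ne
      rw [hE, E1, E2, E4]
      simp only [smul_mul_smul_comm]
      have w : Γ b * Γ j * (Γ a * Γ b * (Γ i * Γ a)) = -(Γ j * Γ i) := by
        calc Γ b * Γ j * (Γ a * Γ b * (Γ i * Γ a))
            = Γ b * Γ j * (Γ b * Γ a * (Γ a * Γ i)) := by
              rw [anti a b nab, anti i a nai.symm, neg_mul_neg]
          _ = Γ b * Γ j * (Γ b * ((Γ a * Γ a) * Γ i)) := by simp only [mul_assoc]
          _ = -(Γ j * Γ b) * (Γ b * Γ i) := by rw [(hmaj a).sq, one_mul, anti b j nbj]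
          _ = -(Γ j * ((Γ b * Γ b) * Γ i)) := by simp only [neg_mul, mul_assoc]
          _ = -(Γ j * Γ i) := by rw [(hmaj b).sq, one_mul]
      rw [w, smul_neg, ← neg_smul]
      congr 1
      rw [neg_mul_neg, Complex.I_mul_I]
      ring
  refine ⟨Γ, hΓc, hmaj, hcar, fun i j hij => ?_, fun x hx hxc v => ?_⟩
  · rcases adjacent_iff.1 hij with ⟨e, e1 | e1⟩ | ⟨e, e1 | e1⟩
    · exact hEs j i hij.symm (hrow j.2 j i rfl e e1)
    · exact hrow i.2 i j rfl e.symm e1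
    · exact hEs j i hij.symm (hEt j i (Or.inr ⟨e.symm, e1⟩))
    · exact hEt i j (Or.inr ⟨e, e1⟩)
  · refine (propagate (M x) (fun v => sgn (x = v)) 1 (R.corner_edge x hx) c v ?_).congr (one_mul _)
    rw [hΓc]
    exact (R.corner_corner x hx c hc).congr (by simp [sgn, hxc])

/-- The Clifford family that consists of Majorana operators `Γ v` and `i Γ v Z v` and of two further
operators `i M x Γ x` and `i M y Γ y`. -/
def cornerFamily (Γ Z M : Vertex L₁ L₂ → Module.End ℂ H) (x y : Vertex L₁ L₂) :
    Option (Vertex L₁ L₂) × Bool → Module.End ℂ H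
  | (some v, false) => Γ v
  | (some v, true) => Complex.I • (Γ v * Z v)
  | (none, false) => Complex.I • (M x * Γ x)
  | (none, true) => Complex.I • (M y * Γ y)

section CornerFamily

variable {Γ : Vertex L₁ L₂ → Module.End ℂ H} {c x y z : Vertex L₁ L₂}

/-- The operator `i M x Γ x` anticommutes with all Majorana operators. -/
lemma twist_corner_majorana (hcar : ∀ a b, Twist (-sgn (a = b)) (Γ a) (Γ b))
    (hMx : ∀ v, Twist (sgn (x = v)) (M x) (Γ v)) (v : Vertex L₁ L₂) :
    Twist (-1) (Complex.I • (M x * Γ x)) (Γ v) :=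
  (Twist.smul_mul_left _ (hMx v) (hcar x v)).congr (by
    rw [mul_neg, Int.units_mul_self])

lemma twist_corner_vertex (R : FermionRelations E Z M) (hx : x ∈ corners L₁ L₂)
    (hmaj : ∀ v, IsMajoranaAt E Z v (Γ v)) (v : Vertex L₁ L₂) :
    Twist 1 (Complex.I • (M x * Γ x)) (Z v) :=
  (Twist.smul_mul_left _ (R.vertex_corner v x hx).symm ((hmaj x).vertex v).symm).congr
    (Int.units_mul_self _)

lemma twist_corner_corner (R : FermionRelations E Z M) (hx : x ∈ corners L₁ L₂)
    (hy : y ∈ corners L₁ L₂) (hxy : x ≠ y) (hcar : ∀ a b, Twist (-sgn (a = b)) (Γ a) (Γ b))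
    (hMx : ∀ v, Twist (sgn (x = v)) (M x) (Γ v)) (hMy : ∀ v, Twist (sgn (y = v)) (M y) (Γ v)) :
    Twist (-1) (Complex.I • (M x * Γ x)) (Complex.I • (M y * Γ y)) := by
  refine (Twist.smul_mul_left _ (Twist.smul_mul_right _ (R.corner_corner x hx y hy) (hMx y))
    (Twist.smul_mul_right _ (hMy x).symm (hcar x y))).congr ?_
  simp [sgn, hxy, hxy.symm]

lemma cornerFamily_isClifford (R : FermionRelations E Z M) (hx : x ∈ corners L₁ L₂)
    (hy : y ∈ corners L₁ L₂) (hxy : x ≠ y) (hmaj : ∀ v, IsMajoranaAt E Z v (Γ v))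
    (hcar : ∀ a b, Twist (-sgn (a = b)) (Γ a) (Γ b))
    (hMx : ∀ v, Twist (sgn (x = v)) (M x) (Γ v)) (hMy : ∀ v, Twist (sgn (y = v)) (M y) (Γ v)) :
    IsClifford (cornerFamily Γ Z M x y) := by
  have tZ : ∀ v, Twist (-1) (Γ v) (Z v) := fun v =>
    ((hmaj v).vertex v).symm.congr (sgn_pos rfl)
  have tM : ∀ {x}, (∀ v, Twist (sgn (x = v)) (M x) (Γ v)) → Twist (-1) (M x) (Γ x) := fun h =>
    (h _).congr (sgn_pos rfl)
  -- the Majorana operators `i Γ v Z v` anticommute with the `Γ v` and with each other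
  have gb : ∀ a b, Twist (-1) (Γ a) (Complex.I • (Γ b * Z b)) := fun a b =>
    (Twist.smul_mul_right _ (hcar a b) ((hmaj a).vertex b).symm).congr (by
      rw [sgn_comm b a, neg_mul, Int.units_mul_self])
  have bb : ∀ a b, a ≠ b → Twist (-1) (Complex.I • (Γ a * Z a)) (Complex.I • (Γ b * Z b)) :=
    fun a b hab => (Twist.smul_mul_left _ (gb a b) (Twist.smul_mul_right _ ((hmaj b).vertex a)
      (R.vertex_vertex a b))).congr (by simp [sgn, hab])
  have xb : ∀ {x}, x ∈ corners L₁ L₂ → (∀ v, Twist (sgn (x = v)) (M x) (Γ v)) → ∀ v,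
      Twist (-1) (Complex.I • (M x * Γ x)) (Complex.I • (Γ v * Z v)) := fun hx h v =>
    (Twist.smul_mul_right _ (twist_corner_majorana hcar h v)
      (twist_corner_vertex R hx hmaj v)).congr (by simp)
  refine ⟨?_, ?_, ?_⟩
  · rintro ⟨_ | v, _ | _⟩
    · exact I_smul_mul_symm (R.corner_symm x hx) (hmaj x).symm (tM hMx)
    · exact I_smul_mul_symm (R.corner_symm y hy) (hmaj y).symm (tM hMy)
    · exact (hmaj v).symm
    · exact I_smul_mul_symm (hmaj v).symm (R.vertex_symm v) (tZ v)
  · rintro ⟨_ | v, _ | _⟩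
    · exact I_smul_mul_self (R.corner_sq x hx) (hmaj x).sq (tM hMx)
    · exact I_smul_mul_self (R.corner_sq y hy) (hmaj y).sq (tM hMy)
    · exact (hmaj v).sq
    · exact I_smul_mul_self (hmaj v).sq (R.vertex_sq v) (tZ v)
  · have xy := twist_corner_corner R hx hy hxy hcar hMx hMy
    rintro ⟨_ | v, _ | _⟩ ⟨_ | w, _ | _⟩ hne <;> apply Twist.neg_one_iff.1
    · exact absurd rfl hne
    · exact xy
    · exact twist_corner_majorana hcar hMx w
    · exact xb hx hMx w
    · exact xy.symm
    · exact absurd rfl hne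
    · exact twist_corner_majorana hcar hMy w
    · exact xb hy hMy w
    · exact (twist_corner_majorana hcar hMx v).symm
    · exact (twist_corner_majorana hcar hMy v).symm
    · have hvw : v ≠ w := by rintro rfl; exact hne rfl
      exact (hcar v w).congr (by simp [sgn, hvw])
    · exact gb v w
    · exact (xb hx hMx v).symm
    · exact (xb hy hMy v).symm
    · exact (gb w v).symm
    · exact bb v w (by rintro rfl; exact hne rfl)

/-- The product `-i (i M x Γ x) (i M y Γ y) ∏ Z v`. -/
def chirality (Γ Z M : Vertex L₁ L₂ → Module.End ℂ H) (x y : Vertex L₁ L₂) : Module.End ℂ H :=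
  (-Complex.I) • (cornerFamily Γ Z M x y (none, false) * cornerFamily Γ Z M x y (none, true) *
    (Finset.univ.toList.map Z).prod)

/-- By irreducibility the fourth corner operator is determined up to a sign: both `i M z Γ z` and
the chirality anticommute with all Clifford generators, so that their product is a scalar. -/
theorem exists_corner_sign [FiniteDimensional ℂ H] (R : FermionRelations E Z M)
    (hx : x ∈ corners L₁ L₂) (hy : y ∈ corners L₁ L₂) (hz : z ∈ corners L₁ L₂) (hxy : x ≠ y)
    (hxz : x ≠ z) (hyz : y ≠ z) (hmaj : ∀ v, IsMajoranaAt E Z v (Γ v))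
    (hcar : ∀ a b, Twist (-sgn (a = b)) (Γ a) (Γ b))
    (hMx : ∀ v, Twist (sgn (x = v)) (M x) (Γ v)) (hMy : ∀ v, Twist (sgn (y = v)) (M y) (Γ v))
    (hMz : ∀ v, Twist (sgn (z = v)) (M z) (Γ v))
    (hdim : Module.finrank ℂ H = 2 ^ (L₁ * L₂ + 1)) :
    ∃ ε : ℤˣ, Complex.I • (M z * Γ z) = ((ε : ℤ) : ℂ) • chirality Γ Z M x y := by
  have cl := cornerFamily_isClifford R hx hy hxy hmaj hcar hMx hMy
  set A := cornerFamily Γ Z M x y (none, false) with hA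
  set B := cornerFamily Γ Z M x y (none, true) with hB
  set P := (Finset.univ.toList.map Z).prod with hP
  set C := Complex.I • (M z * Γ z) with hC
  set χ := chirality Γ Z M x y with hχ
  have PΓ : ∀ v, Twist (-1) P (Γ v) := fun v =>
    (Twist.list_prod _ Z (fun k => sgn (k = v)) fun k => (hmaj v).vertex k).congr
      (prod_toList_sgn v)
  have PZ : ∀ v, Twist 1 P (Z v) := fun v =>
    (Twist.list_prod _ Z (fun _ => 1) fun k => R.vertex_vertex k v).congr (by simp)
  have PM : ∀ c ∈ corners L₁ L₂, Twist (-1) P (M c) := fun c hc =>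
    (Twist.list_prod _ Z (fun k => sgn (k = c)) fun k => R.vertex_corner k c hc).congr
      (prod_toList_sgn c)
  have PC : ∀ c ∈ corners L₁ L₂, Twist 1 P (Complex.I • (M c * Γ c)) := fun c hc =>
    (Twist.smul_mul_right _ (PM c hc) (PΓ c)).congr (by simp)
  have PP : P * P = 1 := list_prod_mul_self _ Z R.vertex_sq R.vertex_vertex
  have AB : Twist (-1) A B := Twist.neg_one_iff.2 (cl.anti _ _ (by simp))
  have CC : C * C = 1 := I_smul_mul_self (R.corner_sq z hz) (hmaj z).sq ((hMz z).congr (sgn_pos rfl))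
  have CA : Twist (-1) C A := twist_corner_corner R hz hx hxz.symm hcar hMz hMx
  have CB : Twist (-1) C B := twist_corner_corner R hz hy hyz.symm hcar hMz hMy
  have CP : Twist 1 C P := (PC z hz).symm
  have χχ : χ * χ = 1 := by
    have h1 : Twist 1 (A * B) P := ((PC x hx).symm.mul_left (PC y hy).symm).congr (by simp)
    have h2 : A * B * (A * B) = -1 := by
      rw [AB.sq_mul (cl.sq _), cl.sq]
      simp
    have h3 : A * B * P * (A * B * P) = -1 := by
      rw [mul_assoc, ← mul_assoc P, ← Twist.one_iff.1 h1, mul_assoc (A * B) P, PP, mul_one, h2]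
    rw [hχ, chirality, smul_mul_smul_comm, ← hA, ← hB, ← hP, h3]
    simp
  have Cχ : Twist 1 C χ := (((CA.mul_right CB).mul_right CP).smul_right _).congr (by simp)
  -- both operators anticommute with the generators
  have Cg : ∀ k, Twist (-1) C (cornerFamily Γ Z M x y k) := by
    rintro ⟨_ | v, _ | _⟩
    · exact CA
    · exact CB
    · exact twist_corner_majorana hcar hMz v
    · exact (Twist.smul_mul_right _ (twist_corner_majorana hcar hMz v)
        (twist_corner_vertex R hz hmaj v)).congr (by simp)
  have χg : ∀ k, Twist (-1) χ (cornerFamily Γ Z M x y k) := by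
    have anti : ∀ k l, k ≠ l →
        Twist (-1) (cornerFamily Γ Z M x y k) (cornerFamily Γ Z M x y l) := fun k l hkl =>
      Twist.neg_one_iff.2 (cl.anti k l hkl)
    rintro ⟨_ | v, _ | _⟩
    · exact ((((Twist.refl A).mul_left AB.symm).mul_left (PC x hx)).smul_left _).congr (by simp)
    · exact (((AB.mul_left (Twist.refl B)).mul_left (PC y hy)).smul_left _).congr (by simp)
    · exact ((((anti _ _ (by simp)).mul_left (anti _ _ (by simp))).mul_left (PΓ v)).smul_left
        _).congr (by simp)
    · exact ((((anti _ _ (by simp)).mul_left (anti _ _ (by simp))).mul_left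
        (Twist.smul_mul_right _ (PΓ v) (PZ v))).smul_left _).congr (by simp)
  have top := IsClifford.adjoin_eq_top _ H _ cl (by
    rw [hdim, Finite.card_option, Nat.card_eq_fintype_card, Fintype.card_prod, Fintype.card_fin,
      Fintype.card_fin])
  have central : ∀ T : Module.End ℂ H, T * (C * χ) = C * χ * T := by
    intro T
    have hT : T ∈ Algebra.adjoin ℂ (Set.range (cornerFamily Γ Z M x y)) := by rw [top]; trivial
    induction hT using Algebra.adjoin_induction with
    | mem T hT =>
      obtain ⟨k, rfl⟩ := hT
      exact (Twist.one_iff.1 (((Cg k).mul_left (χg k)).congr (by simp))).symm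
    | algebraMap r => exact Algebra.commutes r _
    | add S T _ _ hS hT => rw [add_mul, mul_add, hS, hT]
    | mul S T _ _ hS hT => rw [mul_assoc, hT, ← mul_assoc, hS, mul_assoc]
  obtain ⟨r, hr⟩ : ∃ r : ℂ, C * χ = r • 1 := by
    have := (Algebra.IsCentral.center_eq_bot ℂ (Module.End ℂ H)).le
      (Subalgebra.mem_center_iff.2 central)
    obtain ⟨r, hr⟩ := Algebra.mem_bot.1 this
    exact ⟨r, by rw [← hr, Algebra.algebraMap_eq_smul_one]⟩
  have : Nontrivial H := Module.nontrivial_of_finrank_pos (R := ℂ) (by rw [hdim]; positivity)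
  have hrr : r * r = 1 := by
    have h := Cχ.sq_mul CC
    rw [hr, χχ, smul_mul_smul_comm, one_mul, Units.val_one, one_smul] at h
    have h' : algebraMap ℂ (Module.End ℂ H) (r * r) = algebraMap ℂ (Module.End ℂ H) 1 := by
      rw [Algebra.algebraMap_eq_smul_one, h, map_one]
    exact (algebraMap ℂ (Module.End ℂ H)).injective h'
  have hCr : C = r • χ := by
    have : C * χ * χ = C := by rw [mul_assoc, χχ, mul_one]
    rw [← this, hr, smul_mul_assoc, one_mul]
  rcases mul_self_eq_one_iff.1 hrr with e | e
  · exact ⟨1, by rw [hCr, e]; simp⟩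
  · exact ⟨-1, by rw [hCr, e]; simp⟩

end CornerFamily

end Encoding

/-! ### The logical space -/

section Logical

variable {V : Type} [Fintype V] [DecidableEq V]

lemma twist_majoranaFamily {k l : V × Bool} (h : k ≠ l) :
    Twist (-1) (majoranaFamily k) (majoranaFamily l) :=
  Twist.neg_one_iff.2 (majoranaFamily_isClifford.anti k l h)

lemma twist_vertexOp_majoranaFamily (k v : V) (b : Bool) :
    Twist (sgn (k = v)) (vertexOp k) (majoranaFamily (v, b)) := by
  have h : Twist (sgn (k = v)) (majoranaFamily (k, false) * majoranaFamily (k, true))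
      (majoranaFamily (v, b)) := by
    rcases eq_or_ne k v with rfl | hkv
    · rw [sgn_pos rfl]
      cases b
      · exact ((Twist.refl _).mul_left (twist_majoranaFamily (by simp))).congr (by simp)
      · exact ((twist_majoranaFamily (by simp)).mul_left (Twist.refl _)).congr (by simp)
    · rw [sgn_neg hkv]
      exact ((twist_majoranaFamily (by simp [hkv])).mul_left
        (twist_majoranaFamily (by simp [hkv]))).congr (by simp)
  exact h.smul_left _

lemma vertexOp_mul_self (k : V) : vertexOp k * vertexOp k = 1 :=
  majoranaFamily_isClifford.chir_sq (i := (k, false)) (j := (k, true)) (by simp)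

lemma vertexOp_symm (k : V) : (vertexOp k).IsSymmetric :=
  majoranaFamily_isClifford.chir_symm (i := (k, false)) (j := (k, true)) (by simp)

lemma twist_vertexOp_vertexOp (k l : V) : Twist 1 (vertexOp k) (vertexOp l) :=
  (((twist_vertexOp_majoranaFamily k l false).mul_right
    (twist_vertexOp_majoranaFamily k l true)).smul_right _).congr (Int.units_mul_self _)

lemma parity_mul_self : (parity : Module.End ℂ (Fock V)) * parity = 1 :=
  list_prod_mul_self _ _ vertexOp_mul_self twist_vertexOp_vertexOp

lemma parity_symm : (parity : Module.End ℂ (Fock V)).IsSymmetric :=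
  list_prod_symm _ _ vertexOp_symm twist_vertexOp_vertexOp

lemma twist_parity_majoranaFamily (k : V × Bool) : Twist (-1) parity (majoranaFamily k) :=
  (Twist.list_prod _ vertexOp (fun j => sgn (j = k.1)) fun j =>
    twist_vertexOp_majoranaFamily j k.1 k.2).congr (prod_toList_sgn k.1)

variable {L₁ L₂ : ℕ}

lemma logicalOp_mul (P P' : Matrix (Fin 2) (Fin 2) ℂ)
    (T T' : Module.End ℂ (Fock (Vertex L₁ L₂))) :
    logicalOp P T * logicalOp P' T' = logicalOp (P * P') (T * T') := by
  rw [logicalOp, logicalOp, logicalOp, toEuclideanLin_mul]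
  exact (TensorProduct.map_mul _ _ _ _).symm

lemma logicalOp_one : logicalOp 1 (1 : Module.End ℂ (Fock (Vertex L₁ L₂))) = 1 := by
  rw [logicalOp, toEuclideanLin_one]
  exact TensorProduct.map_one

lemma logicalOp_smul_left (a : ℂ) (P : Matrix (Fin 2) (Fin 2) ℂ)
    (T : Module.End ℂ (Fock (Vertex L₁ L₂))) : logicalOp (a • P) T = a • logicalOp P T := by
  rw [logicalOp, logicalOp, map_smul]
  exact TensorProduct.map_smul_left _ _ _

lemma logicalOp_smul_right (a : ℂ) (P : Matrix (Fin 2) (Fin 2) ℂ)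
    (T : Module.End ℂ (Fock (Vertex L₁ L₂))) : logicalOp P (a • T) = a • logicalOp P T := by
  rw [logicalOp, logicalOp]
  exact TensorProduct.map_smul_right _ _ _

lemma logicalOp_symm {P : Matrix (Fin 2) (Fin 2) ℂ} {T : Module.End ℂ (Fock (Vertex L₁ L₂))}
    (hP : P.conjTranspose = P) (hT : T.IsSymmetric) : (logicalOp P T).IsSymmetric := by
  have hP' := toEuclideanLin_symm hP
  rw [LinearMap.isSymmetric_iff_isSelfAdjoint, isSelfAdjoint_iff, LinearMap.star_eq_adjoint] at *
  rw [logicalOp]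
  refine (TensorProduct.adjoint_map _ _).trans ?_
  rw [hP', hT]

lemma twist_logicalOp {s t : ℤˣ} {P P' : Matrix (Fin 2) (Fin 2) ℂ}
    {T T' : Module.End ℂ (Fock (Vertex L₁ L₂))} (h : Twist s P P') (h' : Twist t T T') :
    Twist (s * t) (logicalOp P T) (logicalOp P' T') := by
  unfold Twist at *
  rw [logicalOp_mul, logicalOp_mul, h, h', ← Int.cast_smul_eq_zsmul ℂ, ← Int.cast_smul_eq_zsmul ℂ,
    logicalOp_smul_left, logicalOp_smul_right, smul_smul, ← Int.cast_smul_eq_zsmul ℂ]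
  push_cast
  rfl

lemma finrank_logical : Module.finrank ℂ (Logical L₁ L₂) = 2 ^ (L₁ * L₂ + 1) := by
  rw [Module.finrank_tensorProduct, finrank_fock, finrank_euclideanSpace, Fintype.card_fin,
    Fintype.card_prod, Fintype.card_fin, Fintype.card_fin, pow_succ, mul_comm]

/-- The Clifford family on `ℂ² ⊗ F_m`: the Majorana operators, and `± X`, `± Y` times the parity. -/
def logicalFamily (ε : ℤˣ) : Option (Vertex L₁ L₂) × Bool → Module.End ℂ (Logical L₁ L₂)
  | (some v, b) => logicalOp 1 (majoranaFamily (v, b))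
  | (none, false) => ((ε : ℤ) : ℂ) • logicalOp pauliX parity
  | (none, true) => ((ε : ℤ) : ℂ) • logicalOp pauliY parity

lemma real_smul_symm {H : Type} [NormedAddCommGroup H] [InnerProductSpace ℂ H]
    {T : Module.End ℂ H} (hT : T.IsSymmetric) (n : ℤ) : (((n : ℤ) : ℂ) • T).IsSymmetric := by
  intro x y
  simp only [LinearMap.smul_apply, inner_smul_left, inner_smul_right, hT x y, map_intCast]

lemma unit_smul_mul_self {R : Type} [Ring R] [Algebra ℂ R] {A : R} (hA : A * A = 1) (ε : ℤˣ) :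
    (((ε : ℤ) : ℂ) • A) * (((ε : ℤ) : ℂ) • A) = 1 := by
  rw [smul_mul_smul_comm, hA, ← Int.cast_mul, ← Units.val_mul, Int.units_mul_self]
  simp

theorem logicalFamily_isClifford (ε : ℤˣ) :
    IsClifford (logicalFamily (L₁ := L₁) (L₂ := L₂) ε) where
  symm := by
    rintro ⟨_ | v, _ | _⟩
    · exact real_smul_symm (logicalOp_symm pauliX_herm parity_symm) _
    · exact real_smul_symm (logicalOp_symm pauliY_herm parity_symm) _
    · exact logicalOp_symm (by simp) (majoranaFamily_isClifford.symm _)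
    · exact logicalOp_symm (by simp) (majoranaFamily_isClifford.symm _)
  sq := by
    rintro ⟨_ | v, _ | _⟩
    · exact unit_smul_mul_self (by
        rw [logicalOp_mul, pauliX_mul_self, parity_mul_self, logicalOp_one]) _
    · exact unit_smul_mul_self (by
        rw [logicalOp_mul, pauliY_mul_self, parity_mul_self, logicalOp_one]) _
    · exact (logicalOp_mul _ _ _ _).trans (by
        rw [one_mul, majoranaFamily_isClifford.sq, logicalOp_one])
    · exact (logicalOp_mul _ _ _ _).trans (by
        rw [one_mul, majoranaFamily_isClifford.sq, logicalOp_one])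
  anti := by
    have hP : ∀ (P : Matrix (Fin 2) (Fin 2) ℂ) (k : Vertex L₁ L₂ × Bool),
        Twist (-1) (((ε : ℤ) : ℂ) • logicalOp P parity) (logicalOp 1 (majoranaFamily k)) :=
      fun P k => ((twist_logicalOp (Twist.one_right P)
        (twist_parity_majoranaFamily k)).smul_left _).congr (one_mul _)
    have hXY : Twist (-1) (((ε : ℤ) : ℂ) • logicalOp (L₁ := L₁) (L₂ := L₂) pauliX parity)
        (((ε : ℤ) : ℂ) • logicalOp pauliY parity) :=
      (((twist_logicalOp twist_X_Y (Twist.refl _)).smul_left _).smul_right _).congr (mul_one _)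
    rintro ⟨_ | v, b⟩ ⟨_ | w, b'⟩ hne <;> apply Twist.neg_one_iff.1
    · cases b <;> cases b'
      · exact absurd rfl hne
      · exact hXY
      · exact hXY.symm
      · exact absurd rfl hne
    · cases b
      · exact hP _ _
      · exact hP _ _
    · cases b'
      · exact (hP _ _).symm
      · exact (hP _ _).symm
    · refine (twist_logicalOp (Twist.refl 1)
        (twist_majoranaFamily (k := (v, b)) (l := (w, b')) ?_)).congr (one_mul _)
      rintro e
      simp only [Prod.mk.injEq] at e
      exact hne (by rw [e.1, e.2])

/-- The hole operators are products of Clifford generators. -/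
lemma logicalOp_hole (P : Matrix (Fin 2) (Fin 2) ℂ) (ε : ℤˣ) (v : Vertex L₁ L₂) :
    logicalOp P (hole ε v) =
      (-Complex.I) • ((((ε : ℤ) : ℂ) • logicalOp P parity) * logicalOp 1 (majorana v)) := by
  have h : parity * majorana v = -(majorana v * parity) :=
    Twist.neg_one_iff.1 (twist_parity_majoranaFamily (v, false))
  rw [smul_mul_assoc, logicalOp_mul, mul_one, h, hole, logicalOp_smul_right,
    ← neg_one_smul ℂ (majorana v * parity), logicalOp_smul_right, smul_smul, smul_smul]
  congr 1
  ring

lemma logicalOp_edgeOp (i j : Vertex L₁ L₂) : logicalOp 1 (edgeOp i j) =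
    (-Complex.I) • (logicalOp 1 (majorana i) * logicalOp 1 (majorana j)) := by
  rw [edgeOp, logicalOp_smul_right, logicalOp_mul, one_mul]

lemma logicalOp_vertexOp (i : Vertex L₁ L₂) : logicalOp 1 (vertexOp i) =
    (-Complex.I) • (logicalOp 1 (majorana i) * logicalOp 1 (majoranaBar i)) := by
  rw [vertexOp, logicalOp_smul_right, logicalOp_mul, one_mul]

lemma logicalOp_parity : logicalOp (L₁ := L₁) (L₂ := L₂) 1 parity =
    (Finset.univ.toList.map fun v => logicalOp 1 (vertexOp v)).prod := by
  rw [parity]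
  generalize (Finset.univ : Finset (Vertex L₁ L₂)).toList = l
  induction l with
  | nil => exact logicalOp_one
  | cons v l ih =>
    rw [List.map_cons, List.map_cons, List.prod_cons, List.prod_cons, ← ih, logicalOp_mul, one_mul]

/-- The third Pauli operator times the parity is the product of all Clifford generators. -/
lemma logicalOp_pauliZ_parity (ε : ℤˣ) : logicalOp (L₁ := L₁) (L₂ := L₂) pauliZ parity =
    (-Complex.I) • ((((ε : ℤ) : ℂ) • logicalOp pauliX parity) *
      (((ε : ℤ) : ℂ) • logicalOp pauliY parity) * logicalOp 1 parity) := by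
  rw [smul_mul_smul_comm, logicalOp_mul, parity_mul_self, smul_mul_assoc, logicalOp_mul, one_mul,
    mul_one, pauliX_mul_pauliY, logicalOp_smul_left, ← Int.cast_mul, ← Units.val_mul,
    Int.units_mul_self, smul_smul, smul_smul]
  simp

/-- The edge, vertex, corner and hole operators generate all operators on the logical space. -/
theorem adjoin_logical_eq_top (ε : ℤˣ) (c x y z : Vertex L₁ L₂) :
    Algebra.adjoin ℂ
      ({T : Module.End ℂ (Logical L₁ L₂) |
          ∃ i j, Adjacent i j ∧ T = logicalOp 1 (edgeOp i j)} ∪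
        {T | ∃ j, T = logicalOp 1 (vertexOp j)} ∪
        {logicalOp 1 (majorana c), logicalOp pauliX (hole ε x),
          logicalOp pauliY (hole ε y), logicalOp pauliZ (hole ε z)}) = ⊤ := by
  set A := Algebra.adjoin ℂ
      ({T : Module.End ℂ (Logical L₁ L₂) |
          ∃ i j, Adjacent i j ∧ T = logicalOp 1 (edgeOp i j)} ∪
        {T | ∃ j, T = logicalOp 1 (vertexOp j)} ∪
        {logicalOp 1 (majorana c), logicalOp pauliX (hole ε x),
          logicalOp pauliY (hole ε y), logicalOp pauliZ (hole ε z)}) with hA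
  have cl := logicalFamily_isClifford (L₁ := L₁) (L₂ := L₂) ε
  have top := IsClifford.adjoin_eq_top _ _ _ cl (by
    rw [finrank_logical, Finite.card_option, Nat.card_eq_fintype_card, Fintype.card_prod,
      Fintype.card_fin, Fintype.card_fin])
  have hE : ∀ i j, Adjacent i j → logicalOp 1 (edgeOp i j) ∈ A := fun i j h =>
    Algebra.subset_adjoin (Or.inl (Or.inl ⟨i, j, h, rfl⟩))
  have hV : ∀ j, logicalOp 1 (vertexOp j) ∈ A := fun j =>
    Algebra.subset_adjoin (Or.inl (Or.inr ⟨j, rfl⟩))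
  have hc : logicalOp 1 (majorana c) ∈ A := Algebra.subset_adjoin (Or.inr (by simp))
  have hX : logicalOp pauliX (hole ε x) ∈ A := Algebra.subset_adjoin (Or.inr (by simp))
  have hY : logicalOp pauliY (hole ε y) ∈ A := Algebra.subset_adjoin (Or.inr (by simp))
  have sq : ∀ v : Vertex L₁ L₂, logicalOp 1 (majorana v) * logicalOp 1 (majorana v) = 1 :=
    fun v => cl.sq (some v, false)
  have next : ∀ (v : Vertex L₁ L₂) (T : Module.End ℂ (Logical L₁ L₂)),
      T = Complex.I • (logicalOp 1 (majorana v) * ((-Complex.I) • (logicalOp 1 (majorana v) * T))) := by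
    intro v T
    rw [mul_smul_comm, ← mul_assoc, sq, one_mul, smul_smul]
    simp
  have hγ : ∀ v, logicalOp 1 (majorana v) ∈ A := by
    intro v
    refine (tree_connected (P := fun v => logicalOp 1 (majorana v) ∈ A)
      (fun i j hij => ?_) c v).1 hc
    have aux : ∀ k l, Adjacent k l → logicalOp 1 (majorana k) ∈ A →
        logicalOp 1 (majorana l) ∈ A := by
      intro k l hkl h
      rw [next k (logicalOp 1 (majorana l)), ← logicalOp_edgeOp]
      exact A.smul_mem (A.mul_mem h (hE k l hkl)) _
    exact ⟨aux i j hij.adjacent, aux j i hij.adjacent.symm⟩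
  have hole_mem : ∀ (P : Matrix (Fin 2) (Fin 2) ℂ) (v : Vertex L₁ L₂),
      logicalOp P (hole ε v) ∈ A → ((ε : ℤ) : ℂ) • logicalOp P parity ∈ A := by
    intro P v h
    have : ((ε : ℤ) : ℂ) • logicalOp P parity =
        Complex.I • (logicalOp P (hole ε v) * logicalOp 1 (majorana v)) := by
      rw [logicalOp_hole, smul_mul_assoc, mul_assoc, sq, mul_one, smul_smul]
      simp
    rw [this]
    exact A.smul_mem (A.mul_mem h (hγ v)) _
  rw [eq_top_iff, ← top, Algebra.adjoin_le_iff]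
  rintro _ ⟨⟨_ | v, _ | _⟩, rfl⟩
  · exact hole_mem _ _ hX
  · exact hole_mem _ _ hY
  · exact hγ v
  · change logicalOp 1 (majoranaBar v) ∈ A
    rw [next v (logicalOp 1 (majoranaBar v)), ← logicalOp_vertexOp]
    exact A.smul_mem (A.mul_mem (hγ v) (hV v)) _

end Logical

/-! ### Operators on the code space -/

section Code

variable {L₁ L₂ : ℕ}

open Classical in
/-- The restriction to the code space of an operator that preserves it (and `0` for other
operators). -/
def codeRestrict (T : Module.End ℂ (QubitSpace (Qubit L₁ L₂))) :
    Module.End ℂ (codeSpace L₁ L₂) :=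
  if h : ∀ ψ ∈ codeSpace L₁ L₂, T ψ ∈ codeSpace L₁ L₂ then T.restrict h else 0

/-- `T` commutes with all stabilizers. -/
def CommutesWithStabilizers (T : Module.End ℂ (QubitSpace (Qubit L₁ L₂))) : Prop :=
  ∀ f, Twist 1 T (stabilizer f)

lemma coe_codeRestrict {T : Module.End ℂ (QubitSpace (Qubit L₁ L₂))}
    (h : CommutesWithStabilizers T) (ψ : codeSpace L₁ L₂) :
    (codeRestrict T ψ : QubitSpace (Qubit L₁ L₂)) = T ψ := by
  have h' : ∀ ψ ∈ codeSpace L₁ L₂, T ψ ∈ codeSpace L₁ L₂ := by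
    intro ψ hψ
    rw [mem_codeSpace] at hψ ⊢
    intro f
    have := LinearMap.congr_fun (Twist.one_iff.1 (h f)) ψ
    simp only [Module.End.mul_apply, hψ f] at this
    exact this.symm
  rw [codeRestrict, dif_pos h']
  rfl

lemma codeRestrict_symm {T : Module.End ℂ (QubitSpace (Qubit L₁ L₂))}
    (h : CommutesWithStabilizers T) (hT : T.IsSymmetric) : (codeRestrict T).IsSymmetric := by
  intro φ ψ
  rw [Submodule.coe_inner, Submodule.coe_inner, coe_codeRestrict h, coe_codeRestrict h]
  exact hT φ ψ

lemma codeRestrict_mul_self {T : Module.End ℂ (QubitSpace (Qubit L₁ L₂))}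
    (h : CommutesWithStabilizers T) (hT : T * T = 1) : codeRestrict T * codeRestrict T = 1 := by
  refine LinearMap.ext fun ψ => Subtype.ext ?_
  rw [Module.End.mul_apply, coe_codeRestrict h, coe_codeRestrict h]
  exact LinearMap.congr_fun hT ψ

lemma Twist.codeRestrict {s : ℤˣ} {S T : Module.End ℂ (QubitSpace (Qubit L₁ L₂))}
    (hS : CommutesWithStabilizers S) (hT : CommutesWithStabilizers T) (h : Twist s S T) :
    Twist s (codeRestrict S) (codeRestrict T) := by
  refine LinearMap.ext fun ψ => Subtype.ext ?_
  have := LinearMap.congr_fun h ψ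
  simp only [LinearMap.smul_apply, Module.End.mul_apply, Submodule.coe_smul_of_tower,
    coe_codeRestrict hS, coe_codeRestrict hT] at this ⊢
  exact this

variable (h₁ : Even L₁) (h₂ : Even L₂)
include h₁ h₂

lemma edge_commutesWithStabilizers {i j : Vertex L₁ L₂} (hij : Adjacent i j) :
    CommutesWithStabilizers (encodedEdge i j) := twist_edge_stabilizer h₁ h₂ hij

lemma vertex_commutesWithStabilizers (k : Vertex L₁ L₂) :
    CommutesWithStabilizers (encodedVertex k) :=
  twist_stabilizer (fun i => sgn (k = i)) fun _ _ hij =>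
    (encoded_fermionRelations h₁ h₂).vertex_edge k _ _ hij

lemma corner_commutesWithStabilizers {c : Vertex L₁ L₂} (hc : c ∈ corners L₁ L₂) :
    CommutesWithStabilizers (cornerOp c) :=
  twist_stabilizer (fun i => sgn (c = i)) fun _ _ hij =>
    (encoded_fermionRelations h₁ h₂).corner_edge c hc _ _ hij

/-- On the code space the encoded operators still satisfy the relations. -/
theorem code_fermionRelations :
    FermionRelations (L₁ := L₁) (L₂ := L₂) (fun i j => codeRestrict (encodedEdge i j))
      (fun k => codeRestrict (encodedVertex k)) (fun c => codeRestrict (cornerOp c)) := by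
  have R := encoded_fermionRelations h₁ h₂
  have hE := fun {i j} => edge_commutesWithStabilizers h₁ h₂ (i := i) (j := j)
  have hZ := vertex_commutesWithStabilizers h₁ h₂
  have hM := fun {c} => corner_commutesWithStabilizers h₁ h₂ (c := c)
  refine
  { edge_symm := fun i j h => codeRestrict_symm (hE h) (R.edge_symm i j h)
    edge_sq := fun i j h => codeRestrict_mul_self (hE h) (R.edge_sq i j h)
    edge_swap := fun i j h => LinearMap.ext fun ψ => Subtype.ext ?_
    edge_edge := fun i j k l h h' => (R.edge_edge i j k l h h').codeRestrict (hE h') (hE h)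
    vertex_symm := fun i => codeRestrict_symm (hZ i) (R.vertex_symm i)
    vertex_sq := fun i => codeRestrict_mul_self (hZ i) (R.vertex_sq i)
    vertex_vertex := fun i j => (R.vertex_vertex i j).codeRestrict (hZ i) (hZ j)
    vertex_edge := fun k i j h => (R.vertex_edge k i j h).codeRestrict (hZ k) (hE h)
    corner_symm := fun c h => codeRestrict_symm (hM h) (R.corner_symm c h)
    corner_sq := fun c h => codeRestrict_mul_self (hM h) (R.corner_sq c h)
    corner_corner := fun c h d h' => (R.corner_corner c h d h').codeRestrict (hM h) (hM h')
    corner_edge := fun c h i j h' => (R.corner_edge c h i j h').codeRestrict (hM h) (hE h')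
    vertex_corner := fun k c h => (R.vertex_corner k c h).codeRestrict (hZ k) (hM h) }
  rw [LinearMap.neg_apply, Submodule.coe_neg, coe_codeRestrict (hE h.symm), coe_codeRestrict (hE h),
    R.edge_swap i j h, LinearMap.neg_apply]

/-- On the code space the relations around the faces hold as well. -/
theorem code_face (f : Face L₁ L₂) :
    codeRestrict (encodedEdge (faceVertex f 0 0) (faceVertex f 1 0)) *
      codeRestrict (encodedEdge (faceVertex f 1 0) (faceVertex f 1 1)) *
      codeRestrict (encodedEdge (faceVertex f 1 1) (faceVertex f 0 1)) *
      codeRestrict (encodedEdge (faceVertex f 0 1) (faceVertex f 0 0)) = 1 := by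
  obtain ⟨a1, a2, a3, a4⟩ := adjacent_face f
  have hE := fun {i j} => edge_commutesWithStabilizers h₁ h₂ (i := i) (j := j)
  refine LinearMap.ext fun ψ => Subtype.ext ?_
  simp only [Module.End.mul_apply]
  rw [coe_codeRestrict (hE a1), coe_codeRestrict (hE a2), coe_codeRestrict (hE a3),
    coe_codeRestrict (hE a4)]
  exact mem_codeSpace.1 ψ.2 f

end Code

/-! ### Unitary equivalence -/

section Equivalence

variable {H K : Type} [NormedAddCommGroup H] [InnerProductSpace ℂ H]
  [NormedAddCommGroup K] [InnerProductSpace ℂ K]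

/-- Conjugation by a surjective isometry. -/
def conjStar [FiniteDimensional ℂ H] [FiniteDimensional ℂ K] (J : H ≃ₗᵢ[ℂ] K) :
    Module.End ℂ H ≃⋆ₐ[ℂ] Module.End ℂ K :=
  StarAlgEquiv.ofAlgEquiv (J.toLinearEquiv.conjAlgEquiv ℂ) fun T => by
    rw [LinearMap.star_eq_adjoint, LinearMap.star_eq_adjoint, LinearMap.eq_adjoint_iff]
    intro x y
    change inner ℂ (J (LinearMap.adjoint T (J.symm x))) y = inner ℂ x (J (T (J.symm y)))
    rw [LinearIsometryEquiv.inner_map_eq_flip, LinearMap.adjoint_inner_left,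
      LinearIsometryEquiv.inner_map_eq_flip J.symm]
    rfl

lemma conjStar_apply [FiniteDimensional ℂ H] [FiniteDimensional ℂ K] (J : H ≃ₗᵢ[ℂ] K)
    (T : Module.End ℂ H) (y : K) :
    conjStar J T y = J (T (J.symm y)) := rfl

/-- `J` intertwines `S` and `T`. -/
def Intertwines (J : H ≃ₗᵢ[ℂ] K) (S : Module.End ℂ H) (T : Module.End ℂ K) : Prop :=
  ∀ x, J (S x) = T (J x)

variable {J : H ≃ₗᵢ[ℂ] K} {S S' : Module.End ℂ H} {T T' : Module.End ℂ K}

lemma Intertwines.mul (h : Intertwines J S T) (h' : Intertwines J S' T') :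
    Intertwines J (S * S') (T * T') := fun x => by
  rw [Module.End.mul_apply, h, h', Module.End.mul_apply]

lemma Intertwines.smul (h : Intertwines J S T) (a : ℂ) : Intertwines J (a • S) (a • T) :=
  fun x => by rw [LinearMap.smul_apply, map_smul, h, LinearMap.smul_apply]

lemma Intertwines.list_prod {ι : Type} (l : List ι) (f : ι → Module.End ℂ H)
    (g : ι → Module.End ℂ K) (h : ∀ i, Intertwines J (f i) (g i)) :
    Intertwines J (l.map f).prod (l.map g).prod := by
  induction l with
  | nil => intro x; rfl
  | cons i l ih =>
    rw [List.map_cons, List.map_cons, List.prod_cons, List.prod_cons]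
    exact (h i).mul ih

end Equivalence

lemma Intertwines.isRestriction {L₁ L₂ : ℕ} {J : Logical L₁ L₂ ≃ₗᵢ[ℂ] codeSpace L₁ L₂}
    {S : Module.End ℂ (Logical L₁ L₂)} {T : Module.End ℂ (QubitSpace (Qubit L₁ L₂))}
    (hT : CommutesWithStabilizers T) (h : Intertwines J S (codeRestrict T)) :
    IsRestriction (conjStar J S) T := by
  intro ψ
  rw [conjStar_apply, h, LinearIsometryEquiv.apply_symm_apply, coe_codeRestrict hT]

/-- For distinct corners `c, x, y, z` there are a sign and an isometry that carries the logical
operators to the encoded ones. -/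
theorem exists_encoding {L₁ L₂ : ℕ} (hodd : Odd ((L₁ - 1) * (L₂ - 1))) {c x y z : Vertex L₁ L₂}
    (hc : c ∈ corners L₁ L₂) (hx : x ∈ corners L₁ L₂) (hy : y ∈ corners L₁ L₂)
    (hz : z ∈ corners L₁ L₂) (hcx : x ≠ c) (hcy : y ≠ c) (hcz : z ≠ c) (hxy : x ≠ y) (hxz : x ≠ z)
    (hyz : y ≠ z) :
    ∃ (ε : ℤˣ) (J : Logical L₁ L₂ ≃ₗᵢ[ℂ] codeSpace L₁ L₂),
      (∀ i j, Adjacent i j →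
        IsRestriction (conjStar J (logicalOp 1 (edgeOp i j))) (encodedEdge i j)) ∧
      (∀ j, IsRestriction (conjStar J (logicalOp 1 (vertexOp j))) (encodedVertex j)) ∧
      IsRestriction (conjStar J (logicalOp 1 (majorana c))) (cornerOp c) ∧
      IsRestriction (conjStar J (logicalOp pauliX (hole ε x))) (cornerOp x) ∧
      IsRestriction (conjStar J (logicalOp pauliY (hole ε y))) (cornerOp y) ∧
      IsRestriction (conjStar J (logicalOp pauliZ (hole ε z))) (cornerOp z) := by
  obtain ⟨ho₁, ho₂⟩ := Nat.odd_mul.1 hodd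
  have h₁ := (even_of_odd_sub_one ho₁).1
  have h₂ := (even_of_odd_sub_one ho₂).1
  have R := code_fermionRelations h₁ h₂
  obtain ⟨Γ, hΓc, hmaj, hcar, hE, hM⟩ := exists_majoranas R (code_face h₁ h₂) hc
  have hMx := hM x hx hcx
  have hMy := hM y hy hcy
  have hMz := hM z hz hcz
  obtain ⟨ε, hε⟩ := exists_corner_sign R hx hy hz hxy hxz hyz hmaj hcar hMx hMy hMz
    (finrank_codeSpace hodd)
  obtain ⟨J, hJ⟩ := IsClifford.exists_isometry _ _ _ _ _
    (logicalFamily_isClifford (L₁ := L₁) (L₂ := L₂) ε)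
    (cornerFamily_isClifford R hx hy hxy hmaj hcar hMx hMy)
    (finrank_logical.trans (finrank_codeSpace hodd).symm)
  have hγ : ∀ v, Intertwines J (logicalOp 1 (majorana v)) (Γ v) := fun v => hJ (some v, false)
  have hA := hJ (none, false)
  have hB := hJ (none, true)
  have hV : ∀ v, Intertwines J (logicalOp 1 (vertexOp v)) (codeRestrict (encodedVertex v)) := by
    intro v
    have hb : Intertwines J (logicalOp 1 (majoranaBar v))
      (Complex.I • (Γ v * codeRestrict (encodedVertex v))) := hJ (some v, true)
    have h := ((hγ v).mul hb).smul (-Complex.I)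
    rw [I_smul_mul_cancel_left (hmaj v).sq, ← logicalOp_vertexOp] at h
    exact h
  have hcorner : ∀ (P : Matrix (Fin 2) (Fin 2) ℂ) (v : Vertex L₁ L₂),
      Intertwines J (((ε : ℤ) : ℂ) • logicalOp P parity)
        (Complex.I • (codeRestrict (cornerOp v) * Γ v)) →
      Intertwines J (logicalOp P (hole ε v)) (codeRestrict (cornerOp v)) := by
    intro P v hP
    have h := (hP.mul (hγ v)).smul (-Complex.I)
    rw [I_smul_mul_cancel (hmaj v).sq, ← logicalOp_hole] at h
    exact h
  refine ⟨ε, J, fun i j hij => ?_, fun v => ?_, ?_, ?_, ?_, ?_⟩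
  · refine Intertwines.isRestriction (edge_commutesWithStabilizers h₁ h₂ hij) ?_
    have h := ((hγ i).mul (hγ j)).smul (-Complex.I)
    rw [← hE i j hij, ← logicalOp_edgeOp] at h
    exact h
  · exact Intertwines.isRestriction (vertex_commutesWithStabilizers h₁ h₂ v) (hV v)
  · refine Intertwines.isRestriction (corner_commutesWithStabilizers h₁ h₂ hc) ?_
    have h := hγ c
    rw [hΓc] at h
    exact h
  · exact Intertwines.isRestriction (corner_commutesWithStabilizers h₁ h₂ hx) (hcorner _ _ hA)
  · exact Intertwines.isRestriction (corner_commutesWithStabilizers h₁ h₂ hy) (hcorner _ _ hB)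
  · refine Intertwines.isRestriction (corner_commutesWithStabilizers h₁ h₂ hz) (hcorner _ _ ?_)
    have hP := Intertwines.list_prod (Finset.univ : Finset (Vertex L₁ L₂)).toList _ _ hV
    rw [← logicalOp_parity] at hP
    have h := ((((show Intertwines J _ _ from hA).mul hB).mul hP).smul (-Complex.I)).smul
      ((ε : ℤ) : ℂ)
    rw [hε, logicalOp_pauliZ_parity ε]
    exact h

end Compact
end

theorem mainTheorem3 (L₁ L₂ : ℕ) (hodd : Odd ((L₁ - 1) * (L₂ - 1))) :
    Fintype.card (Compact.Qubit L₁ L₂) = L₁ * L₂ + ⌈(((L₁ - 1) * (L₂ - 1) : ℕ) : ℚ) / 2⌉₊ ∧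
    {f : Compact.Face L₁ L₂ | Compact.stabilizer f ≠ 1}.ncard =
      ⌊(((L₁ - 1) * (L₂ - 1) : ℕ) : ℚ) / 2⌋₊ ∧
    Module.finrank ℂ (Compact.codeSpace L₁ L₂) = 2 ^ (L₁ * L₂ + 1) ∧
    (Compact.corners L₁ L₂).ncard = 4 ∧
    ∀ c cX cY cZ : Compact.Vertex L₁ L₂, {c, cX, cY, cZ} = Compact.corners L₁ L₂ →
      ∃ ε : ℤˣ,
        Algebra.adjoin ℂ
          ({T : Module.End ℂ (Compact.Logical L₁ L₂) |
              ∃ i j, Compact.Adjacent i j ∧ T = Compact.logicalOp 1 (Compact.edgeOp i j)} ∪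
            {T | ∃ j, T = Compact.logicalOp 1 (Compact.vertexOp j)} ∪
            {Compact.logicalOp 1 (Compact.majorana c),
              Compact.logicalOp Compact.pauliX (Compact.hole ε cX),
              Compact.logicalOp Compact.pauliY (Compact.hole ε cY),
              Compact.logicalOp Compact.pauliZ (Compact.hole ε cZ)}) = ⊤ ∧
        ∃ (μ : Module.End ℂ (Compact.Logical L₁ L₂) ≃⋆ₐ[ℂ]
              Module.End ℂ (Compact.codeSpace L₁ L₂))
          (J : Compact.Logical L₁ L₂ ≃ₗᵢ[ℂ] Compact.codeSpace L₁ L₂),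
          (∀ T φ, μ T (J φ) = J (T φ)) ∧
          (∀ i j, Compact.Adjacent i j → Compact.IsRestriction
            (μ (Compact.logicalOp 1 (Compact.edgeOp i j))) (Compact.encodedEdge i j)) ∧
          (∀ j, Compact.IsRestriction
            (μ (Compact.logicalOp 1 (Compact.vertexOp j))) (Compact.encodedVertex j)) ∧
          Compact.IsRestriction
            (μ (Compact.logicalOp 1 (Compact.majorana c))) (Compact.cornerOp c) ∧
          Compact.IsRestriction
            (μ (Compact.logicalOp Compact.pauliX (Compact.hole ε cX))) (Compact.cornerOp cX) ∧
          Compact.IsRestriction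
            (μ (Compact.logicalOp Compact.pauliY (Compact.hole ε cY))) (Compact.cornerOp cY) ∧
          Compact.IsRestriction
            (μ (Compact.logicalOp Compact.pauliZ (Compact.hole ε cZ))) (Compact.cornerOp cZ) := by
  obtain ⟨k, hk⟩ := hodd
  have hodd : Odd ((L₁ - 1) * (L₂ - 1)) := ⟨k, hk⟩
  obtain ⟨ho₁, ho₂⟩ := Nat.odd_mul.1 hodd
  have hcorners := Compact.corners_ncard (Compact.even_of_odd_sub_one ho₁).2
    (Compact.even_of_odd_sub_one ho₂).2
  refine ⟨?_, ?_, Compact.finrank_codeSpace hodd, hcorners, ?_⟩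
  · rw [Compact.card_qubit hodd, hk]
    congr 1
    symm
    rw [show (2 * k + 1 + 1) / 2 = k + 1 by omega, Nat.ceil_eq_iff (Nat.succ_ne_zero k)]
    push_cast
    constructor <;> linarith
  · have e : {f : Compact.Face L₁ L₂ | Compact.stabilizer f ≠ 1} =
        {f | ¬ Compact.IsOddFace f} := by
      ext f
      exact Compact.stabilizer_ne_one_iff
    rw [e, ← Nat.card_coe_set_eq, Nat.card_eq_fintype_card]
    refine (Compact.card_evenFace hodd).trans ?_
    rw [hk]
    symm
    rw [show (2 * k + 1) / 2 = k by omega, Nat.floor_eq_iff (by positivity)]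
    push_cast
    constructor <;> linarith
  · intro c x y z h
    have mem : ∀ v, v = c ∨ v = x ∨ v = y ∨ v = z → v ∈ Compact.corners L₁ L₂ := by
      intro v hv
      rw [← h]
      simpa using hv
    -- the four vertices are distinct, as there are four corners
    have card : ({c, x, y, z} : Finset (Compact.Vertex L₁ L₂)).card = 4 := by
      rw [← hcorners, ← h, ← Set.ncard_coe_finset]
      simp
    have distinct : x ≠ c ∧ y ≠ c ∧ z ≠ c ∧ x ≠ y ∧ x ≠ z ∧ y ≠ z := by
      have three : ∀ a b d : Compact.Vertex L₁ L₂,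
          ({c, x, y, z} : Finset (Compact.Vertex L₁ L₂)) ≠ {a, b, d} := by
        intro a b d e
        have := Finset.card_le_three (a := a) (b := b) (c := d)
        rw [← e] at this
        omega
      refine ⟨?_, ?_, ?_, ?_, ?_, ?_⟩ <;> rintro rfl
      · exact three x y z (by simp)
      · exact three y x z (by ext; simp; tauto)
      · exact three z x y (by ext; simp; tauto)
      · exact three c x z (by simp)
      · exact three c x y (by ext; simp; tauto)
      · exact three c x y (by simp)
    obtain ⟨d1, d2, d3, d4, d5, d6⟩ := distinct
    obtain ⟨ε, J, hJ⟩ := Compact.exists_encoding hodd (mem c (by simp)) (mem x (by simp))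
      (mem y (by simp)) (mem z (by simp)) d1 d2 d3 d4 d5 d6
    refine ⟨ε, Compact.adjoin_logical_eq_top ε c x y z, Compact.conjStar J, J, fun T φ => ?_, hJ⟩
    rw [Compact.conjStar_apply, LinearIsometryEquiv.symm_apply_apply]
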